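/- Let $W$ be a finite-dimensional $C^*$-weak Hopf algebra over $\mathbb{C}$ (multiplication, unit $1$, comultiplication $\Delta(x)=\sum x^{(1)}\otimes x^{(2)}$, counit $\varepsilon$, antipode $S$, and an involution ${}^*$ with $\Delta(x^*)=\Delta(x)^*$ admitting a faithful $*$-representation on a Hilbert space), and let $\hat W=\operatorname{Hom}(W,\mathbb{C})$ be its dual weak Hopf algebra, with $(\varphi\psi)(x)=\sum\varphi(x^{(1)})\psi(x^{(2)})$, $\hat 1=\varepsilon$, $\langle\hat\Delta(\varphi),x\otimes y\rangle=\varphi(xy)$, $\hat\varepsilon(\varphi)=\varphi(1)$. Put $\varepsilon_L(x)=(\varepsilon\otimes\mathrm{id})(\Delta(1)(x\otimes 1))$ and $\varepsilon_R(x)=(\mathrm{id}\otimes\varepsilon)((1\otimes x)\Delta(1))$. A Haar integral is an element $h$ with $xh=\varepsilon_L(x)h$ and $hx=h\,\varepsilon_R(x)$ for all $x$, and $\varepsilon_L(h)=1=\varepsilon_R(h)$. Let $h$ and $\varphi$ be the Haar integrals of $W$ and $\hat W$, and assume that $h$ is cocommutative, $\Delta^{\mathrm{op}}(h)=\Delta(h)$.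 Fix a finite directed cellulation of a closed oriented surface, every vertex of which meets an edge, given by its rotation system: the cyclic counterclockwise order of the edge ends at each vertex. Let $E$ be its set of edges. On $\mathcal H=\bigotimes_{e\in E}W$ take the inner product extending $\langle x,y\rangle=\varphi(x^*y)$ on each factor, i.e. $\langle\bigotimes x_e,\bigotimes y_e\rangle=\prod_e\varphi(x_e^*y_e)$. On one factor $W$, for $g\in W$ and $\psi\in\hat W$, put $$L_+^g x=gx,\quad L_-^g x=xS^{-1}(g),\quad T_+^\psi x=\sum\psi(x^{(2)})\,x^{(1)},\quad T_-^\psi x=\sum\psi(S(x^{(1)}))\,x^{(2)} .$$ A site $s=(v,f)$ is a corner of a face $f$ at a vertex $v$. For $g\in W$ let $A^g(s)=\sum_{(g)}L^{g^{(1)}}\cdots L^{g^{(n)}}$, where the factors act on the $n$ edge ends at $v$, taken counterclockwise starting from $s$, with $L=L_-$ at the starting vertex and $L=L_+$ at the ending vertex of an edge. For $\psi\in\hat W$ let $B^\psi(s)=\sum_{(\psi)}T^{\psi^{(1)}}\cdots T^{\psi^{(m)}}$, where the factors act on the $m$ edge sides bounding $f$, taken counterclockwise starting from $s$, with $T=T_-$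 if $f$ lies to the left of the directed edge and $T=T_+$ if it lies to its right. Then $A^h(s)=A_v^h$ depends only on the vertex $v$ of $s$, and $B^\varphi(s)=B_f^\varphi$ depends only on the face $f$ of $s$. For all vertices $v$ and faces $f$ these operators are Hermitian projectors for this inner product: $$(A_v^h)^\dagger=A_v^h,\quad (A_v^h)^2=A_v^h,\quad (B_f^\varphi)^\dagger=B_f^\varphi,\quad (B_f^\varphi)^2=B_f^\varphi .$$ Moreover they commute pairwise: $[A_v^h,B_f^\varphi]=0$, $[A_v^h,A_{v'}^h]=0$ and $[B_f^\varphi,B_{f'}^\varphi]=0$ for all vertices $v,v'$ and faces $f,f'$. -/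

import Mathlib

open scoped TensorProduct ComplexConjugate

universe u v

namespace WeakHopf

noncomputable section

/-! ### Weak bialgebras, counital maps, weak Hopf algebras -/

/-- A complex weak bialgebra: an algebra and coalgebra whose comultiplication is multiplicative,
with the weak unit and weak counit axioms. -/
class WeakBialgebra (W : Type u) [Ring W] [Algebra ℂ W] extends Coalgebra ℂ W where
  /-- `Δ(xy) = Δ(x)Δ(y)`. -/
  comul_mul : ∀ x y : W, comul (x * y) = comul x * comul y
  /-- `(Δ ⊗ id)Δ(1) = (Δ(1) ⊗ 1)(1 ⊗ Δ(1))`. -/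
  comul_one_left :
    TensorProduct.assoc ℂ W W W (LinearMap.rTensor W comul (comul (1 : W))) =
      TensorProduct.assoc ℂ W W W (comul (1 : W) ⊗ₜ[ℂ] (1 : W)) * ((1 : W) ⊗ₜ[ℂ] comul (1 : W))
  /-- `(Δ ⊗ id)Δ(1) = (1 ⊗ Δ(1))(Δ(1) ⊗ 1)`. -/
  comul_one_right :
    TensorProduct.assoc ℂ W W W (LinearMap.rTensor W comul (comul (1 : W))) =
      ((1 : W) ⊗ₜ[ℂ] comul (1 : W)) * TensorProduct.assoc ℂ W W W (comul (1 : W) ⊗ₜ[ℂ] (1 : W))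
  /-- `ε(uvw) = ∑ ε(u v⁽¹⁾) ε(v⁽²⁾ w)`. -/
  counit_mul_left : ∀ x y z : W,
    counit (x * y * z) =
      LinearMap.mul' ℂ ℂ (TensorProduct.map (counit ∘ₗ LinearMap.mulLeft ℂ x)
        (counit ∘ₗ LinearMap.mulRight ℂ z) (comul y))
  /-- `ε(uvw) = ∑ ε(u v⁽²⁾) ε(v⁽¹⁾ w)`. -/
  counit_mul_right : ∀ x y z : W,
    counit (x * y * z) =
      LinearMap.mul' ℂ ℂ (TensorProduct.map (counit ∘ₗ LinearMap.mulLeft ℂ x)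
        (counit ∘ₗ LinearMap.mulRight ℂ z) (TensorProduct.comm ℂ W W (comul y)))

section Counital

variable {A : Type u} [Ring A] [Algebra ℂ A] [Coalgebra ℂ A]

/-- `ε_L(x) = (ε ⊗ id)(Δ(1)(x ⊗ 1))`. -/
def epsL (x : A) : A :=
  TensorProduct.lid ℂ A (LinearMap.rTensor A (Coalgebra.counit (R := ℂ) (A := A))
    (Coalgebra.comul (R := ℂ) (1 : A) * (x ⊗ₜ[ℂ] (1 : A))))

/-- `ε_R(x) = (id ⊗ ε)((1 ⊗ x)Δ(1))`. -/
def epsR (x : A) : A :=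
  TensorProduct.rid ℂ A (LinearMap.lTensor A (Coalgebra.counit (R := ℂ) (A := A))
    (((1 : A) ⊗ₜ[ℂ] x) * Coalgebra.comul (R := ℂ) (1 : A)))

/-- A Haar integral: a two-sided integral that is normalized on both sides. -/
structure IsHaarIntegral (h : A) : Prop where
  left_integral : ∀ x : A, x * h = epsL x * h
  right_integral : ∀ x : A, h * x = h * epsR x
  left_normalized : epsL h = 1
  right_normalized : epsR h = 1

/-- `Δ(h) = Δᵒᵖ(h)`. -/
def IsCocommutative (h : A) : Prop :=
  TensorProduct.comm ℂ A A (Coalgebra.comul (R := ℂ) h) = Coalgebra.comul (R := ℂ) h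

end Counital

/-- A complex weak Hopf algebra: a weak bialgebra with an antipode `S`. -/
class WeakHopfAlgebra (W : Type u) [Ring W] [Algebra ℂ W] extends WeakBialgebra W where
  /-- The antipode. -/
  antipode : W →ₗ[ℂ] W
  /-- `∑ x⁽¹⁾ S(x⁽²⁾) = ε_L(x)`. -/
  mul_lTensor_antipode : ∀ x : W,
    LinearMap.mul' ℂ W (LinearMap.lTensor W antipode (comul x)) = epsL x
  /-- `∑ S(x⁽¹⁾) x⁽²⁾ = ε_R(x)`. -/
  mul_rTensor_antipode : ∀ x : W,
    LinearMap.mul' ℂ W (LinearMap.rTensor W antipode (comul x)) = epsR x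
  /-- `∑ S(x⁽¹⁾) x⁽²⁾ S(x⁽³⁾) = S(x)`. -/
  antipode_mul_antipode : ∀ x : W,
    LinearMap.mul' ℂ W (TensorProduct.map antipode
      (LinearMap.mul' ℂ W ∘ₗ LinearMap.lTensor W antipode ∘ₗ comul) (comul x)) = antipode x

/-- A `C⋆`-weak Hopf algebra: the comultiplication is a `⋆`-homomorphism, and the underlying
`⋆`-algebra has a faithful `⋆`-representation on a Hilbert space. -/
class CStarWeakHopfAlgebra (W : Type u) [Ring W] [Algebra ℂ W] [StarRing W] [StarModule ℂ W]
    extends WeakHopfAlgebra W where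
  /-- `Δ(x⋆) = Δ(x)⋆`. -/
  comul_star : ∀ x : W, comul (star x) = star (comul x)
  /-- There is a faithful `⋆`-representation on a Hilbert space. -/
  exists_faithful_rep : ∃ (K : Type u) (_ : NormedAddCommGroup K) (_ : InnerProductSpace ℂ K)
    (_ : CompleteSpace K) (ρ : W →⋆ₐ[ℂ] (K →L[ℂ] K)), Function.Injective ρ

/-! ### The dual -/

/-- The dual space `Ŵ = Hom(W, ℂ)`. As a type of linear maps tagged by `WithConv` it carries the
convolution product `(φψ)(x) = ∑ φ(x⁽¹⁾)ψ(x⁽²⁾)`, whose unit is `ε`. -/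
abbrev DualAlg (W : Type u) [Ring W] [Algebra ℂ W] : Type u := WithConv (W →ₗ[ℂ] ℂ)

section Dual

variable {W : Type u} [Ring W] [Algebra ℂ W]

/-- The pairing of `Ŵ ⊗ Ŵ` with `W ⊗ W`; an isomorphism `Ŵ ⊗ Ŵ ≃ (W ⊗ W)^∨` when `W` is finite
dimensional. -/
def dualTensorEquiv (W : Type u) [Ring W] [Algebra ℂ W] [Module.Finite ℂ W] :
    (DualAlg W ⊗[ℂ] DualAlg W) ≃ₗ[ℂ] Module.Dual ℂ (W ⊗[ℂ] W) :=
  (TensorProduct.congr (WithConv.linearEquiv ℂ (W →ₗ[ℂ] ℂ))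
    (WithConv.linearEquiv ℂ (W →ₗ[ℂ] ℂ))).trans (TensorProduct.dualDistribEquiv ℂ W W)

@[simp]
theorem dualTensorEquiv_tmul [Module.Finite ℂ W] (φ ψ : DualAlg W) (x y : W) :
    dualTensorEquiv W (φ ⊗ₜ[ℂ] ψ) (x ⊗ₜ[ℂ] y) = φ x * ψ y := by
  simp [dualTensorEquiv, TensorProduct.dualDistribEquiv, TensorProduct.dualDistribEquivOfBasis]

/-- The comultiplication of `Ŵ`: `⟨Δ̂(φ), x ⊗ y⟩ = φ(xy)`. -/
def dualComul (W : Type u) [Ring W] [Algebra ℂ W] [Module.Finite ℂ W] :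
    DualAlg W →ₗ[ℂ] DualAlg W ⊗[ℂ] DualAlg W :=
  (dualTensorEquiv W).symm.toLinearMap ∘ₗ Module.Dual.transpose (LinearMap.mul' ℂ W) ∘ₗ
    (WithConv.linearEquiv ℂ (W →ₗ[ℂ] ℂ)).toLinearMap

theorem dualComul_pairing [Module.Finite ℂ W] (φ : DualAlg W) (x y : W) :
    dualTensorEquiv W (dualComul W φ) (x ⊗ₜ[ℂ] y) = φ (x * y) := by
  simp [dualComul, Module.Dual.transpose]

/-- The counit of `Ŵ`: `ε̂(φ) = φ(1)`. -/
def dualCounit (W : Type u) [Ring W] [Algebra ℂ W] : DualAlg W →ₗ[ℂ] ℂ :=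
  Module.Dual.eval ℂ W 1 ∘ₗ (WithConv.linearEquiv ℂ (W →ₗ[ℂ] ℂ)).toLinearMap


/-- Evaluation of the first tensor factor at `x`. -/
def evalFst {U : Type u} [AddCommGroup U] [Module ℂ U] (x : W) :
    DualAlg W ⊗[ℂ] U →ₗ[ℂ] U :=
  (TensorProduct.lid ℂ U).toLinearMap ∘ₗ LinearMap.rTensor U
    (Module.Dual.eval ℂ W x ∘ₗ (WithConv.linearEquiv ℂ (W →ₗ[ℂ] ℂ)).toLinearMap)

theorem evalFst_tmul {U : Type u} [AddCommGroup U] [Module ℂ U] (x : W) (φ : DualAlg W)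
    (y : U) : evalFst x (φ ⊗ₜ[ℂ] y) = φ x • y := by
  simp [evalFst]

theorem evalFst_ext [Module.Finite ℂ W] {U : Type u} [AddCommGroup U] [Module ℂ U]
    {s t : DualAlg W ⊗[ℂ] U} (h : ∀ x : W, evalFst x s = evalFst x t) : s = t := by
  let e := (TensorProduct.congr (WithConv.linearEquiv ℂ (W →ₗ[ℂ] ℂ))
    (LinearEquiv.refl ℂ U)).trans (dualTensorHomEquiv ℂ W U)
  have he : ∀ (r : DualAlg W ⊗[ℂ] U) (x : W), e r x = evalFst x r := by
    intro r x
    induction r with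
    | zero => simp
    | tmul a b => simp [e, evalFst_tmul]
    | add a b ha hb => simp [ha, hb]
  apply e.injective
  ext x
  rw [he, he, h]

theorem dual_ext [Module.Finite ℂ W] {s t : DualAlg W ⊗[ℂ] DualAlg W}
    (h : ∀ x y : W, dualTensorEquiv W s (x ⊗ₜ[ℂ] y) = dualTensorEquiv W t (x ⊗ₜ[ℂ] y)) : s = t := by
  apply (dualTensorEquiv W).injective
  exact TensorProduct.ext' h

theorem pair_assoc [Module.Finite ℂ W] (s : DualAlg W ⊗[ℂ] DualAlg W) (ψ : DualAlg W)
    (x y z : W) :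
    dualTensorEquiv W (evalFst x (TensorProduct.assoc ℂ _ _ _ (s ⊗ₜ[ℂ] ψ))) (y ⊗ₜ[ℂ] z) =
      dualTensorEquiv W s (x ⊗ₜ[ℂ] y) * ψ z := by
  induction s with
  | zero => simp
  | tmul a b => simp [evalFst_tmul, mul_assoc]
  | add a b ha hb => simp only [TensorProduct.add_tmul, map_add, LinearMap.add_apply, ha, hb, add_mul]

theorem pair_rTensor [Module.Finite ℂ W] (t : DualAlg W ⊗[ℂ] DualAlg W) (x y z : W) :
    dualTensorEquiv W (evalFst x (TensorProduct.assoc ℂ _ _ _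
      (LinearMap.rTensor _ (dualComul W) t))) (y ⊗ₜ[ℂ] z) =
      dualTensorEquiv W t ((x * y) ⊗ₜ[ℂ] z) := by
  induction t with
  | zero => simp
  | tmul a b => rw [LinearMap.rTensor_tmul, pair_assoc, dualComul_pairing, dualTensorEquiv_tmul]
  | add a b ha hb => simp only [map_add, LinearMap.add_apply, ha, hb]

theorem pair_lTensor [Module.Finite ℂ W] (t : DualAlg W ⊗[ℂ] DualAlg W) (x y z : W) :
    dualTensorEquiv W (evalFst x (LinearMap.lTensor _ (dualComul W) t)) (y ⊗ₜ[ℂ] z) =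
      dualTensorEquiv W t (x ⊗ₜ[ℂ] (y * z)) := by
  induction t with
  | zero => simp
  | tmul a b =>
    rw [LinearMap.lTensor_tmul, evalFst_tmul, map_smul, LinearMap.smul_apply, dualComul_pairing,
      dualTensorEquiv_tmul, smul_eq_mul]
  | add a b ha hb => simp only [map_add, LinearMap.add_apply, ha, hb]

/-- The coalgebra structure of `Ŵ`, dual to the algebra structure of `W`. -/
instance dualCoalgebra [Module.Finite ℂ W] : Coalgebra ℂ (DualAlg W) where
  comul := dualComul W
  counit := dualCounit W
  coassoc := by
    apply LinearMap.ext
    intro φ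
    apply evalFst_ext
    intro x
    apply dual_ext
    intro y z
    simp only [LinearMap.comp_apply, LinearEquiv.coe_coe]
    rw [pair_rTensor, pair_lTensor, dualComul_pairing, dualComul_pairing, mul_assoc]
  rTensor_counit_comp_comul := by
    have key : ∀ (t : DualAlg W ⊗[ℂ] DualAlg W) (x : W),
        (TensorProduct.lid ℂ _ (LinearMap.rTensor _ (dualCounit W) t)) x =
          dualTensorEquiv W t (1 ⊗ₜ[ℂ] x) := by
      intro t x
      induction t with
      | zero => simp
      | tmul a b => simp [dualCounit]
      | add a b ha hb => simp only [map_add, LinearMap.add_apply, WithConv.ofConv_add, ha, hb]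
    apply LinearMap.ext
    intro φ
    apply (TensorProduct.lid ℂ (DualAlg W)).injective
    apply WithConv.ext
    apply LinearMap.ext
    intro x
    rw [LinearMap.comp_apply, key, dualComul_pairing]
    simp
  lTensor_counit_comp_comul := by
    have key : ∀ (t : DualAlg W ⊗[ℂ] DualAlg W) (x : W),
        (TensorProduct.rid ℂ _ (LinearMap.lTensor _ (dualCounit W) t)) x =
          dualTensorEquiv W t (x ⊗ₜ[ℂ] 1) := by
      intro t x
      induction t with
      | zero => simp
      | tmul a b => simp [dualCounit, mul_comm]
      | add a b ha hb => simp only [map_add, LinearMap.add_apply, WithConv.ofConv_add, ha, hb]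
    apply LinearMap.ext
    intro φ
    apply (TensorProduct.rid ℂ (DualAlg W)).injective
    apply WithConv.ext
    apply LinearMap.ext
    intro x
    rw [LinearMap.comp_apply, key, dualComul_pairing]
    simp

end Dual

/-! ### Local actions on one edge -/

section LocalActions

variable {W : Type u} [Ring W] [Algebra ℂ W] [WeakHopfAlgebra W]

/-- The inverse `S⁻¹` of the antipode in the ring of linear endomorphisms of `W`; the antipode of
a finite-dimensional weak Hopf algebra is bijective, so this is the inverse map. -/
def antipodeInv (W : Type u) [Ring W] [Algebra ℂ W] [WeakHopfAlgebra W] : Module.End ℂ W :=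
  Ring.inverse (WeakHopfAlgebra.antipode : Module.End ℂ W)

/-- `L₊ʰ x = h x`. -/
def Lplus : W →ₗ[ℂ] Module.End ℂ W := LinearMap.mul ℂ W

/-- `L₋ʰ x = x S⁻¹(h)`. -/
def Lminus : W →ₗ[ℂ] Module.End ℂ W := (LinearMap.mul ℂ W).flip ∘ₗ antipodeInv W

/-- `T₊^φ x = ∑ ⟨φ, x⁽²⁾⟩ x⁽¹⁾`. -/
def Tplus : DualAlg W →ₗ[ℂ] Module.End ℂ W where
  toFun φ := (TensorProduct.rid ℂ W).toLinearMap ∘ₗ LinearMap.lTensor W φ.ofConv ∘ₗ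
    Coalgebra.comul
  map_add' φ ψ := by
    simp [LinearMap.lTensor_add, LinearMap.add_comp, LinearMap.comp_add]
  map_smul' c φ := by
    simp [LinearMap.lTensor_smul, LinearMap.smul_comp, LinearMap.comp_smul]

/-- `T₋^φ x = ∑ ⟨φ, S(x⁽¹⁾)⟩ x⁽²⁾`. -/
def Tminus : DualAlg W →ₗ[ℂ] Module.End ℂ W where
  toFun φ := (TensorProduct.lid ℂ W).toLinearMap ∘ₗ
    LinearMap.rTensor W (φ.ofConv ∘ₗ WeakHopfAlgebra.antipode) ∘ₗ Coalgebra.comul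
  map_add' φ ψ := by
    simp [LinearMap.add_comp, LinearMap.rTensor_add, LinearMap.comp_add]
  map_smul' c φ := by
    simp [LinearMap.smul_comp, LinearMap.rTensor_smul, LinearMap.comp_smul]

end LocalActions

/-! ### Directed lattices on closed oriented surfaces -/

/-- A directed lattice (a directed cellulation of a closed oriented surface) with edge set `E`,
given by its rotation system. A dart is an end of an edge: `(e, true)` is the end of `e` at its
starting vertex and `(e, false)` is the end of `e` at its ending vertex; both are thought of as
pointing away from that vertex. The permutation `rot` sends a dart to the next dart
counterclockwise around the same vertex. -/
structure DirectedLattice (E : Type v) where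
  /-- The next dart counterclockwise around the same vertex. -/
  rot : Equiv.Perm (E × Bool)

namespace DirectedLattice

variable {E : Type v} (C : DirectedLattice E)

/-- The opposite end of the same edge. -/
def flip : Equiv.Perm (E × Bool) :=
  Equiv.prodCongr (Equiv.refl E) Equiv.boolNot

/-- Walking along a dart away from its vertex, with a face on the left, one arrives at the opposite
dart and continues along the dart that is next clockwise: this goes counterclockwise around the
face. -/
def faceRot : Equiv.Perm (E × Bool) := flip.trans C.rot.symm

/-- Vertices are the cycles of `rot`. -/
def Vertex : Type v := Quotient (Equiv.Perm.SameCycle.setoid C.rot)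

/-- Faces are the cycles of `faceRot`; a dart belongs to the face on its left. -/
def Face : Type v := Quotient (Equiv.Perm.SameCycle.setoid C.faceRot)

/-- A site is a corner of a face at a vertex. It is recorded by the first dart that one meets when
going counterclockwise around the vertex from that corner, so the face of the site lies to the right
of this dart and to the left of the dart preceding it around the vertex. -/
abbrev Site (_C : DirectedLattice E) : Type v := E × Bool

/-- The vertex of a site. -/
def siteVertex (s : C.Site) : C.Vertex := Quotient.mk _ s

/-- The face of a site. -/
def siteFace (s : C.Site) : C.Face := Quotient.mk _ (C.rot.symm s)

/-- The cycle of a permutation through `x`, listed once around, starting at `x`. -/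
def cycleList (p : Equiv.Perm (E × Bool)) (x : E × Bool) : List (E × Bool) :=
  (List.range (Function.minimalPeriod p x)).map fun k => (p ^ k) x

/-- The darts around the vertex of `s`, counterclockwise from `s`. -/
def vertexDarts (s : C.Site) : List (E × Bool) := cycleList C.rot s

/-- The darts traversed when going around the face of `s`, counterclockwise from `s`. -/
def faceDarts (s : C.Site) : List (E × Bool) := cycleList C.faceRot (C.rot.symm s)

end DirectedLattice

/-! ### Vertex and face operators -/

section Model

variable (W : Type u) [Ring W] [Algebra ℂ W] (E : Type v)

/-- The total space `⨂_{e ∈ E} W`. -/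
abbrev TotalSpace : Type (max u v) := ⨂[ℂ] _ : E, W

variable {W E}

/-- The operator on the total space that applies `T` to the tensor factor of the edge `e`. -/
def onEdge [DecidableEq E] (e : E) : Module.End ℂ W →ₗ[ℂ] Module.End ℂ (TotalSpace W E) :=
  (PiTensorProduct.mapMultilinear ℂ (fun _ : E => W) (fun _ : E => W)).toLinearMap
    (fun _ => LinearMap.id) e

theorem onEdge_tprod [DecidableEq E] (e : E) (T : Module.End ℂ W) (x : E → W) :
    onEdge e T (PiTensorProduct.tprod ℂ x) =
      PiTensorProduct.tprod ℂ (Function.update x e (T (x e))) := by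
  simp only [onEdge, MultilinearMap.toLinearMap_apply, PiTensorProduct.mapMultilinear_apply,
    PiTensorProduct.map_tprod]
  congr 1
  funext i
  by_cases h : i = e
  · subst h; simp
  · simp [h]

variable [WeakHopfAlgebra W] [DecidableEq E]

/-- The action of `W` at a dart: `L₋` at the starting vertex of an edge, `L₊` at the ending
vertex. -/
def dartL (d : E × Bool) : W →ₗ[ℂ] Module.End ℂ (TotalSpace W E) :=
  onEdge d.1 ∘ₗ (if d.2 then Lminus else Lplus)

/-- The action of `Ŵ` for the face to the left of a dart. The dual edge starts at the face to the
right of the edge and ends at the face to its left, so `T₋` acts for the face on the left of the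
edge and `T₊` for the face on its right. -/
def dartT (d : E × Bool) : DualAlg W →ₗ[ℂ] Module.End ℂ (TotalSpace W E) :=
  onEdge d.1 ∘ₗ (if d.2 then Tminus else Tplus)

/-- `Aʰ(s) = ∑ L^{h⁽¹⁾}(d₁) L^{h⁽²⁾}(d₂) ⋯ L^{h⁽ⁿ⁾}(dₙ)`, where `d₁, …, dₙ` are the darts
counterclockwise around the vertex of `s` from `s`. The sum over the iterated coproduct is the
convolution product of linear maps from `W` to the operators. -/
def siteA (C : DirectedLattice E) (s : C.Site) : W →ₗ[ℂ] Module.End ℂ (TotalSpace W E) :=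
  (((C.vertexDarts s).map fun d => WithConv.toConv (dartL (W := W) d)).prod).ofConv

/-- `B^φ(s) = ∑ T^{φ⁽¹⁾}(c₁) T^{φ⁽²⁾}(c₂) ⋯ T^{φ⁽ⁿ⁾}(cₙ)`, where `c₁, …, cₙ` are the darts
counterclockwise around the face of `s` from `s`. -/
def siteB [Module.Finite ℂ W] (C : DirectedLattice E) (s : C.Site) :
    DualAlg W →ₗ[ℂ] Module.End ℂ (TotalSpace W E) :=
  (((C.faceDarts s).map fun d => WithConv.toConv (dartT (W := W) d)).prod).ofConv

/-- `A_vʰ`, computed from a chosen site at `v`. -/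
def vertexOp (C : DirectedLattice E) (h : W) (v : C.Vertex) : Module.End ℂ (TotalSpace W E) :=
  siteA C v.out h

/-- `B_f^φ`, computed from a chosen site at `f`. -/
def faceOp [Module.Finite ℂ W] (C : DirectedLattice E) (φ : DualAlg W) (f : C.Face) :
    Module.End ℂ (TotalSpace W E) :=
  siteB C (C.rot f.out) φ

end Model

/-! ### The inner product defined by the Haar measure -/

section InnerProduct

variable {W : Type u} [Ring W] [Algebra ℂ W] [StarRing W] [StarModule ℂ W] {E : Type v}

/-- The conjugate-linear involution `⨂ x_e ↦ ⨂ x_e⋆` of the total space. -/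
def totalStar : TotalSpace W E →ₗ⋆[ℂ] TotalSpace W E :=
  let f : TotalSpace W E →+ TotalSpace W E :=
    PiTensorProduct.liftAddHom
      (fun p => PiTensorProduct.tprodCoeff ℂ (star p.1) (fun e => star (p.2 e)))
      (fun r x e he => PiTensorProduct.zero_tprodCoeff' _ _ e (by simp [he]))
      (fun x => by simp)
      (fun r x e a b => by
        have key : ∀ c : W, (fun i => star (Function.update x e c i)) =
            Function.update (fun i => star (x i)) e (star c) := by
          intro c; funext i
          by_cases h : i = e
          · subst h; simp
          · simp [h]
        simp only [key, star_add, PiTensorProduct.add_tprodCoeff])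
      (fun r r' x => by simp [add_smul])
      (fun r x e c => by
        have key : (fun i => star (Function.update x e (c • x e) i)) =
            Function.update (fun i => star (x i)) e (star c • star (x e)) := by
          funext i
          by_cases h : i = e
          · subst h; simp
          · simp [h]
        simp only [key]
        rw [PiTensorProduct.smul_tprodCoeff (R₁ := ℂ) (star r) (fun i => star (x i)) e (star c)]
        simp [mul_comm])
  have hf : ∀ (r : ℂ) (x : E → W), f (PiTensorProduct.tprodCoeff ℂ r x) =
      PiTensorProduct.tprodCoeff ℂ (star r) (fun e => star (x e)) := by
    intro r x
    rfl
  { f with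
    map_smul' := by
      intro c z
      change f (c • z) = (starRingEnd ℂ c) • f z
      induction z using PiTensorProduct.induction_on' with
      | tprodCoeff r x =>
        rw [PiTensorProduct.smul_tprodCoeff', hf, hf, PiTensorProduct.smul_tprodCoeff']
        simp
      | add a b ha hb => rw [smul_add, map_add, map_add, ha, hb, smul_add] }

theorem totalStar_tprod (x : E → W) :
    totalStar (PiTensorProduct.tprod ℂ x) = PiTensorProduct.tprod ℂ (fun e => star (x e)) := by
  change PiTensorProduct.tprodCoeff ℂ (star (1 : ℂ)) _ = PiTensorProduct.tprodCoeff ℂ 1 _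
  simp

variable [Fintype E]

/-- The functional `⨂ x_e ↦ ∏ φ(x_e)` on the total space. -/
def totalFunctional (φ : W →ₗ[ℂ] ℂ) : TotalSpace W E →ₗ[ℂ] ℂ :=
  PiTensorProduct.lift ((MultilinearMap.mkPiAlgebra ℂ E ℂ).compLinearMap fun _ => φ)

/-- The Haar inner product `⟨x, y⟩ = φ(x⋆y)` on each tensor factor, extended to the total space:
conjugate-linear in the first variable, linear in the second, and
`⟨⨂ x_e, ⨂ y_e⟩ = ∏ φ(x_e⋆ y_e)`. -/
def haarInner (φ : DualAlg W) (x y : TotalSpace W E) : ℂ :=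
  totalFunctional φ.ofConv (totalStar x * y)

theorem haarInner_tprod (φ : DualAlg W) (x y : E → W) :
    haarInner φ (PiTensorProduct.tprod ℂ x) (PiTensorProduct.tprod ℂ y) =
      ∏ e, φ (star (x e) * y e) := by
  simp [haarInner, totalStar_tprod, totalFunctional, PiTensorProduct.tprod_mul_tprod]

/-- `T` is Hermitian, `T† = T`, for the Haar inner product. -/
def IsHermitian (φ : DualAlg W) (T : Module.End ℂ (TotalSpace W E)) : Prop :=
  ∀ x y : TotalSpace W E, haarInner φ (T x) y = haarInner φ x (T y)

end InnerProduct

end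

end WeakHopf

/-! Cocommutativity of `h` has three consequences on which everything rests.

The antipode is involutive. A left integral satisfies `(S(x) ⊗ 1)Δ(h) = (1 ⊗ x)Δ(h)`; comparing this
with its flip gives `(S²(x) ⊗ 1)Δ(h) = (x ⊗ 1)Δ(h)`, and `ε_L(h) = 1` allows the first factor to be
read off (`antipode_antipode`).

The functional `φ` is a trace. It satisfies `φ(S(x)) = χ(xq)`, where `χ` is the regular character
and `q = (φ ⊗ id)Δ(h)`, and `q` is central (`haar_mul_comm`). Equivalently, `φ` is cocommutative in
the dual.

The functional `φ` is invariant, `∑ φ(x⁽¹⁾y)x⁽²⁾ = ∑ φ(xy⁽¹⁾)S(y⁽²⁾)`, and normalized invariant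
functionals are unique up to `S` (`apply_antipode_eq`). Hence `φ ∘ S = φ` and `φ(x⋆) = conj φ(x)`.

A site operator is a convolution product of multiplicative maps, one per dart, and maps at distinct
darts commute. So it is itself multiplicative, and `h² = h`, `φ² = φ` give idempotents
(`convList_map_mul`); cocommutativity makes the starting dart irrelevant (`convList_rotate`);
adjointness passes from single darts to products (`convList_adjoint`), with `h⋆ = h` and `φ⋆ = φ`;
and operators of distinct vertices, or of distinct faces, involve disjoint sets of darts.

The delicate point is a vertex against a face, which may meet at several corners. A face operator is
treated as a cyclic word of letters in which elements of `W` can be inserted at the corners;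
cyclicity is the trace property of `φ`. Moving the action at a dart across the word consumes an
insertion at the corner on one side of the dart and creates one at the corner on the other side.
Moving all actions around the vertex therefore carries an insertion once around the vertex and back
to its corner, where it has jumped from one side of any fixed insertion to the other
(`FaceCalculus.wordL_mul_convList`). With a fixed insertion `S(h⁽¹⁾)`, cocommutativity of `h`
converts this exchange into commutation (`unit_mul_apply_of_exchange`). -/

namespace WeakHopf

noncomputable section

open Coalgebra WithConv LinearMap

/-! ### Tensor squares and the counital maps -/

section Tensor
variable {A : Type u} [Ring A] [Algebra ℂ A]

/-- `x ↦ x ⊗ 1`. -/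
def inclL (A : Type u) [Ring A] [Algebra ℂ A] : A →ₗ[ℂ] A ⊗[ℂ] A := (TensorProduct.mk ℂ A A).flip 1
/-- `x ↦ 1 ⊗ x`. -/
def inclR (A : Type u) [Ring A] [Algebra ℂ A] : A →ₗ[ℂ] A ⊗[ℂ] A := TensorProduct.mk ℂ A A 1

@[simp] theorem inclL_apply (x : A) : inclL A x = x ⊗ₜ[ℂ] 1 := rfl
@[simp] theorem inclR_apply (x : A) : inclR A x = 1 ⊗ₜ[ℂ] x := rfl

theorem assoc_mul (s t : (A ⊗[ℂ] A) ⊗[ℂ] A) :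
    TensorProduct.assoc ℂ A A A (s * t) =
      TensorProduct.assoc ℂ A A A s * TensorProduct.assoc ℂ A A A t :=
  map_mul (Algebra.TensorProduct.assoc ℂ ℂ ℂ A A A) s t

end Tensor

section Counital
variable {A : Type u} [Ring A] [Algebra ℂ A] [Coalgebra ℂ A]

/-- `ε_L` as a linear map. -/
def epsLMap (A : Type u) [Ring A] [Algebra ℂ A] [Coalgebra ℂ A] : A →ₗ[ℂ] A :=
  (TensorProduct.lid ℂ A).toLinearMap ∘ₗ rTensor A (counit (R := ℂ) (A := A)) ∘ₗ
    mulLeft ℂ (comul (R := ℂ) (1 : A)) ∘ₗ (TensorProduct.mk ℂ A A).flip 1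

/-- `ε_R` as a linear map. -/
def epsRMap (A : Type u) [Ring A] [Algebra ℂ A] [Coalgebra ℂ A] : A →ₗ[ℂ] A :=
  (TensorProduct.rid ℂ A).toLinearMap ∘ₗ lTensor A (counit (R := ℂ) (A := A)) ∘ₗ
    mulRight ℂ (comul (R := ℂ) (1 : A)) ∘ₗ TensorProduct.mk ℂ A A 1

theorem epsLMap_apply (x : A) : epsLMap A x = epsL x := rfl
theorem epsRMap_apply (x : A) : epsRMap A x = epsR x := rfl

/-- `ε'_L(x) = ∑ ε(x 1⁽¹⁾) 1⁽²⁾`. -/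
def epsLOp (A : Type u) [Ring A] [Algebra ℂ A] [Coalgebra ℂ A] : A →ₗ[ℂ] A :=
  (TensorProduct.lid ℂ A).toLinearMap ∘ₗ rTensor A (counit (R := ℂ) (A := A)) ∘ₗ
    mulRight ℂ (comul (R := ℂ) (1 : A)) ∘ₗ (TensorProduct.mk ℂ A A).flip 1

/-- `ε'_R(x) = ∑ 1⁽¹⁾ ε(1⁽²⁾ x)`. -/
def epsROp (A : Type u) [Ring A] [Algebra ℂ A] [Coalgebra ℂ A] : A →ₗ[ℂ] A :=
  (TensorProduct.rid ℂ A).toLinearMap ∘ₗ lTensor A (counit (R := ℂ) (A := A)) ∘ₗ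
    mulLeft ℂ (comul (R := ℂ) (1 : A)) ∘ₗ TensorProduct.mk ℂ A A 1

theorem epsL_eq_sum {ι : Type*} (r : Repr ℂ (1 : A) ι) (x : A) :
    epsL x = ∑ i ∈ r.index, counit (R := ℂ) (r.left i * x) • r.right i := by
  simp [epsL, ← r.eq, Finset.sum_mul]

theorem epsR_eq_sum {ι : Type*} (r : Repr ℂ (1 : A) ι) (x : A) :
    epsR x = ∑ i ∈ r.index, counit (R := ℂ) (x * r.right i) • r.left i := by
  simp [epsR, ← r.eq, Finset.mul_sum]

theorem epsLOp_eq_sum {ι : Type*} (r : Repr ℂ (1 : A) ι) (x : A) :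
    epsLOp A x = ∑ i ∈ r.index, counit (R := ℂ) (x * r.left i) • r.right i := by
  simp [epsLOp, ← r.eq, Finset.mul_sum]

theorem epsROp_eq_sum {ι : Type*} (r : Repr ℂ (1 : A) ι) (x : A) :
    epsROp A x = ∑ i ∈ r.index, counit (R := ℂ) (r.right i * x) • r.left i := by
  simp [epsROp, ← r.eq, Finset.sum_mul]

theorem sum_counit_smul_right {ι : Type*} {x : A} (r : Repr ℂ x ι) :
    ∑ i ∈ r.index, counit (R := ℂ) (r.right i) • r.left i = x := by
  have := lTensor_counit_comul (R := ℂ) x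
  rw [← r.eq] at this
  simpa only [map_sum, lTensor_tmul, TensorProduct.rid_tmul, one_smul] using
    congrArg (TensorProduct.rid ℂ A) this

theorem inclL_mul_inclR (f g : A →ₗ[ℂ] A) (x : A) :
    (toConv (inclL A ∘ₗ f) * toConv (inclR A ∘ₗ g)) x = TensorProduct.map f g (comul x) := by
  rw [(ℛ ℂ x).convMul_apply, ← (ℛ ℂ x).eq]
  simp

end Counital

/-! ### Identities of weak bialgebras: `Δ(1)` and the counital subalgebras -/

section Bialgebra
variable {W : Type u} [Ring W] [Algebra ℂ W] [WeakBialgebra W]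

/-- `id ⊗ ε ⊗ id`. -/
def counitMiddle (W : Type u) [Ring W] [Algebra ℂ W] [Coalgebra ℂ W] :
    W ⊗[ℂ] (W ⊗[ℂ] W) →ₗ[ℂ] W ⊗[ℂ] W :=
  lTensor W ((TensorProduct.lid ℂ W).toLinearMap ∘ₗ rTensor W (counit (R := ℂ) (A := W)))

@[simp] theorem counitMiddle_tmul (x y z : W) :
    counitMiddle W (x ⊗ₜ (y ⊗ₜ z)) = x ⊗ₜ[ℂ] (counit (R := ℂ) y • z) := by
  simp [counitMiddle]

theorem counitMiddle_assoc (t : W ⊗[ℂ] W) (w : W) :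
    counitMiddle W (TensorProduct.assoc ℂ W W W (t ⊗ₜ w)) =
      TensorProduct.rid ℂ W (lTensor W (counit (R := ℂ) (A := W)) t) ⊗ₜ[ℂ] w := by
  induction t with
  | zero => simp
  | tmul a b => simp [TensorProduct.smul_tmul]
  | add a b ha hb => simp only [TensorProduct.add_tmul, map_add, ha, hb]

theorem counitMiddle_comul_tmul (x w : W) :
    counitMiddle W (TensorProduct.assoc ℂ W W W (comul x ⊗ₜ w)) = x ⊗ₜ[ℂ] w := by
  rw [counitMiddle_assoc, lTensor_counit_comul]; simp

theorem counitMiddle_tmul_comul (x w : W) :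
    counitMiddle W (w ⊗ₜ comul x) = w ⊗ₜ[ℂ] x := by
  rw [counitMiddle, lTensor_tmul, comp_apply, rTensor_counit_comul]; simp

theorem comul_one_mul (x : W) : comul (R := ℂ) (1 : W) * comul x = comul x := by
  rw [← WeakBialgebra.comul_mul, one_mul]

theorem comul_mul_one (x : W) : comul x * comul (R := ℂ) (1 : W) = comul x := by
  rw [← WeakBialgebra.comul_mul, mul_one]

/-- Multiply a weak unit axiom by `Δ(x) ⊗ 1` and apply the counit to the middle leg; one side
collapses because `Δ(1)Δ(x) = Δ(x)`. The next three lemmas vary the axiom, the side of the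
multiplication and the position of `Δ(x)`. -/
theorem map_id_epsL_comul (x : W) :
    TensorProduct.map LinearMap.id (epsLMap W) (comul x) = comul (R := ℂ) 1 * (x ⊗ₜ[ℂ] 1) := by
  have h := congrArg (fun t => counitMiddle W
    (t * TensorProduct.assoc ℂ W W W (comul x ⊗ₜ[ℂ] (1 : W)))) (WeakBialgebra.comul_one_right (W := W))
  beta_reduce at h
  rw [mul_assoc, ← assoc_mul, ← assoc_mul, Algebra.TensorProduct.tmul_mul_tmul, comul_one_mul,
    mul_one] at h
  set r := ℛ ℂ (1 : W)
  have h1 : counitMiddle W (TensorProduct.assoc ℂ W W W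
      (rTensor W comul (comul (1 : W)) * comul x ⊗ₜ[ℂ] (1 : W))) =
      comul (R := ℂ) 1 * (x ⊗ₜ[ℂ] 1) := by
    rw [← r.eq]
    simp only [map_sum, Finset.sum_mul, rTensor_tmul, Algebra.TensorProduct.tmul_mul_tmul,
      mul_one, ← WeakBialgebra.comul_mul, counitMiddle_comul_tmul]
  rw [← h1, h, ← (ℛ ℂ x).eq]
  simp only [map_sum, TensorProduct.map_tmul, epsLMap_apply, epsL_eq_sum r, ← r.eq,
    TensorProduct.sum_tmul, TensorProduct.tmul_sum, TensorProduct.assoc_tmul, Finset.sum_mul,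
    Finset.mul_sum, Algebra.TensorProduct.tmul_mul_tmul, one_mul, mul_one, counitMiddle_tmul, id_apply]

theorem map_epsR_id_comul (x : W) :
    TensorProduct.map (epsRMap W) LinearMap.id (comul x) = (1 ⊗ₜ[ℂ] x) * comul (R := ℂ) 1 := by
  have h := congrArg (fun t => counitMiddle W (((1 : W) ⊗ₜ[ℂ] comul x) * t))
    ((coassoc_apply (R := ℂ) (1 : W)).symm.trans (WeakBialgebra.comul_one_right (W := W)))
  beta_reduce at h
  rw [← mul_assoc, Algebra.TensorProduct.tmul_mul_tmul, comul_mul_one, mul_one] at h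
  set r := ℛ ℂ (1 : W)
  have h1 : counitMiddle W ((1 : W) ⊗ₜ[ℂ] comul x * lTensor W comul (comul (1 : W))) =
      (1 ⊗ₜ[ℂ] x) * comul (R := ℂ) 1 := by
    rw [← r.eq]
    simp only [map_sum, Finset.mul_sum, lTensor_tmul, Algebra.TensorProduct.tmul_mul_tmul,
      one_mul, ← WeakBialgebra.comul_mul, counitMiddle_tmul_comul]
  rw [← h1, h, ← (ℛ ℂ x).eq]
  simp only [map_sum, TensorProduct.map_tmul, epsRMap_apply, epsR_eq_sum r, ← r.eq,
    TensorProduct.sum_tmul, TensorProduct.tmul_sum, TensorProduct.assoc_tmul, Finset.sum_mul,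
    Finset.mul_sum, Algebra.TensorProduct.tmul_mul_tmul, one_mul, mul_one, counitMiddle_tmul,
    id_apply, TensorProduct.smul_tmul]
  rw [Finset.sum_comm]

theorem map_id_epsLOp_comul (x : W) :
    TensorProduct.map LinearMap.id (epsLOp W) (comul x) = (x ⊗ₜ[ℂ] 1) * comul (R := ℂ) 1 := by
  have h := congrArg (fun t => counitMiddle W
    (TensorProduct.assoc ℂ W W W (comul x ⊗ₜ[ℂ] (1 : W)) * t)) (WeakBialgebra.comul_one_left (W := W))
  beta_reduce at h
  rw [← mul_assoc, ← assoc_mul, ← assoc_mul, Algebra.TensorProduct.tmul_mul_tmul, comul_mul_one,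
    mul_one] at h
  set r := ℛ ℂ (1 : W)
  have h1 : counitMiddle W (TensorProduct.assoc ℂ W W W
      (comul x ⊗ₜ[ℂ] (1 : W) * rTensor W comul (comul (1 : W)))) =
      (x ⊗ₜ[ℂ] 1) * comul (R := ℂ) 1 := by
    rw [← r.eq]
    simp only [map_sum, Finset.mul_sum, rTensor_tmul, Algebra.TensorProduct.tmul_mul_tmul,
      one_mul, ← WeakBialgebra.comul_mul, counitMiddle_comul_tmul]
  rw [← h1, h, ← (ℛ ℂ x).eq]
  simp only [map_sum, TensorProduct.map_tmul, epsLOp_eq_sum r, ← r.eq,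
    TensorProduct.sum_tmul, TensorProduct.tmul_sum, TensorProduct.assoc_tmul, Finset.sum_mul,
    Finset.mul_sum, Algebra.TensorProduct.tmul_mul_tmul, one_mul, mul_one, counitMiddle_tmul, id_apply]
  rw [Finset.sum_comm]

theorem map_epsROp_id_comul (x : W) :
    TensorProduct.map (epsROp W) LinearMap.id (comul x) = comul (R := ℂ) 1 * (1 ⊗ₜ[ℂ] x) := by
  have h := congrArg (fun t => counitMiddle W (t * ((1 : W) ⊗ₜ[ℂ] comul x)))
    ((coassoc_apply (R := ℂ) (1 : W)).symm.trans (WeakBialgebra.comul_one_left (W := W)))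
  beta_reduce at h
  rw [mul_assoc, Algebra.TensorProduct.tmul_mul_tmul, comul_one_mul, mul_one] at h
  set r := ℛ ℂ (1 : W)
  have h1 : counitMiddle W (lTensor W comul (comul (1 : W)) * (1 : W) ⊗ₜ[ℂ] comul x) =
      comul (R := ℂ) 1 * (1 ⊗ₜ[ℂ] x) := by
    rw [← r.eq]
    simp only [map_sum, Finset.sum_mul, lTensor_tmul, Algebra.TensorProduct.tmul_mul_tmul,
      mul_one, ← WeakBialgebra.comul_mul, counitMiddle_tmul_comul]
  rw [← h1, h, ← (ℛ ℂ x).eq]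
  simp only [map_sum, TensorProduct.map_tmul, epsROp_eq_sum r, ← r.eq,
    TensorProduct.sum_tmul, TensorProduct.tmul_sum, TensorProduct.assoc_tmul, Finset.sum_mul,
    Finset.mul_sum, Algebra.TensorProduct.tmul_mul_tmul, one_mul, mul_one, counitMiddle_tmul,
    id_apply, TensorProduct.smul_tmul]

/-- This is the weak counit axiom with middle element `1`. -/
theorem counit_mul_epsL (x y : W) : counit (R := ℂ) (x * epsL y) = counit (R := ℂ) (x * y) := by
  set r := ℛ ℂ (1 : W)
  have h := WeakBialgebra.counit_mul_right x 1 y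
  rw [mul_one] at h
  rw [h, epsL_eq_sum r, ← r.eq]
  simp [Finset.mul_sum, mul_comm]

theorem counit_epsR_mul (x y : W) : counit (R := ℂ) (epsR x * y) = counit (R := ℂ) (x * y) := by
  set r := ℛ ℂ (1 : W)
  have h := WeakBialgebra.counit_mul_right x 1 y
  rw [mul_one] at h
  rw [h, epsR_eq_sum r, ← r.eq]
  simp [Finset.sum_mul]

theorem epsL_mul_epsL (x y : W) : epsL (x * epsL y) = epsL (x * y) := by
  simp only [epsL_eq_sum (ℛ ℂ (1 : W)) (x * _), ← mul_assoc]
  simp only [counit_mul_epsL]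

theorem epsR_epsR_mul (x y : W) : epsR (epsR x * y) = epsR (x * y) := by
  simp only [epsR_eq_sum (ℛ ℂ (1 : W)) (_ * y), mul_assoc]
  simp only [counit_epsR_mul]

/-- Since `ε_L(x)` is `Δ(1)` with its first leg paired with `ε(· x)`, applying that functional to
the first leg of a weak unit axiom computes its coproduct. The two orders in the axiom give the two
placements of `Δ(1)`. -/
theorem comul_epsL (x : W) : comul (epsL x) = (epsL x ⊗ₜ[ℂ] 1) * comul (R := ℂ) (1 : W) := by
  set r := ℛ ℂ (1 : W)
  have h := congrArg ((TensorProduct.lid ℂ (W ⊗[ℂ] W)).toLinearMap ∘ₗ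
    rTensor _ (counit ∘ₗ mulRight ℂ x))
    ((coassoc_apply (R := ℂ) (1 : W)).symm.trans (WeakBialgebra.comul_one_left (W := W)))
  rw [← r.eq] at h
  simp only [map_sum, Finset.sum_mul, Finset.mul_sum, TensorProduct.sum_tmul,
    TensorProduct.tmul_sum, lTensor_tmul, TensorProduct.assoc_tmul, comp_apply, rTensor_tmul,
    Algebra.TensorProduct.tmul_mul_tmul, mul_one, one_mul, LinearEquiv.coe_coe,
    TensorProduct.lid_tmul, mulRight_apply] at h
  rw [epsL_eq_sum r]
  conv_rhs => rw [← r.eq]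
  simp only [map_sum, map_smul, h, Finset.sum_mul, Finset.mul_sum, TensorProduct.sum_tmul,
    Algebra.TensorProduct.tmul_mul_tmul, one_mul, TensorProduct.smul_tmul', Algebra.smul_mul_assoc]

theorem comul_epsL' (x : W) : comul (epsL x) = comul (R := ℂ) (1 : W) * (epsL x ⊗ₜ[ℂ] 1) := by
  set r := ℛ ℂ (1 : W)
  have h := congrArg ((TensorProduct.lid ℂ (W ⊗[ℂ] W)).toLinearMap ∘ₗ
    rTensor _ (counit ∘ₗ mulRight ℂ x))
    ((coassoc_apply (R := ℂ) (1 : W)).symm.trans (WeakBialgebra.comul_one_right (W := W)))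
  rw [← r.eq] at h
  simp only [map_sum, Finset.sum_mul, Finset.mul_sum, TensorProduct.sum_tmul,
    TensorProduct.tmul_sum, lTensor_tmul, TensorProduct.assoc_tmul, comp_apply, rTensor_tmul,
    Algebra.TensorProduct.tmul_mul_tmul, mul_one, one_mul, LinearEquiv.coe_coe,
    TensorProduct.lid_tmul, mulRight_apply] at h
  rw [epsL_eq_sum r]
  conv_rhs => rw [← r.eq]
  simp only [map_sum, map_smul, h, Finset.sum_mul, Finset.mul_sum, TensorProduct.sum_tmul,
    Algebra.TensorProduct.tmul_mul_tmul, mul_one, TensorProduct.smul_tmul', Algebra.mul_smul_comm]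

theorem comul_epsR (x : W) : comul (epsR x) = (1 ⊗ₜ[ℂ] epsR x) * comul (R := ℂ) (1 : W) := by
  set r := ℛ ℂ (1 : W)
  have h := congrArg ((TensorProduct.rid ℂ (W ⊗[ℂ] W)).toLinearMap ∘ₗ
    lTensor _ (counit ∘ₗ mulLeft ℂ x) ∘ₗ (TensorProduct.assoc ℂ W W W).symm.toLinearMap)
    (WeakBialgebra.comul_one_right (W := W))
  rw [← r.eq] at h
  simp only [map_sum, Finset.sum_mul, Finset.mul_sum, TensorProduct.sum_tmul,
    TensorProduct.tmul_sum, lTensor_tmul, TensorProduct.assoc_tmul, comp_apply, rTensor_tmul,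
    Algebra.TensorProduct.tmul_mul_tmul, mul_one, one_mul, LinearEquiv.coe_coe,
    TensorProduct.rid_tmul, mulLeft_apply, LinearEquiv.symm_apply_apply,
    TensorProduct.assoc_symm_tmul] at h
  rw [epsR_eq_sum r]
  conv_rhs => rw [← r.eq]
  simp only [map_sum, map_smul, h, Finset.sum_mul, Finset.mul_sum, TensorProduct.tmul_sum,
    Algebra.TensorProduct.tmul_mul_tmul, one_mul, TensorProduct.tmul_smul, Algebra.smul_mul_assoc]

theorem comul_epsR' (x : W) : comul (epsR x) = comul (R := ℂ) (1 : W) * (1 ⊗ₜ[ℂ] epsR x) := by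
  set r := ℛ ℂ (1 : W)
  have h := congrArg ((TensorProduct.rid ℂ (W ⊗[ℂ] W)).toLinearMap ∘ₗ
    lTensor _ (counit ∘ₗ mulLeft ℂ x) ∘ₗ (TensorProduct.assoc ℂ W W W).symm.toLinearMap)
    (WeakBialgebra.comul_one_left (W := W))
  rw [← r.eq] at h
  simp only [map_sum, Finset.sum_mul, Finset.mul_sum, TensorProduct.sum_tmul,
    TensorProduct.tmul_sum, lTensor_tmul, TensorProduct.assoc_tmul, comp_apply, rTensor_tmul,
    Algebra.TensorProduct.tmul_mul_tmul, mul_one, one_mul, LinearEquiv.coe_coe,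
    TensorProduct.rid_tmul, mulLeft_apply, LinearEquiv.symm_apply_apply,
    TensorProduct.assoc_symm_tmul] at h
  rw [epsR_eq_sum r]
  conv_rhs => rw [← r.eq]
  simp only [map_sum, map_smul, h, Finset.sum_mul, Finset.mul_sum, TensorProduct.tmul_sum,
    Algebra.TensorProduct.tmul_mul_tmul, mul_one, TensorProduct.tmul_smul, Algebra.mul_smul_comm]
  simp only [Finset.smul_sum]

/-- Both forms of `Δ(ε_L(x))` agree; pairing the second leg with `ε(y ·)` turns `Δ(1)` into
`ε_R(y)`. -/
theorem epsL_commute_epsR (x y : W) : Commute (epsL x) (epsR y) := by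
  set r := ℛ ℂ (1 : W)
  have h := congrArg ((TensorProduct.rid ℂ W).toLinearMap ∘ₗ lTensor W (counit ∘ₗ mulLeft ℂ y))
    ((comul_epsL x).symm.trans (comul_epsL' x))
  rw [← r.eq] at h
  simp only [map_sum, Finset.sum_mul, Finset.mul_sum, lTensor_tmul, comp_apply,
    Algebra.TensorProduct.tmul_mul_tmul, mul_one, one_mul, LinearEquiv.coe_coe,
    TensorProduct.rid_tmul, mulLeft_apply] at h
  rw [Commute, SemiconjBy, epsR_eq_sum r]
  simpa [Finset.mul_sum, Finset.sum_mul] using h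

theorem epsL_one : epsL (1 : W) = 1 := by
  rw [epsL, ← Algebra.TensorProduct.one_def, mul_one, rTensor_counit_comul]; simp

theorem epsR_one : epsR (1 : W) = 1 := by
  rw [epsR, ← Algebra.TensorProduct.one_def, one_mul, lTensor_counit_comul]; simp

theorem epsL_conv_id :
    toConv (epsLMap W) * toConv (LinearMap.id (R := ℂ) (M := W)) = toConv LinearMap.id := by
  ext x
  set r := ℛ ℂ (1 : W)
  set q := ℛ ℂ x
  have h : TensorProduct.lid ℂ W (rTensor W counit (comul (R := ℂ) (1 : W) * comul x)) = x := by
    rw [comul_one_mul, rTensor_counit_comul]; simp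
  rw [← r.eq, ← q.eq] at h
  simp only [map_sum, Finset.sum_mul, Finset.mul_sum, rTensor_tmul, TensorProduct.lid_tmul,
    Algebra.TensorProduct.tmul_mul_tmul] at h
  refine (q.convMul_apply _ _).trans (Eq.trans ?_ h)
  simp only [epsLMap_apply, epsL_eq_sum r, Finset.sum_mul, Algebra.smul_mul_assoc, id_apply]

end Bialgebra

/-! ### Convolution algebras and changes of source or target -/

section Convolution
variable {C A : Type*} [AddCommGroup C] [Module ℂ C] [Coalgebra ℂ C] [Ring A] [Algebra ℂ A]

theorem convMul_comp_left {B : Type*} [Ring B] [Algebra ℂ B] (f : A →ₗ[ℂ] B)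
    (hf : ∀ x y, f (x * y) = f x * f y) (a b : C →ₗ[ℂ] A) :
    toConv (f ∘ₗ a) * toConv (f ∘ₗ b) = toConv (f ∘ₗ (toConv a * toConv b).ofConv) := by
  ext x
  refine ((ℛ ℂ x).convMul_apply _ _).trans ?_
  change _ = f ((toConv a * toConv b) x)
  rw [(ℛ ℂ x).convMul_apply]
  simp [hf]

theorem convMul_comp_right {D : Type*} [AddCommGroup D] [Module ℂ D] [Coalgebra ℂ D]
    (g : D →ₗ[ℂ] C) (hg : ∀ d, comul (g d) = TensorProduct.map g g (comul d)) (a b : C →ₗ[ℂ] A) :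
    toConv (a ∘ₗ g) * toConv (b ∘ₗ g) = toConv ((toConv a * toConv b).ofConv ∘ₗ g) := by
  ext x
  change mul' ℂ A (TensorProduct.map (a ∘ₗ g) (b ∘ₗ g) (comul x)) =
    mul' ℂ A (TensorProduct.map a b (comul (g x)))
  rw [hg, TensorProduct.map_comp, comp_apply]

theorem mulLeft_comp_convMul (c : A) (f g : C →ₗ[ℂ] A) :
    toConv (mulLeft ℂ c ∘ₗ f) * toConv g = toConv (mulLeft ℂ c ∘ₗ (toConv f * toConv g).ofConv) := by
  ext x
  refine ((ℛ ℂ x).convMul_apply _ _).trans ?_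
  change _ = c * ((toConv f * toConv g) x)
  rw [(ℛ ℂ x).convMul_apply]
  simp [Finset.mul_sum, mul_assoc]

theorem convMul_mulRight_comp (c : A) (f g : C →ₗ[ℂ] A) :
    toConv f * toConv (mulRight ℂ c ∘ₗ g) = toConv (mulRight ℂ c ∘ₗ (toConv f * toConv g).ofConv) := by
  ext x
  refine ((ℛ ℂ x).convMul_apply _ _).trans ?_
  change _ = ((toConv f * toConv g) x) * c
  rw [(ℛ ℂ x).convMul_apply]
  simp [Finset.sum_mul, mul_assoc]

theorem mulRight_comp_convMul (c : A) (f g : C →ₗ[ℂ] A) :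
    toConv (mulRight ℂ c ∘ₗ f) * toConv g = toConv f * toConv (mulLeft ℂ c ∘ₗ g) := by
  ext x
  refine ((ℛ ℂ x).convMul_apply _ _).trans (Eq.trans ?_ ((ℛ ℂ x).convMul_apply _ _).symm)
  simp [mul_assoc]

end Convolution

/-! ### The antipode as a weak convolution inverse -/

section Antipode
variable {W : Type u} [Ring W] [Algebra ℂ W] [WeakHopfAlgebra W]

local notation "𝒮" => WeakHopfAlgebra.antipode

theorem antipode_conv_id :
    toConv (𝒮 : W →ₗ[ℂ] W) * toConv LinearMap.id = toConv (epsRMap W) := by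
  ext x; exact WeakHopfAlgebra.mul_rTensor_antipode x

theorem id_conv_antipode :
    toConv LinearMap.id * toConv (𝒮 : W →ₗ[ℂ] W) = toConv (epsLMap W) := by
  ext x; exact WeakHopfAlgebra.mul_lTensor_antipode x

theorem antipode_conv_epsL :
    toConv (𝒮 : W →ₗ[ℂ] W) * toConv (epsLMap W) = toConv (𝒮 : W →ₗ[ℂ] W) := by
  rw [← id_conv_antipode]
  ext x
  exact WeakHopfAlgebra.antipode_mul_antipode x

theorem epsR_conv_antipode :
    toConv (epsRMap W) * toConv (𝒮 : W →ₗ[ℂ] W) = toConv (𝒮 : W →ₗ[ℂ] W) := by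
  rw [← antipode_conv_id, mul_assoc, id_conv_antipode, antipode_conv_epsL]

/-! #### The antipode is antimultiplicative -/

/-- `x ⊗ y ↦ ε(y) x`. -/
def prFst (W : Type u) [Ring W] [Algebra ℂ W] [Coalgebra ℂ W] : W ⊗[ℂ] W →ₗ[ℂ] W :=
  (TensorProduct.rid ℂ W).toLinearMap ∘ₗ lTensor W counit

/-- `x ⊗ y ↦ ε(x) y`. -/
def prSnd (W : Type u) [Ring W] [Algebra ℂ W] [Coalgebra ℂ W] : W ⊗[ℂ] W →ₗ[ℂ] W :=
  (TensorProduct.lid ℂ W).toLinearMap ∘ₗ rTensor W counit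

@[simp] theorem prFst_tmul (x y : W) : prFst W (x ⊗ₜ y) = counit (R := ℂ) y • x := by simp [prFst]
@[simp] theorem prSnd_tmul (x y : W) : prSnd W (x ⊗ₜ y) = counit (R := ℂ) x • y := by simp [prSnd]

theorem comul_tmul_eq_sum {ι κ : Type*} {x y : W} (r : Repr ℂ x ι) (q : Repr ℂ y κ) :
    comul (R := ℂ) (x ⊗ₜ[ℂ] y) = ∑ i ∈ r.index, ∑ k ∈ q.index,
      (r.left i ⊗ₜ[ℂ] q.left k) ⊗ₜ[ℂ] (r.right i ⊗ₜ[ℂ] q.right k) := by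
  rw [TensorProduct.comul_tmul, ← r.eq, ← q.eq]
  simp [TensorProduct.sum_tmul, TensorProduct.tmul_sum]
  first | done | rw [Finset.sum_comm]

theorem comul_prFst (t : W ⊗[ℂ] W) :
    comul (prFst W t) = TensorProduct.map (prFst W) (prFst W) (comul t) := by
  induction t with
  | zero => simp
  | add a b ha hb => simp only [map_add, ha, hb]
  | tmul x y =>
    rw [comul_tmul_eq_sum (ℛ ℂ x) (ℛ ℂ y)]
    simp only [map_sum, TensorProduct.map_tmul, prFst_tmul, TensorProduct.smul_tmul_smul, map_smul]
    simp only [← Finset.sum_smul, ← Finset.smul_sum]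
    rw [← (ℛ ℂ x).eq]
    congr 1
    conv_lhs => rw [← sum_counit_smul (ℛ ℂ y)]
    simp

theorem comul_prSnd (t : W ⊗[ℂ] W) :
    comul (prSnd W t) = TensorProduct.map (prSnd W) (prSnd W) (comul t) := by
  induction t with
  | zero => simp
  | add a b ha hb => simp only [map_add, ha, hb]
  | tmul x y =>
    rw [comul_tmul_eq_sum (ℛ ℂ x) (ℛ ℂ y)]
    simp only [map_sum, TensorProduct.map_tmul, prSnd_tmul, TensorProduct.smul_tmul_smul, map_smul]
    simp only [← Finset.sum_smul, ← Finset.smul_sum, (ℛ ℂ y).eq]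
    congr 1
    conv_lhs => rw [← sum_counit_smul (ℛ ℂ x)]
    simp

theorem comul_mul' (t : W ⊗[ℂ] W) :
    comul (mul' ℂ W t) = TensorProduct.map (mul' ℂ W) (mul' ℂ W) (comul t) := by
  induction t with
  | zero => simp
  | add a b ha hb => simp only [map_add, ha, hb]
  | tmul x y =>
    rw [comul_tmul_eq_sum (ℛ ℂ x) (ℛ ℂ y), mul'_apply, WeakBialgebra.comul_mul, ← (ℛ ℂ x).eq,
      ← (ℛ ℂ y).eq]
    simp [Finset.sum_mul, Finset.mul_sum]
    first | done | rw [Finset.sum_comm]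

/-- The second copy of `x` meets only a counit, so the convolution takes place in `y` alone. -/
theorem convMul_prSnd_apply (g : W ⊗[ℂ] W →ₗ[ℂ] W) (G : W →ₗ[ℂ] W) (x y : W) :
    (toConv g * toConv (G ∘ₗ prSnd W)) (x ⊗ₜ y) =
      (toConv (g ∘ₗ TensorProduct.mk ℂ W W x) * toConv G) y := by
  rw [(ℛ ℂ y).convMul_apply, convMul_apply, comul_tmul_eq_sum (ℛ ℂ x) (ℛ ℂ y), Finset.sum_comm]
  simp only [map_sum, TensorProduct.map_tmul, mul'_apply, comp_apply, prSnd_tmul,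
    map_smul, mul_smul_comm, ← smul_mul_assoc, ← Finset.sum_mul, TensorProduct.mk_apply]
  simp only [← map_smul, ← map_sum, TensorProduct.smul_tmul', ← TensorProduct.sum_tmul,
    sum_counit_smul_right]

theorem prFst_convMul_apply (g : W ⊗[ℂ] W →ₗ[ℂ] W) (G : W →ₗ[ℂ] W) (x y : W) :
    (toConv (G ∘ₗ prFst W) * toConv g) (x ⊗ₜ y) =
      (toConv G * toConv (g ∘ₗ (TensorProduct.mk ℂ W W).flip y)) x := by
  rw [(ℛ ℂ x).convMul_apply, convMul_apply, comul_tmul_eq_sum (ℛ ℂ x) (ℛ ℂ y)]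
  simp only [map_sum, TensorProduct.map_tmul, mul'_apply, comp_apply, prFst_tmul,
    map_smul, ← mul_smul_comm, smul_mul_assoc, ← Finset.mul_sum, TensorProduct.mk_apply, flip_apply]
  simp only [← map_smul, ← map_sum, ← TensorProduct.tmul_smul, ← TensorProduct.tmul_sum,
    sum_counit_smul]

theorem prFst_conv_prSnd_apply (F G : W →ₗ[ℂ] W) (x y : W) :
    (toConv (F ∘ₗ prFst W) * toConv (G ∘ₗ prSnd W)) (x ⊗ₜ y) = F x * G y := by
  rw [convMul_prSnd_apply, (ℛ ℂ y).convMul_apply]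
  simp only [comp_apply, TensorProduct.mk_apply, prFst_tmul, map_smul,
    smul_mul_assoc, ← mul_smul_comm, ← Finset.mul_sum]
  simp only [← map_smul, ← map_sum, sum_counit_smul]

theorem prSnd_conv_prFst_apply (F G : W →ₗ[ℂ] W) (x y : W) :
    (toConv (F ∘ₗ prSnd W) * toConv (G ∘ₗ prFst W)) (x ⊗ₜ y) = F y * G x := by
  have hF : F y = ∑ k ∈ (ℛ ℂ y).index, counit (R := ℂ) ((ℛ ℂ y).right k) • F ((ℛ ℂ y).left k) := by
    simp only [← map_smul, ← map_sum, sum_counit_smul_right]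
  have hG : G x = ∑ k ∈ (ℛ ℂ x).index, counit (R := ℂ) ((ℛ ℂ x).left k) • G ((ℛ ℂ x).right k) := by
    simp only [← map_smul, ← map_sum, sum_counit_smul]
  rw [convMul_apply, comul_tmul_eq_sum (ℛ ℂ x) (ℛ ℂ y), hF, hG, Finset.sum_mul_sum, Finset.sum_comm]
  simp only [map_sum, TensorProduct.map_tmul, mul'_apply, comp_apply, prFst_tmul,
    prSnd_tmul, map_smul, smul_mul_smul_comm]
  refine Finset.sum_congr rfl fun i _ => Finset.sum_congr rfl fun k _ => ?_
  rw [mul_comm]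

/-- By `ε_R(ε_R(z)y) = ε_R(zy)` it suffices to expand `ε_R(ε_R(z)y)` through the antipode, where
`Δ(ε_R(z)y) = (1 ⊗ ε_R(z))Δ(y)`. -/
theorem sum_antipode_mul_epsR_mul (z y : W) :
    (toConv (𝒮 : W →ₗ[ℂ] W) * toConv (mulLeft ℂ (epsR z))) y = epsR (z * y) := by
  rw [← epsR_epsR_mul]
  conv_rhs => rw [← WeakHopfAlgebra.mul_rTensor_antipode]
  rw [WeakBialgebra.comul_mul, comul_epsR,
    mul_assoc, comul_one_mul, (ℛ ℂ y).convMul_apply, ← (ℛ ℂ y).eq]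
  simp [Finset.mul_sum]

theorem sum_mul_epsL_mul_antipode (z x : W) :
    (toConv (mulRight ℂ (epsL z)) * toConv (𝒮 : W →ₗ[ℂ] W)) x = epsL (x * z) := by
  rw [← epsL_mul_epsL]
  conv_rhs => rw [← WeakHopfAlgebra.mul_lTensor_antipode]
  rw [WeakBialgebra.comul_mul, comul_epsL',
    ← mul_assoc, comul_mul_one, (ℛ ℂ x).convMul_apply, ← (ℛ ℂ x).eq]
  simp [Finset.sum_mul]

/-- In the convolution algebra of maps `W ⊗ W → W`, let `m` be the product, `ρ = S ∘ m` and `ν(x ⊗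
y) = S(y)S(x)`. A weak inverse of `m` is determined by its two products with `m`, so it suffices
that `νm = ρm`, `mν = mρ`, `ρmρ = ρ` and `νmν = ν`. -/
theorem antipode_mul (x y : W) : (𝒮 (x * y) : W) = 𝒮 y * 𝒮 x := by
  set p : WithConv (W ⊗[ℂ] W →ₗ[ℂ] W) := toConv (LinearMap.id ∘ₗ prFst W)
  set q : WithConv (W ⊗[ℂ] W →ₗ[ℂ] W) := toConv (LinearMap.id ∘ₗ prSnd W)
  set sp : WithConv (W ⊗[ℂ] W →ₗ[ℂ] W) := toConv (𝒮 ∘ₗ prFst W)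
  set sq : WithConv (W ⊗[ℂ] W →ₗ[ℂ] W) := toConv (𝒮 ∘ₗ prSnd W)
  set er : WithConv (W ⊗[ℂ] W →ₗ[ℂ] W) := toConv (epsRMap W ∘ₗ prFst W)
  set el : WithConv (W ⊗[ℂ] W →ₗ[ℂ] W) := toConv (epsLMap W ∘ₗ prSnd W)
  set m : WithConv (W ⊗[ℂ] W →ₗ[ℂ] W) := toConv (LinearMap.id ∘ₗ mul' ℂ W)
  set ρ : WithConv (W ⊗[ℂ] W →ₗ[ℂ] W) := toConv (𝒮 ∘ₗ mul' ℂ W)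
  have hm : m = p * q := by
    apply WithConv.ext
    apply TensorProduct.ext'
    intro x y
    exact (prFst_conv_prSnd_apply LinearMap.id LinearMap.id x y).symm
  have hρm : ρ * m = toConv (epsRMap W ∘ₗ mul' ℂ W) := by
    rw [convMul_comp_right _ comul_mul', antipode_conv_id]
  have hmρ : m * ρ = toConv (epsLMap W ∘ₗ mul' ℂ W) := by
    rw [convMul_comp_right _ comul_mul', id_conv_antipode]
  have hρ : ρ * m * ρ = ρ := by
    rw [hρm, convMul_comp_right _ comul_mul', epsR_conv_antipode]
  have hsp : sp * p = er := by
    rw [convMul_comp_right _ comul_prFst, antipode_conv_id]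
  have hsq : q * sq = el := by
    rw [convMul_comp_right _ comul_prSnd, id_conv_antipode]
  have hersp : er * sp = sp := by
    rw [convMul_comp_right _ comul_prFst, epsR_conv_antipode]
  have hsqel : sq * el = sq := by
    rw [convMul_comp_right _ comul_prSnd, antipode_conv_epsL]
  have hcomm : er * el = el * er := by
    apply WithConv.ext
    apply TensorProduct.ext'
    intro x y
    refine (prFst_conv_prSnd_apply _ _ x y).trans (Eq.trans ?_ (prSnd_conv_prFst_apply _ _ x y).symm)
    exact (epsL_commute_epsR y x).eq.symm
  have hνm : sq * sp * m = ρ * m := by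
    rw [hm, mul_assoc sq, ← mul_assoc sp, hsp, ← hm, hρm, ← mul_assoc]
    apply WithConv.ext
    apply TensorProduct.ext'
    intro x y
    refine (convMul_prSnd_apply (sq * er).ofConv LinearMap.id x y).trans ?_
    have : (sq * er).ofConv ∘ₗ TensorProduct.mk ℂ W W x = mulRight ℂ (epsR x) ∘ₗ 𝒮 := by
      ext z; exact prSnd_conv_prFst_apply _ _ x z
    rw [this, mulRight_comp_convMul, comp_id]
    exact sum_antipode_mul_epsR_mul x y
  have hmν : m * (sq * sp) = m * ρ := by
    rw [hm, mul_assoc p, ← mul_assoc q, hsq, ← hm, hmρ]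
    apply WithConv.ext
    apply TensorProduct.ext'
    intro x y
    refine (prFst_convMul_apply (el * sp).ofConv LinearMap.id x y).trans ?_
    have : (el * sp).ofConv ∘ₗ (TensorProduct.mk ℂ W W).flip y = mulLeft ℂ (epsL y) ∘ₗ 𝒮 := by
      ext z; exact prSnd_conv_prFst_apply _ _ z y
    rw [this, ← mulRight_comp_convMul, comp_id]
    exact sum_mul_epsL_mul_antipode y x
  -- The inner factors are `ε_R(x)` and `ε_L(y)`; they commute, and each is then absorbed by the
  -- adjacent antipode.
  have hν : sq * sp * m * (sq * sp) = sq * sp := by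
    calc sq * sp * m * (sq * sp) = sq * (sp * p) * (q * sq) * sp := by
          rw [hm]; simp only [mul_assoc]
      _ = sq * (er * el) * sp := by rw [hsp, hsq]; simp only [mul_assoc]
      _ = (sq * el) * (er * sp) := by rw [hcomm]; simp only [mul_assoc]
      _ = sq * sp := by rw [hsqel, hersp]
  -- `ρ = ρmρ = ρmν = νmν = ν`.
  have key : ρ = sq * sp := by
    rw [← hρ, mul_assoc, ← hmν, ← mul_assoc, ← hνm, hν]
  have := congrArg (fun f : WithConv (W ⊗[ℂ] W →ₗ[ℂ] W) => f (x ⊗ₜ y)) key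
  exact this.trans (prSnd_conv_prFst_apply _ _ x y)

end Antipode

/-! ### The antipode and the coproduct; integrals and `S² = id` -/

section Tensor
variable {W : Type u} [Ring W] [Algebra ℂ W]

theorem inclL_mul (x y : W) : inclL W (x * y) = inclL W x * inclL W y := by simp
theorem inclR_mul (x y : W) : inclR W (x * y) = inclR W x * inclR W y := by simp

theorem comm_mul (s t : W ⊗[ℂ] W) :
    TensorProduct.comm ℂ W W (s * t) = TensorProduct.comm ℂ W W s * TensorProduct.comm ℂ W W t :=
  map_mul (Algebra.TensorProduct.comm ℂ W W) s t

end Tensor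

section AntipodeComul
variable {W : Type u} [Ring W] [Algebra ℂ W] [WeakHopfAlgebra W]

local notation "𝒮" => WeakHopfAlgebra.antipode

theorem inclL_conv_inclR (f g : W →ₗ[ℂ] W) :
    toConv (inclL W ∘ₗ f) * toConv (inclR W ∘ₗ g) = toConv (TensorProduct.map f g ∘ₗ comul) := by
  ext x; exact inclL_mul_inclR f g x

theorem inclL_conv_inclR_id :
    toConv (inclL W) * toConv (inclR W) = toConv (comul (R := ℂ) (A := W)) := by
  have := inclL_conv_inclR (LinearMap.id (R := ℂ) (M := W)) LinearMap.id
  simpa using this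

theorem inclL_conv_inclR_epsL :
    toConv (inclL W) * toConv (inclR W ∘ₗ epsLMap W) =
      toConv (mulLeft ℂ (comul (1 : W)) ∘ₗ inclL W) := by
  rw [← comp_id (inclL W), inclL_conv_inclR]
  ext x; exact map_id_epsL_comul x

theorem inclL_epsR_conv_inclR :
    toConv (inclL W ∘ₗ epsRMap W) * toConv (inclR W) =
      toConv (mulRight ℂ (comul (1 : W)) ∘ₗ inclR W) := by
  rw [← comp_id (inclR W), inclL_conv_inclR]
  ext x; exact map_epsR_id_comul x

/-- The two weak counit axioms evaluate `ε(uxv)` with the legs of `x` in either order, so `∑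
ε(ux⁽¹⁾)ε(x⁽²⁾v)` is unchanged when these legs are swapped. -/
theorem inclR_epsL_conv_inclL_epsR :
    toConv (inclR W ∘ₗ epsLMap W) * toConv (inclL W ∘ₗ epsRMap W) =
      toConv (inclL W ∘ₗ epsRMap W) * toConv (inclR W ∘ₗ epsLMap W) := by
  ext x
  set r := ℛ ℂ (1 : W)
  set q := ℛ ℂ x
  refine (q.convMul_apply _ _).trans (Eq.trans ?_ (q.convMul_apply _ _).symm)
  have h : ∀ i j, ∑ k ∈ q.index, counit (R := ℂ) (r.left i * q.left k) *
        counit (R := ℂ) (q.right k * r.right j) =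
      ∑ k ∈ q.index, counit (R := ℂ) (r.left i * q.right k) *
        counit (R := ℂ) (q.left k * r.right j) := by
    intro i j
    have h1 := WeakBialgebra.counit_mul_left (r.left i) x (r.right j)
    have h2 := WeakBialgebra.counit_mul_right (r.left i) x (r.right j)
    rw [← q.eq] at h1 h2
    simp only [map_sum, TensorProduct.map_tmul, TensorProduct.comm_tmul, mul'_apply, comp_apply,
      mulLeft_apply, mulRight_apply] at h1 h2
    exact h1.symm.trans h2
  simp only [comp_apply, inclL_apply, inclR_apply, Algebra.TensorProduct.tmul_mul_tmul, one_mul,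
    mul_one]
  simp only [epsLMap_apply, epsRMap_apply, epsL_eq_sum r, epsR_eq_sum r, TensorProduct.sum_tmul]
  simp only [TensorProduct.tmul_sum, TensorProduct.smul_tmul_smul]
  have h' : ∀ j i, ∑ k ∈ q.index, counit (R := ℂ) (q.right k * r.right j) *
        counit (R := ℂ) (r.left i * q.left k) =
      ∑ k ∈ q.index, counit (R := ℂ) (q.left k * r.right j) *
        counit (R := ℂ) (r.left i * q.right k) := by
    intro j i
    simpa only [mul_comm] using h i j
  rw [Finset.sum_comm]
  conv_rhs => rw [Finset.sum_comm]
  refine Finset.sum_congr rfl fun i _ => ?_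
  rw [Finset.sum_comm]
  conv_rhs => rw [Finset.sum_comm]
  refine Finset.sum_congr rfl fun j _ => ?_
  rw [← Finset.sum_smul, ← Finset.sum_smul, h']

/-- The uniqueness argument for weak inverses again, now for maps `W → W ⊗ W`: both `Δ ∘ S` and `x ↦
S(x⁽²⁾) ⊗ S(x⁽¹⁾)` are weak inverses of `Δ`. -/
theorem comul_antipode (x : W) :
    comul (𝒮 x : W) = TensorProduct.map 𝒮 𝒮 (TensorProduct.comm ℂ W W (comul x)) := by
  set l : WithConv (W →ₗ[ℂ] W ⊗[ℂ] W) := toConv (inclL W)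
  set r : WithConv (W →ₗ[ℂ] W ⊗[ℂ] W) := toConv (inclR W)
  set ls : WithConv (W →ₗ[ℂ] W ⊗[ℂ] W) := toConv (inclL W ∘ₗ 𝒮)
  set rs : WithConv (W →ₗ[ℂ] W ⊗[ℂ] W) := toConv (inclR W ∘ₗ 𝒮)
  set le : WithConv (W →ₗ[ℂ] W ⊗[ℂ] W) := toConv (inclL W ∘ₗ epsRMap W)
  set re : WithConv (W →ₗ[ℂ] W ⊗[ℂ] W) := toConv (inclR W ∘ₗ epsLMap W)
  set D : WithConv (W →ₗ[ℂ] W ⊗[ℂ] W) := toConv (comul ∘ₗ LinearMap.id)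
  set ρ : WithConv (W →ₗ[ℂ] W ⊗[ℂ] W) := toConv (comul ∘ₗ 𝒮)
  have hD : l * r = D := inclL_conv_inclR_id
  have hρD : ρ * D = toConv (comul ∘ₗ epsRMap W) := by
    rw [convMul_comp_left _ WeakBialgebra.comul_mul, antipode_conv_id]
  have hDρ : D * ρ = toConv (comul ∘ₗ epsLMap W) := by
    rw [convMul_comp_left _ WeakBialgebra.comul_mul, id_conv_antipode]
  have hρ : ρ * D * ρ = ρ := by
    rw [hρD, convMul_comp_left _ WeakBialgebra.comul_mul, epsR_conv_antipode]
  have hls : ls * l = le := by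
    have := convMul_comp_left (inclL W) inclL_mul 𝒮 LinearMap.id
    rwa [antipode_conv_id] at this
  have hrs : r * rs = re := by
    have := convMul_comp_left (inclR W) inclR_mul LinearMap.id 𝒮
    rwa [id_conv_antipode] at this
  have hlels : le * ls = ls := by
    rw [convMul_comp_left _ inclL_mul, epsR_conv_antipode]
  have hrsre : rs * re = rs := by
    rw [convMul_comp_left _ inclR_mul, antipode_conv_epsL]
  have hDν : D * (rs * ls) = D * ρ := by
    calc D * (rs * ls) = l * (r * rs) * ls := by rw [← hD]; simp only [mul_assoc]
      _ = toConv (mulLeft ℂ (comul (1 : W)) ∘ₗ (inclL W ∘ₗ epsLMap W)) := by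
        rw [hrs, inclL_conv_inclR_epsL, mulLeft_comp_convMul]
        have := convMul_comp_left (inclL W) inclL_mul LinearMap.id 𝒮
        rw [id_conv_antipode] at this
        rw [comp_id] at this
        rw [this]
      _ = D * ρ := by
        rw [hDρ]; ext x; exact (comul_epsL' x).symm
  have hνD : rs * ls * D = ρ * D := by
    calc rs * ls * D = rs * ((ls * l) * r) := by rw [← hD]; simp only [mul_assoc]
      _ = toConv (mulRight ℂ (comul (1 : W)) ∘ₗ (inclR W ∘ₗ epsRMap W)) := by
        rw [hls, inclL_epsR_conv_inclR, convMul_mulRight_comp]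
        have := convMul_comp_left (inclR W) inclR_mul 𝒮 LinearMap.id
        rw [antipode_conv_id] at this
        rw [comp_id] at this
        rw [this]
      _ = ρ * D := by
        rw [hρD]; ext x; exact (comul_epsR x).symm
  have hν : rs * ls * D * (rs * ls) = rs * ls := by
    calc rs * ls * D * (rs * ls) = rs * ((ls * l) * (r * rs)) * ls := by
          rw [← hD]; simp only [mul_assoc]
      _ = (rs * re) * (le * ls) := by
          rw [hls, hrs, ← inclR_epsL_conv_inclL_epsR]; simp only [mul_assoc]; rfl
      _ = rs * ls := by rw [hrsre, hlels]
  have key : ρ = rs * ls := by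
    rw [← hρ, mul_assoc, ← hDν, ← mul_assoc, ← hνD, hν]
  have := congrArg (fun f : WithConv (W →ₗ[ℂ] W ⊗[ℂ] W) => f x) key
  refine this.trans (((ℛ ℂ x).convMul_apply _ _).trans ?_)
  rw [← (ℛ ℂ x).eq]
  simp [ls, rs]

theorem antipode_one : (𝒮 (1 : W) : W) = 1 := by
  have h := map_epsR_id_comul (1 : W)
  rw [← Algebra.TensorProduct.one_def, one_mul] at h
  have h2 : (toConv (epsRMap W) * toConv (𝒮 : W →ₗ[ℂ] W)) 1 = 𝒮 1 := by rw [epsR_conv_antipode]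
  have h3 : mul' ℂ W (lTensor W 𝒮 (TensorProduct.map (epsRMap W) LinearMap.id (comul (1 : W)))) =
      𝒮 1 := by
    rw [← h2, convMul_apply]
    congr 1
    rw [← (ℛ ℂ (1 : W)).eq]; simp
  rw [← h3, h, WeakHopfAlgebra.mul_lTensor_antipode, epsL_one]

theorem antipode_tmul_conv_comul :
    toConv (inclL W ∘ₗ 𝒮) * toConv (comul (R := ℂ) (A := W)) =
      toConv (mulRight ℂ (comul (1 : W)) ∘ₗ inclR W) := by
  have := convMul_comp_left (inclL W) inclL_mul 𝒮 LinearMap.id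
  rw [antipode_conv_id, comp_id] at this
  rw [← inclL_conv_inclR_id, ← mul_assoc, this, inclL_epsR_conv_inclR]

theorem comul_conv_tmul_antipode :
    toConv (comul (R := ℂ) (A := W)) * toConv (inclR W ∘ₗ 𝒮) =
      toConv (mulLeft ℂ (comul (1 : W)) ∘ₗ inclL W) := by
  have := convMul_comp_left (inclR W) inclR_mul LinearMap.id 𝒮
  rw [id_conv_antipode, comp_id] at this
  rw [← inclL_conv_inclR_id, mul_assoc, this, inclL_conv_inclR_epsL]

/-- A left integral satisfies `Δ(y)Δ(h) = (ε_L(y) ⊗ 1)Δ(h)`. Convolve both sides on the left with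
`S(·) ⊗ 1`: the left becomes `(1 ⊗ y)Δ(1)Δ(h)`, and on the right `S` absorbs `ε_L`. -/
theorem antipode_tmul_mul_comul {h : W} (hh : ∀ x : W, x * h = epsL x * h) (x : W) :
    ((𝒮 x : W) ⊗ₜ[ℂ] (1 : W)) * comul h = (1 ⊗ₜ[ℂ] x) * comul h := by
  have e2 : toConv (mulRight ℂ (comul h) ∘ₗ comul) =
      toConv (mulRight ℂ (comul h) ∘ₗ inclL W ∘ₗ epsLMap W) := by
    ext y
    change comul y * comul h = (epsL y ⊗ₜ[ℂ] 1) * comul h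
    rw [← WeakBialgebra.comul_mul, hh, WeakBialgebra.comul_mul, comul_epsL, mul_assoc, comul_one_mul]
  have e3 := congrArg (toConv (inclL W ∘ₗ 𝒮) * ·) e2
  beta_reduce at e3
  rw [convMul_mulRight_comp, convMul_mulRight_comp, convMul_comp_left _ inclL_mul,
    antipode_conv_epsL, antipode_tmul_conv_comul] at e3
  have e4 := congrArg (fun f : WithConv (W →ₗ[ℂ] W ⊗[ℂ] W) => f x) e3
  change (1 ⊗ₜ[ℂ] x) * comul 1 * comul h = ((𝒮 x : W) ⊗ₜ[ℂ] (1 : W)) * comul h at e4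
  rw [← e4, mul_assoc, comul_one_mul]

theorem comul_mul_tmul_antipode {h : W} (hh : ∀ x : W, h * x = h * epsR x) (x : W) :
    comul h * ((1 : W) ⊗ₜ[ℂ] (𝒮 x : W)) = comul h * (x ⊗ₜ[ℂ] 1) := by
  have e2 : toConv (mulLeft ℂ (comul h) ∘ₗ comul) =
      toConv (mulLeft ℂ (comul h) ∘ₗ inclR W ∘ₗ epsRMap W) := by
    ext y
    change comul h * comul y = comul h * (1 ⊗ₜ[ℂ] epsR y)
    rw [← WeakBialgebra.comul_mul, hh, WeakBialgebra.comul_mul, comul_epsR', ← mul_assoc,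
      comul_mul_one]
  have e3 := congrArg (· * toConv (inclR W ∘ₗ 𝒮)) e2
  beta_reduce at e3
  rw [mulLeft_comp_convMul, mulLeft_comp_convMul, convMul_comp_left _ inclR_mul,
    epsR_conv_antipode, comul_conv_tmul_antipode] at e3
  have e4 := congrArg (fun f : WithConv (W →ₗ[ℂ] W ⊗[ℂ] W) => f x) e3
  change comul h * (comul 1 * (x ⊗ₜ[ℂ] 1)) = comul h * ((1 : W) ⊗ₜ[ℂ] (𝒮 x : W)) at e4
  rw [← e4, ← mul_assoc, comul_mul_one]

/-- A cocommutative Haar integral forces the antipode to be involutive. -/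
theorem antipode_antipode {h : W} (hh : IsHaarIntegral h) (hcoc : IsCocommutative h) (x : W) :
    (𝒮 (𝒮 x) : W) = x := by
  have e1 := antipode_tmul_mul_comul hh.left_integral x
  have e2 := congrArg (TensorProduct.comm ℂ W W) e1
  rw [comm_mul, comm_mul, hcoc, TensorProduct.comm_tmul, TensorProduct.comm_tmul,
    ← antipode_tmul_mul_comul hh.left_integral] at e2
  -- The element `y` is recovered from `(y ⊗ 1)Δ(h)`: applying `S` to the second leg and multiplying
  -- gives `y ε_L(h) = y`.
  have key : ∀ y : W, mul' ℂ W (lTensor W 𝒮 ((y ⊗ₜ[ℂ] 1) * comul h)) = y := by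
    intro y
    have : mul' ℂ W (lTensor W 𝒮 ((y ⊗ₜ[ℂ] 1) * comul h)) =
        y * mul' ℂ W (lTensor W 𝒮 (comul h)) := by
      rw [← (ℛ ℂ h).eq]; simp [Finset.mul_sum, mul_assoc]
    rw [this, WeakHopfAlgebra.mul_lTensor_antipode, hh.left_normalized, mul_one]
  rw [← key (𝒮 (𝒮 x)), e2, key]

end AntipodeComul

/-! ### Counital maps under an involutive antipode -/

section Involutive
variable {W : Type u} [Ring W] [Algebra ℂ W] [WeakHopfAlgebra W]
local notation "𝒮" => WeakHopfAlgebra.antipode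

theorem map_antipode_antipode_comul_one :
    TensorProduct.map 𝒮 𝒮 (TensorProduct.comm ℂ W W (comul 1)) = comul (R := ℂ) (1 : W) := by
  rw [← comul_antipode, antipode_one]

theorem epsL_epsR (x : W) : epsL (epsR x) = 𝒮 (epsR x) := by
  rw [← WeakHopfAlgebra.mul_lTensor_antipode, comul_epsR]
  have : mul' ℂ W (lTensor W 𝒮 ((1 ⊗ₜ[ℂ] epsR x) * comul (R := ℂ) 1)) =
      mul' ℂ W (lTensor W 𝒮 (comul (R := ℂ) 1)) * 𝒮 (epsR x) := by
    rw [← (ℛ ℂ (1 : W)).eq]; simp [Finset.sum_mul, Finset.mul_sum, antipode_mul, mul_assoc]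
  rw [this, WeakHopfAlgebra.mul_lTensor_antipode, epsL_one, one_mul]

theorem epsR_epsL (x : W) : epsR (epsL x) = 𝒮 (epsL x) := by
  rw [← WeakHopfAlgebra.mul_rTensor_antipode, comul_epsL']
  have : mul' ℂ W (rTensor W 𝒮 (comul (R := ℂ) 1 * (epsL x ⊗ₜ[ℂ] 1))) =
      𝒮 (epsL x) * mul' ℂ W (rTensor W 𝒮 (comul (R := ℂ) 1)) := by
    rw [← (ℛ ℂ (1 : W)).eq]; simp [Finset.sum_mul, Finset.mul_sum, antipode_mul, mul_assoc]
  rw [this, WeakHopfAlgebra.mul_rTensor_antipode, epsR_one, mul_one]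

theorem map_epsL_id_comul_one :
    TensorProduct.map (epsLMap W) LinearMap.id (comul (1 : W)) = rTensor W 𝒮 (comul (1 : W)) := by
  have h := map_epsR_id_comul (1 : W)
  rw [← Algebra.TensorProduct.one_def, one_mul] at h
  rw [← h, ← (ℛ ℂ (1 : W)).eq]
  simp only [map_sum, TensorProduct.map_tmul, rTensor_tmul, epsRMap_apply, epsLMap_apply, epsL_epsR, id_apply]

theorem map_id_epsR_comul_one :
    TensorProduct.map LinearMap.id (epsRMap W) (comul (1 : W)) = lTensor W 𝒮 (comul (1 : W)) := by
  have h := map_id_epsL_comul (1 : W)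
  rw [← Algebra.TensorProduct.one_def, mul_one] at h
  rw [← h, ← (ℛ ℂ (1 : W)).eq]
  simp only [map_sum, TensorProduct.map_tmul, lTensor_tmul, epsRMap_apply, epsLMap_apply, epsR_epsL, id_apply]

/-- From `Δ(1) = (S ⊗ S)Δᵒᵖ(1)` and `S² = id`, the tensor `∑ 1⁽²⁾ ⊗ S(1⁽¹⁾)` equals `∑ ε_L(1⁽¹⁾) ⊗
1⁽²⁾`. Pair the first leg with `ε(x ·)`, which does not see `ε_L`. -/
theorem antipode_epsR (hS : ∀ x : W, (𝒮 (𝒮 x) : W) = x) (x : W) : 𝒮 (epsR x) = epsLOp W x := by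
  set r := ℛ ℂ (1 : W)
  have h1 := congrArg (rTensor W 𝒮) (map_antipode_antipode_comul_one (W := W))
  rw [← map_epsL_id_comul_one, ← r.eq] at h1
  have h2 := congrArg ((TensorProduct.lid ℂ W).toLinearMap ∘ₗ rTensor W (counit ∘ₗ mulLeft ℂ x)) h1
  simp only [map_sum, TensorProduct.map_tmul, TensorProduct.comm_tmul, rTensor_tmul, hS,
    epsLMap_apply, id_apply, comp_apply, LinearEquiv.coe_coe, TensorProduct.lid_tmul,
    mulLeft_apply, counit_mul_epsL] at h2
  rw [epsR_eq_sum r, epsLOp_eq_sum r, ← h2]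
  simp

theorem antipode_epsL (hS : ∀ x : W, (𝒮 (𝒮 x) : W) = x) (x : W) : 𝒮 (epsL x) = epsROp W x := by
  set r := ℛ ℂ (1 : W)
  have h1 := congrArg (lTensor W 𝒮) (map_antipode_antipode_comul_one (W := W))
  rw [← map_id_epsR_comul_one, ← r.eq] at h1
  have h2 := congrArg ((TensorProduct.rid ℂ W).toLinearMap ∘ₗ lTensor W (counit ∘ₗ mulRight ℂ x)) h1
  simp only [map_sum, TensorProduct.map_tmul, TensorProduct.comm_tmul, lTensor_tmul, hS,
    epsRMap_apply, id_apply, comp_apply, LinearEquiv.coe_coe, TensorProduct.rid_tmul,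
    mulRight_apply, counit_epsR_mul] at h2
  rw [epsL_eq_sum r, epsROp_eq_sum r, ← h2]
  simp

end Involutive

/-! ### The dual weak bialgebra through its pairing -/

section DualPairing
variable {W : Type u} [Ring W] [Algebra ℂ W]

section
variable [Coalgebra ℂ W]

theorem dual_one_apply (x : W) : (1 : DualAlg W) x = counit (R := ℂ) x := by
  simp

theorem dual_mul_apply {ι : Type*} {x : W} (r : Repr ℂ x ι) (φ ψ : DualAlg W) :
    (φ * ψ) x = ∑ i ∈ r.index, φ (r.left i) * ψ (r.right i) := r.convMul_apply _ _

theorem dualTensor_zero_mul (t : DualAlg W ⊗[ℂ] DualAlg W) : 0 * t = 0 :=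
  map_zero₂ (Algebra.TensorProduct.mul (R := ℂ)) t

theorem dualTensor_add_mul (t s s' : DualAlg W ⊗[ℂ] DualAlg W) :
    (s + s') * t = s * t + s' * t :=
  map_add₂ (Algebra.TensorProduct.mul (R := ℂ)) s s' t

theorem dualTensor_mul_zero (t : DualAlg W ⊗[ℂ] DualAlg W) : t * 0 = 0 :=
  map_zero (Algebra.TensorProduct.mul (R := ℂ) t)

theorem dualTensor_mul_add (t s s' : DualAlg W ⊗[ℂ] DualAlg W) :
    t * (s + s') = t * s + t * s' :=
  map_add (Algebra.TensorProduct.mul (R := ℂ) t) s s'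

end

section
variable [Module.Finite ℂ W]

theorem pair_comul (φ : DualAlg W) (x y : W) :
    dualTensorEquiv W (comul φ) (x ⊗ₜ[ℂ] y) = φ (x * y) := dualComul_pairing φ x y

theorem dual_counit_apply (φ : DualAlg W) : counit (R := ℂ) φ = φ 1 := rfl

end

variable [WeakBialgebra W] [Module.Finite ℂ W]

theorem dualTensorEquiv_mul {ι κ : Type*} {x y : W} (r : Repr ℂ x ι) (q : Repr ℂ y κ)
    (s t : DualAlg W ⊗[ℂ] DualAlg W) :
    dualTensorEquiv W (s * t) (x ⊗ₜ y) = ∑ i ∈ r.index, ∑ k ∈ q.index,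
      dualTensorEquiv W s (r.left i ⊗ₜ q.left k) * dualTensorEquiv W t (r.right i ⊗ₜ q.right k) := by
  induction s with
  | zero => simp [dualTensor_zero_mul]
  | add a b ha hb => simp only [dualTensor_add_mul, add_mul, map_add, LinearMap.add_apply, ha, hb, Finset.sum_add_distrib]
  | tmul a b =>
    induction t with
    | zero => simp [dualTensor_mul_zero]
    | add c d hc hd =>
      simp only [dualTensor_mul_add, mul_add, map_add, LinearMap.add_apply, hc, hd, Finset.sum_add_distrib]
    | tmul c d =>
      rw [Algebra.TensorProduct.tmul_mul_tmul, dualTensorEquiv_tmul, dual_mul_apply r,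
        dual_mul_apply q, Finset.sum_mul_sum]
      simp only [dualTensorEquiv_tmul]
      exact Finset.sum_congr rfl fun _ _ => Finset.sum_congr rfl fun _ _ => by ring

theorem lid_counit_apply (t : DualAlg W ⊗[ℂ] DualAlg W) (x : W) :
    (TensorProduct.lid ℂ (DualAlg W) (rTensor _ (counit (R := ℂ)) t)) x =
      dualTensorEquiv W t (1 ⊗ₜ[ℂ] x) := by
  induction t with
  | zero => simp
  | tmul a b => simp [dual_counit_apply]
  | add a b ha hb => simp only [map_add, LinearMap.add_apply, WithConv.ofConv_add, ha, hb]

theorem rid_counit_apply (t : DualAlg W ⊗[ℂ] DualAlg W) (x : W) :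
    (TensorProduct.rid ℂ (DualAlg W) (lTensor _ (counit (R := ℂ)) t)) x =
      dualTensorEquiv W t (x ⊗ₜ[ℂ] 1) := by
  induction t with
  | zero => simp
  | tmul a b => simp [dual_counit_apply, mul_comm]
  | add a b ha hb => simp only [map_add, LinearMap.add_apply, WithConv.ofConv_add, ha, hb]

theorem dual_comul_mul (φ ψ : DualAlg W) :
    comul (R := ℂ) (φ * ψ) = comul (R := ℂ) φ * comul ψ := by
  apply dual_ext
  intro x y
  rw [pair_comul, dualTensorEquiv_mul (ℛ ℂ x) (ℛ ℂ y), convMul_apply, WeakBialgebra.comul_mul]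
  conv_lhs => rw [← (ℛ ℂ x).eq, ← (ℛ ℂ y).eq]
  simp [Finset.sum_mul_sum, pair_comul]

/-- The counital maps of the dual are the transposes of those of `W`; this turns the integral axioms
for `φ` into statements about `W`. -/
theorem dual_epsL_apply (φ : DualAlg W) (y : W) : epsL φ y = φ (epsL y) := by
  rw [epsL, lid_counit_apply, dualTensorEquiv_mul (ℛ ℂ 1) (ℛ ℂ y), epsL_eq_sum (ℛ ℂ 1)]
  simp only [pair_comul, dualTensorEquiv_tmul, dual_one_apply, map_sum, map_smul, smul_eq_mul]
  refine Finset.sum_congr rfl fun i _ => ?_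
  conv_rhs => rw [← sum_counit_smul_right (ℛ ℂ y)]
  simp only [Finset.mul_sum, map_sum, mul_smul_comm, map_smul, smul_eq_mul, Finset.sum_mul]
  exact Finset.sum_congr rfl fun _ _ => by ring

theorem dual_epsR_apply (φ : DualAlg W) (y : W) : epsR φ y = φ (epsR y) := by
  rw [epsR, rid_counit_apply, dualTensorEquiv_mul (ℛ ℂ y) (ℛ ℂ 1), epsR_eq_sum (ℛ ℂ 1),
    Finset.sum_comm]
  simp only [pair_comul, dualTensorEquiv_tmul, dual_one_apply, map_sum, map_smul, smul_eq_mul]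
  refine Finset.sum_congr rfl fun i _ => ?_
  conv_rhs => rw [← sum_counit_smul (ℛ ℂ y)]
  simp only [Finset.sum_mul, map_sum, smul_mul_assoc, map_smul, smul_eq_mul]
  exact Finset.sum_congr rfl fun _ _ => by ring

end DualPairing

/-! ### Slicing tensors by functionals; Haar functionals -/

section Functional
variable {W : Type u} [Ring W] [Algebra ℂ W]

/-- `x ⊗ y ↦ φ(x) y`. -/
def evalLeft (φ : W →ₗ[ℂ] ℂ) : W ⊗[ℂ] W →ₗ[ℂ] W :=
  (TensorProduct.lid ℂ W).toLinearMap ∘ₗ rTensor W φ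

/-- `x ⊗ y ↦ φ(y) x`. -/
def evalRight (φ : W →ₗ[ℂ] ℂ) : W ⊗[ℂ] W →ₗ[ℂ] W :=
  (TensorProduct.rid ℂ W).toLinearMap ∘ₗ lTensor W φ

@[simp] theorem evalLeft_tmul (φ : W →ₗ[ℂ] ℂ) (x y : W) : evalLeft φ (x ⊗ₜ y) = φ x • y := by
  simp [evalLeft]

@[simp] theorem evalRight_tmul (φ : W →ₗ[ℂ] ℂ) (x y : W) : evalRight φ (x ⊗ₜ y) = φ y • x := by
  simp [evalRight]

theorem evalLeft_comm (φ : W →ₗ[ℂ] ℂ) (t : W ⊗[ℂ] W) :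
    evalLeft φ (TensorProduct.comm ℂ W W t) = evalRight φ t := by
  induction t with
  | zero => simp
  | add a b ha hb => simp only [map_add, ha, hb]
  | tmul a b => simp

theorem evalLeft_mul_tmul (φ : W →ₗ[ℂ] ℂ) (t : W ⊗[ℂ] W) (w : W) :
    evalLeft φ (t * (1 ⊗ₜ w)) = evalLeft φ t * w := by
  induction t with
  | zero => simp
  | add a b ha hb => simp only [map_add, ha, hb, add_mul]
  | tmul a b => simp

theorem evalRight_tmul_mul (φ : W →ₗ[ℂ] ℂ) (t : W ⊗[ℂ] W) (w : W) :
    evalRight φ ((w ⊗ₜ 1) * t) = w * evalRight φ t := by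
  induction t with
  | zero => simp
  | add a b ha hb => simp only [map_add, ha, hb, mul_add]
  | tmul a b => simp

theorem evalRight_mul_tmul (φ : W →ₗ[ℂ] ℂ) (t : W ⊗[ℂ] W) (w : W) :
    evalRight φ (t * (w ⊗ₜ 1)) = evalRight φ t * w := by
  induction t with
  | zero => simp
  | add a b ha hb => simp only [map_add, ha, hb, add_mul]
  | tmul a b => simp

end Functional

section HaarFunctional
variable {W : Type u} [Ring W] [Algebra ℂ W] [WeakBialgebra W] [Module.Finite ℂ W]

omit [WeakBialgebra W] in
theorem eq_of_forall_dual_eq {x y : W} (h : ∀ ψ : DualAlg W, ψ x = ψ y) : x = y :=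
  (Module.forall_dual_apply_eq_zero_iff ℂ (x - y)).1
    (fun f => by simpa [sub_eq_zero] using h (toConv f)) |> sub_eq_zero.1

/-- Test against every `ψ`: the two sides are `(ψφ)(x)` and `(ε_L(ψ)φ)(x)`. -/
theorem evalRight_comul {φ : DualAlg W} (hφ : ∀ ψ : DualAlg W, ψ * φ = epsL ψ * φ) (x : W) :
    evalRight φ.ofConv (comul x) = epsL (evalRight φ.ofConv (comul x)) := by
  apply eq_of_forall_dual_eq
  intro ψ
  have h := congrArg (fun f : DualAlg W => f x) (hφ ψ)
  simp only [dual_mul_apply (ℛ ℂ x), dual_epsL_apply] at h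
  rw [← epsLMap_apply, ← (ℛ ℂ x).eq]
  simpa [epsLMap_apply, mul_comm] using h

theorem evalLeft_comul {φ : DualAlg W} (hφ : ∀ ψ : DualAlg W, φ * ψ = φ * epsR ψ) (x : W) :
    evalLeft φ.ofConv (comul x) = epsR (evalLeft φ.ofConv (comul x)) := by
  apply eq_of_forall_dual_eq
  intro ψ
  have h := congrArg (fun f : DualAlg W => f x) (hφ ψ)
  simp only [dual_mul_apply (ℛ ℂ x), dual_epsR_apply] at h
  rw [← epsRMap_apply, ← (ℛ ℂ x).eq]
  simpa [epsRMap_apply] using h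

theorem evalRight_comul_one {φ : DualAlg W} (hφ : epsL φ = 1) :
    evalRight φ.ofConv (comul (1 : W)) = 1 := by
  set r := ℛ ℂ (1 : W)
  set w := evalRight φ.ofConv (comul (1 : W)) with hw
  have h1 : epsR w = w := by
    have h := map_epsR_id_comul (1 : W)
    rw [← Algebra.TensorProduct.one_def, one_mul] at h
    conv_rhs => rw [hw, ← h]
    rw [hw, ← epsRMap_apply, ← r.eq]
    simp
  have h2 : ∀ y, counit (R := ℂ) (w * y) = counit (R := ℂ) y := by
    intro y
    have h := congrArg (fun f : DualAlg W => f y) hφ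
    simp only [dual_epsL_apply, dual_one_apply, epsL_eq_sum r] at h
    rw [← h, hw, ← r.eq]
    simp [Finset.sum_mul, mul_comm]
  -- An element `w` fixed by `ε_R` is determined by the functional `ε(w ·)`, which here is `ε`.
  rw [← h1, epsR_eq_sum r]
  simp only [h2]
  exact sum_counit_smul_right r

theorem evalLeft_comul_one {φ : DualAlg W} (hφ : epsR φ = 1) :
    evalLeft φ.ofConv (comul (1 : W)) = 1 := by
  set r := ℛ ℂ (1 : W)
  set w := evalLeft φ.ofConv (comul (1 : W)) with hw
  have h1 : epsL w = w := by
    have h := map_id_epsL_comul (1 : W)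
    rw [← Algebra.TensorProduct.one_def, mul_one] at h
    conv_rhs => rw [hw, ← h]
    rw [hw, ← epsLMap_apply, ← r.eq]
    simp
  have h2 : ∀ y, counit (R := ℂ) (y * w) = counit (R := ℂ) y := by
    intro y
    have h := congrArg (fun f : DualAlg W => f y) hφ
    simp only [dual_epsR_apply, dual_one_apply, epsR_eq_sum r] at h
    rw [← h, hw, ← r.eq]
    simp [Finset.mul_sum, mul_comm]
  rw [← h1, epsL_eq_sum r]
  simp only [h2]
  exact sum_counit_smul r

end HaarFunctional

/-! ### The Haar functional is a trace -/

section Tracial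
variable {W : Type u} [Ring W] [Algebra ℂ W] [WeakHopfAlgebra W]
local notation "𝒮" => WeakHopfAlgebra.antipode

/-- Evaluate `∑ (S(y⁽¹⁾) ⊗ 1)Δ(y⁽²⁾) = (1 ⊗ y)Δ(1)` at `y = ε_L(x)`, where `Δ(y) = Δ(1)(y ⊗ 1)`, so
that `S(y)` splits off on the left. -/
theorem antipode_tmul_mul_comul_one (x : W) :
    ((𝒮 (epsL x) : W) ⊗ₜ[ℂ] (1 : W)) * comul (1 : W) = (1 ⊗ₜ[ℂ] epsL x) * comul (1 : W) := by
  have h := fun y : W => congrArg (fun f : WithConv (W →ₗ[ℂ] W ⊗[ℂ] W) => f y)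
    (antipode_tmul_conv_comul (W := W))
  let G : W ⊗[ℂ] W →ₗ[ℂ] W ⊗[ℂ] W := mul' ℂ (W ⊗[ℂ] W) ∘ₗ TensorProduct.map (inclL W ∘ₗ 𝒮) comul
  have hG : ∀ y : W, G (comul y) = (1 ⊗ₜ[ℂ] y) * comul (1 : W) := h
  have hz : ∀ t : W ⊗[ℂ] W, G (t * (epsL x ⊗ₜ[ℂ] 1)) = (𝒮 (epsL x) ⊗ₜ[ℂ] 1) * G t := by
    intro t
    induction t with
    | zero => simp
    | add a b ha hb => simp only [map_add, ha, hb, add_mul, mul_add]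
    | tmul a b =>
      simp only [G, Algebra.TensorProduct.tmul_mul_tmul, mul_one, comp_apply,
        TensorProduct.map_tmul, inclL_apply, mul'_apply, antipode_mul]
      rw [← mul_assoc, Algebra.TensorProduct.tmul_mul_tmul, mul_one]
  rw [← hG (epsL x), comul_epsL', hz, hG, ← Algebra.TensorProduct.one_def, one_mul]

variable [Module.Finite ℂ W]

/-- The character of the left regular representation. -/
def regularTrace (W : Type u) [Ring W] [Algebra ℂ W] : W →ₗ[ℂ] ℂ :=
  LinearMap.trace ℂ W ∘ₗ LinearMap.mul ℂ W

omit [WeakHopfAlgebra W] [Module.Finite ℂ W] in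
theorem regularTrace_mul_comm (x y : W) : regularTrace W (x * y) = regularTrace W (y * x) := by
  have h : ∀ a b : W, LinearMap.mul ℂ W (a * b) = LinearMap.mul ℂ W a * LinearMap.mul ℂ W b := by
    intro a b; ext z; simp [mul_assoc]
  simp only [regularTrace, comp_apply, h]
  exact LinearMap.trace_mul_comm ℂ _ _

/-- A functional composed with the antipode is a multiple of the regular character. -/
theorem apply_antipode_eq_regularTrace {h : W} (hh : IsHaarIntegral h)
    (hS : ∀ x : W, (𝒮 (𝒮 x) : W) = x) (φ : W →ₗ[ℂ] ℂ) (x : W) :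
    φ (𝒮 x) = regularTrace W (x * evalLeft φ (comul h)) := by
  set r := ℛ ℂ h
  -- By `Δ(h)(1 ⊗ y) = Δ(h)(S(y) ⊗ 1)`, left multiplication by `xq` is a sum of rank-one maps. Its
  -- trace is `∑ φ(h⁽¹⁾S(xh⁽²⁾)) = φ(ε_L(h)S(x))`.
  have h1 : LinearMap.mul ℂ W (x * evalLeft φ (comul h)) =
      ∑ i ∈ r.index, (φ ∘ₗ mulLeft ℂ (r.left i) ∘ₗ 𝒮).smulRight (x * r.right i) := by
    ext y
    have e := comul_mul_tmul_antipode hh.right_integral (𝒮 y)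
    rw [hS] at e
    rw [LinearMap.mul_apply', mul_assoc, ← evalLeft_mul_tmul, e, ← r.eq]
    simp [Finset.sum_mul, Finset.mul_sum]
  rw [regularTrace, comp_apply, h1, map_sum]
  simp only [LinearMap.trace_smulRight, comp_apply, mulLeft_apply, antipode_mul, ← mul_assoc]
  rw [← map_sum, ← Finset.sum_mul]
  have h2 := WeakHopfAlgebra.mul_lTensor_antipode h
  rw [hh.left_normalized, ← r.eq] at h2
  simp only [map_sum, lTensor_tmul, mul'_apply] at h2
  rw [h2, one_mul]

/-- The Haar functional of a weak Hopf algebra with cocommutative Haar integral is a trace. -/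
theorem haar_mul_comm {h : W} (hh : IsHaarIntegral h) (hcoc : IsCocommutative h)
    {φ : DualAlg W} (hφ : IsHaarIntegral φ) (x y : W) : φ (x * y) = φ (y * x) := by
  have hS := antipode_antipode hh hcoc
  set r := ℛ ℂ (1 : W)
  set q := evalLeft φ.ofConv (comul h) with hq
  have hφχ : ∀ x, φ (𝒮 x) = regularTrace W (x * q) :=
    apply_antipode_eq_regularTrace hh hS φ.ofConv
  -- Cocommutativity of `h` allows the other leg to be sliced, where left integrality of `φ`
  -- applies.
  have hqL : q = epsL q := by
    rw [hq, ← hcoc, evalLeft_comm]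
    exact evalRight_comul hφ.left_integral h
  set z := evalRight (regularTrace W) (comul (1 : W)) with hz
  -- Here `xz = ∑ x⁽¹⁾χ(ε'_L(x⁽²⁾))` and `zx = ∑ x⁽¹⁾χ(ε_L(x⁽²⁾))`. The character `χ` identifies the
  -- two counital maps, as `ε'_L(y) = ∑ S(y⁽²⁾)y⁽¹⁾` and `ε_L(y) = ∑ y⁽¹⁾S(y⁽²⁾)`.
  have hzc : ∀ x, x * z = z * x := by
    intro x
    rw [hz, ← evalRight_tmul_mul, ← evalRight_mul_tmul, ← map_id_epsL_comul, ← map_id_epsLOp_comul]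
    have : regularTrace W ∘ₗ epsLOp W = regularTrace W ∘ₗ epsLMap W := by
      ext y
      rw [comp_apply, comp_apply, ← antipode_epsR hS, epsLMap_apply,
        ← WeakHopfAlgebra.mul_rTensor_antipode, ← WeakHopfAlgebra.mul_lTensor_antipode,
        ← (ℛ ℂ y).eq]
      simp [antipode_mul, hS, regularTrace_mul_comm]
    rw [← (ℛ ℂ x).eq]
    simp only [map_sum, TensorProduct.map_tmul, evalRight_tmul, ← comp_apply, this]
  -- Since `q = ε_L(q)`, the factor `S(q)` crosses `Δ(1)` to become `q` on the leg seen by `χ`,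
  -- where `χ(q ·) = φ ∘ S`. The normalization of `φ` does the rest.
  have hzq : 𝒮 q * z = 1 := by
    have e := evalLeft_comul_one hφ.right_normalized
    rw [← map_antipode_antipode_comul_one] at e
    have e' := congrArg 𝒮 e
    rw [antipode_one, ← r.eq] at e'
    rw [hqL, hz, ← evalRight_tmul_mul, antipode_tmul_mul_comul_one, ← hqL]
    refine Eq.trans ?_ e'
    rw [← r.eq]
    simp [hS, Finset.mul_sum, hφχ, regularTrace_mul_comm q]
  -- `S(q)` is the inverse of a central element.
  have hSq : ∀ x, 𝒮 q * x = x * 𝒮 q := by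
    intro x
    calc 𝒮 q * x = 𝒮 q * (x * z) * 𝒮 q := by
          rw [hzc, mul_assoc, mul_assoc, ← hzc, mul_assoc, hzq, mul_one]
      _ = x * 𝒮 q := by rw [hzc, ← mul_assoc, hzq, one_mul]
  have hqc : ∀ x, q * x = x * q := by
    intro x
    rw [← hS (q * x), ← hS (x * q), antipode_mul, antipode_mul x, hSq]
  rw [← hS (x * y), ← hS (y * x), hφχ, hφχ, antipode_mul, antipode_mul, mul_assoc, ← hqc,
    ← mul_assoc, regularTrace_mul_comm, mul_assoc]

end Tracial

/-! ### Invariant functionals and their uniqueness -/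

section Invariance
variable {W : Type u} [Ring W] [Algebra ℂ W] [WeakHopfAlgebra W]
local notation "𝒮" => WeakHopfAlgebra.antipode

/-- A representation of `Δ(S(x))` from one of `Δ(x)`. -/
def antipodeRepr {ι : Type*} {x : W} (r : Repr ℂ x ι) : Repr ℂ (𝒮 x : W) ι where
  index := r.index
  left i := 𝒮 (r.right i)
  right i := 𝒮 (r.left i)
  eq := by rw [comul_antipode, ← r.eq]; simp

/-- A functional with `∑ φ(x⁽¹⁾y) x⁽²⁾ = ∑ φ(xy⁽¹⁾) S(y⁽²⁾)`. -/
def IsInvariant (φ : W →ₗ[ℂ] ℂ) : Prop :=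
  ∀ x y : W, evalLeft φ (comul x * (y ⊗ₜ[ℂ] 1)) = evalLeft φ ((x ⊗ₜ[ℂ] 1) * lTensor W 𝒮 (comul y))

theorem lTensor_antipode_comul_mul_one (hS : ∀ x : W, (𝒮 (𝒮 x) : W) = x) (x : W) :
    TensorProduct.map LinearMap.id (epsRMap W) (comul x) =
      (x ⊗ₜ[ℂ] 1) * lTensor W 𝒮 (comul (1 : W)) := by
  have h := congrArg (lTensor W 𝒮) (map_id_epsLOp_comul x)
  have h1 : lTensor W 𝒮 ((x ⊗ₜ[ℂ] 1) * comul (1 : W)) =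
      (x ⊗ₜ[ℂ] 1) * lTensor W 𝒮 (comul (1 : W)) := by
    rw [← (ℛ ℂ (1 : W)).eq]
    simp [Finset.mul_sum]
  rw [← h1, ← h, ← (ℛ ℂ x).eq]
  simp only [map_sum, TensorProduct.map_tmul, lTensor_tmul, ← antipode_epsR hS, hS, epsRMap_apply,
    id_apply]

/-- The hypothesis allows `ε_R` to be inserted on the second leg, so that `(φ ⊗ id)(Δ(x)Δ(y)) = ∑
φ(xy⁽¹⁾)ε_R(y⁽²⁾)`. Convolving both sides in `y` with `S` on the right gives invariance, because
`ε_R` convolved with `S` is `S` and `∑ Δ(y⁽¹⁾)(1 ⊗ S(y⁽²⁾)) = Δ(1)(y ⊗ 1)`. -/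
theorem isInvariant_of_evalLeft_comul (hS : ∀ x : W, (𝒮 (𝒮 x) : W) = x) {φ : W →ₗ[ℂ] ℂ}
    (hφ : ∀ x, evalLeft φ (comul x) = epsR (evalLeft φ (comul x))) : IsInvariant φ := by
  intro x y
  let a : WithConv (W →ₗ[ℂ] W) := toConv ((φ ∘ₗ mulLeft ℂ x).smulRight 1)
  let D : W →ₗ[ℂ] W := evalLeft φ ∘ₗ mulLeft ℂ (comul x) ∘ₗ comul
  have h0 : ∀ w : W, evalLeft φ (TensorProduct.map LinearMap.id (epsRMap W) (comul w)) =
      evalLeft φ (comul w) := by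
    intro w
    rw [hφ w, ← epsRMap_apply, ← (ℛ ℂ w).eq]
    simp
  have h1 : ∀ (g : W →ₗ[ℂ] W) (y : W), (a * toConv g) y =
      evalLeft φ ((x ⊗ₜ[ℂ] 1) * lTensor W g (comul y)) := by
    intro g y
    rw [(ℛ ℂ y).convMul_apply, ← (ℛ ℂ y).eq]
    simp [a, Finset.mul_sum]
  have h2 : toConv D = a * toConv (epsRMap W) := by
    ext y
    refine Eq.trans ?_ (h1 (epsRMap W) y).symm
    have e : lTensor W (epsRMap W) (comul y) = (y ⊗ₜ[ℂ] 1) * lTensor W 𝒮 (comul (1 : W)) :=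
      lTensor_antipode_comul_mul_one hS y
    rw [e, ← mul_assoc, Algebra.TensorProduct.tmul_mul_tmul, mul_one,
      ← lTensor_antipode_comul_mul_one hS, h0, WeakBialgebra.comul_mul]
    rfl
  have h3 := congrArg (fun f : WithConv (W →ₗ[ℂ] W) => (f * (toConv 𝒮 : WithConv (W →ₗ[ℂ] W))) y) h2
  beta_reduce at h3
  rw [mul_assoc, epsR_conv_antipode, h1] at h3
  rw [← h3]
  have h4 := congrArg (fun f : WithConv (W →ₗ[ℂ] W ⊗[ℂ] W) => evalLeft φ (comul x * f y))
    (comul_conv_tmul_antipode (W := W))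
  beta_reduce at h4
  rw [(ℛ ℂ y).convMul_apply] at h4 ⊢
  simp only [Finset.mul_sum, map_sum, comp_apply, inclR_apply, ← mul_assoc, evalLeft_mul_tmul] at h4
  refine Eq.trans ?_ h4.symm
  simp only [mulLeft_apply, inclL_apply]
  rw [← mul_assoc, comul_mul_one]

/-- Apply `ψ` to invariance at `x = 1`; the side containing `Δ(1)` is `φ(y)` by the normalization of
`ψ`. -/
theorem sum_apply_mul_apply_antipode {φ ψ : W →ₗ[ℂ] ℂ} (hφ : IsInvariant φ)
    (hψ : evalRight ψ (comul (1 : W)) = 1) {ι : Type*} {y : W} (r : Repr ℂ y ι) :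
    ∑ i ∈ r.index, φ (r.left i) * ψ (𝒮 (r.right i)) = φ y := by
  have h := congrArg ψ (hφ 1 y)
  rw [← Algebra.TensorProduct.one_def, one_mul, ← r.eq, ← (ℛ ℂ (1 : W)).eq] at h
  rw [← (ℛ ℂ (1 : W)).eq] at hψ
  simp only [Finset.sum_mul, map_sum, Algebra.TensorProduct.tmul_mul_tmul, mul_one, evalLeft_tmul,
    evalRight_tmul, lTensor_tmul, map_smul, smul_eq_mul] at h hψ
  rw [← h]
  conv_rhs => rw [← one_mul y, ← hψ]
  simp [Finset.sum_mul, mul_comm]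

/-- Normalized invariant functionals are unique up to the antipode, hence unique. -/
theorem apply_antipode_eq (hS : ∀ x : W, (𝒮 (𝒮 x) : W) = x) {φ ψ : W →ₗ[ℂ] ℂ}
    (hφ : IsInvariant φ) (hψ : IsInvariant ψ) (hφ1 : evalRight φ (comul (1 : W)) = 1)
    (hψ1 : evalRight ψ (comul (1 : W)) = 1) (y : W) : φ (𝒮 y) = ψ y := by
  set r := ℛ ℂ y
  -- With the roles of `φ` and `ψ` exchanged, both sides become `∑ ψ(y⁽¹⁾)φ(S(y⁽²⁾))`.
  rw [← sum_apply_mul_apply_antipode hφ hψ1 (antipodeRepr r), ← sum_apply_mul_apply_antipode hψ hφ1 r]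
  simp [antipodeRepr, hS, mul_comm]

end Invariance

/-! ### The involution, the counit and the antipode -/

section Star
variable {W : Type u} [Ring W] [Algebra ℂ W] [StarRing W] [StarModule ℂ W]
  [CStarWeakHopfAlgebra W]
local notation "𝒮" => WeakHopfAlgebra.antipode

/-- A representation of `Δ(x⋆)` from one of `Δ(x)`. -/
def starRepr {ι : Type*} {x : W} (r : Repr ℂ x ι) : Repr ℂ (star x) ι where
  index := r.index
  left i := star (r.left i)
  right i := star (r.right i)
  eq := by
    rw [CStarWeakHopfAlgebra.comul_star, ← r.eq, star_sum]
    simp [TensorProduct.star_tmul]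

/-- The linear map `x ↦ (f(x⋆))⋆`. -/
def starConj (f : W →ₗ[ℂ] W) : W →ₗ[ℂ] W where
  toFun x := star (f (star x))
  map_add' x y := by simp
  map_smul' c x := by simp

/-- The functional `x ↦ conj φ(x⋆)`. -/
def starFunctional (φ : W →ₗ[ℂ] ℂ) : W →ₗ[ℂ] ℂ where
  toFun x := star (φ (star x))
  map_add' x y := by simp
  map_smul' c x := by simp

/-- The functional `x ↦ conj ε(x⋆)` is also a counit, and a left counit equals a right counit. -/
theorem counit_star (x : W) : counit (R := ℂ) (star x) = star (counit (R := ℂ) x) := by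
  set r := ℛ ℂ x
  have h : ∑ i ∈ r.index, star (counit (R := ℂ) (star (r.left i))) • r.right i = x := by
    have := congrArg star (sum_counit_smul (starRepr r))
    simpa [starRepr, star_sum] using this
  have h1 := congrArg (counit (R := ℂ)) h
  have h2 := congrArg (starFunctional (counit (R := ℂ))) (sum_counit_smul_right r)
  have h3 : starFunctional (counit (R := ℂ)) x = counit (R := ℂ) x := by
    rw [← h1, ← h2]
    simp [starFunctional, mul_comm]
  rw [← h3]
  simp [starFunctional]

/-- `∑ 1⁽¹⁾⋆ ⊗ 1⁽²⁾⋆ = Δ(1)`. -/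
def starReprOne {ι : Type*} (r : Repr ℂ (1 : W) ι) : Repr ℂ (1 : W) ι where
  index := r.index
  left i := star (r.left i)
  right i := star (r.right i)
  eq := (starRepr r).eq.trans (by rw [star_one])

theorem star_epsR_star (x : W) : star (epsR (star x)) = epsROp W x := by
  set r := ℛ ℂ (1 : W)
  rw [epsR_eq_sum r, epsROp_eq_sum (starReprOne r)]
  simp only [star_sum, star_smul, starReprOne, ← counit_star, star_mul, star_star]

theorem star_epsL_star (x : W) : star (epsL (star x)) = epsLOp W x := by
  set r := ℛ ℂ (1 : W)
  rw [epsL_eq_sum r, epsLOp_eq_sum (starReprOne r)]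
  simp only [star_sum, star_smul, starReprOne, ← counit_star, star_mul, star_star]

/-- Put `P(x) = S(S(x⋆)⋆)`. In the convolution algebra `P S = ε_L` and `P ε_R = P`, so that `P = P(S
id) = ε_L id = id`; apply `S` to `P(x) = x`. -/
theorem antipode_star (hS : ∀ x : W, (𝒮 (𝒮 x) : W) = x) (x : W) :
    (𝒮 (star x) : W) = star (𝒮 x) := by
  let P : WithConv (W →ₗ[ℂ] W) := toConv (𝒮 ∘ₗ starConj 𝒮)
  have hP : ∀ x, P x = 𝒮 (star (𝒮 (star x))) := fun _ => rfl
  have h1 : P * toConv 𝒮 = toConv (epsLMap W) := by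
    ext x
    have e := WeakHopfAlgebra.mul_rTensor_antipode (star x)
    rw [← (starRepr (ℛ ℂ x)).eq] at e
    have e' := congrArg (fun w => (𝒮 (star w) : W)) e
    beta_reduce at e'
    rw [star_epsR_star, ← antipode_epsL hS, hS] at e'
    refine ((ℛ ℂ x).convMul_apply _ _).trans (Eq.trans ?_ e')
    simp [starRepr, star_sum, antipode_mul, hP]
  have h2 : P * toConv (epsRMap W) = P := by
    ext x
    have e := congrArg (fun f : WithConv (W →ₗ[ℂ] W) => f (star x)) (antipode_conv_epsL (W := W))
    beta_reduce at e
    rw [(starRepr (ℛ ℂ x)).convMul_apply] at e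
    have e' := congrArg (fun w => (𝒮 (star w) : W)) e
    refine ((ℛ ℂ x).convMul_apply _ _).trans (Eq.trans ?_ e')
    simp only [starRepr, star_sum, star_mul, map_sum, antipode_mul, epsLMap_apply, star_epsL_star,
      ← antipode_epsR hS, hS, epsRMap_apply, hP]
  have h3 : P = toConv LinearMap.id := by
    rw [← h2, ← antipode_conv_id, ← mul_assoc, h1, epsL_conv_id]
  have h4 : ∀ y, 𝒮 (star (𝒮 (star y))) = y := fun y =>
    congrArg (fun f : WithConv (W →ₗ[ℂ] W) => f y) h3
  have h5 := congrArg 𝒮 (h4 x)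
  rw [hS] at h5
  rw [← h5, star_star]

theorem evalRight_starFunctional {φ : W →ₗ[ℂ] ℂ} (hφ : evalRight φ (comul (1 : W)) = 1) :
    evalRight (starFunctional φ) (comul (1 : W)) = 1 := by
  set r := ℛ ℂ (1 : W)
  rw [← (starReprOne r).eq] at hφ
  rw [← r.eq]
  have := congrArg star hφ
  simpa [starReprOne, starFunctional, star_sum] using this

/-- Conjugating the invariance identity reverses the products inside `φ`; the trace property
restores their order. -/
theorem isInvariant_starFunctional (hS : ∀ x : W, (𝒮 (𝒮 x) : W) = x) {φ : W →ₗ[ℂ] ℂ}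
    (hφ : IsInvariant φ) (ht : ∀ x y, φ (x * y) = φ (y * x)) : IsInvariant (starFunctional φ) := by
  intro x y
  have h := congrArg star (hφ (star x) (star y))
  rw [← (starRepr (ℛ ℂ x)).eq, ← (starRepr (ℛ ℂ y)).eq] at h
  rw [← (ℛ ℂ x).eq, ← (ℛ ℂ y).eq]
  simp only [starRepr, Finset.sum_mul, Finset.mul_sum, map_sum, lTensor_tmul, star_sum,
    Algebra.TensorProduct.tmul_mul_tmul, mul_one, one_mul, evalLeft_tmul, star_smul,
    antipode_star hS, star_star] at h
  simp only [Finset.sum_mul, Finset.mul_sum, map_sum, lTensor_tmul,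
    Algebra.TensorProduct.tmul_mul_tmul, mul_one, one_mul, evalLeft_tmul, starFunctional, coe_mk,
    AddHom.coe_mk, star_mul, ht (star y), ht _ (star x)]
  exact h

end Star

/-! ### Invariance, antipode and star for the Haar functional -/

section HaarInvariance
variable {W : Type u} [Ring W] [Algebra ℂ W] [StarRing W] [StarModule ℂ W]
  [CStarWeakHopfAlgebra W] [Module.Finite ℂ W]
local notation "𝒮" => WeakHopfAlgebra.antipode

variable {h : W} (hh : IsHaarIntegral h) (hcoc : IsCocommutative h) {φ : DualAlg W}
  (hφ : IsHaarIntegral φ)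
include hh hcoc hφ

theorem haar_isInvariant : IsInvariant φ.ofConv :=
  isInvariant_of_evalLeft_comul (antipode_antipode hh hcoc)
    (evalLeft_comul hφ.right_integral)

theorem haar_antipode (x : W) : φ (𝒮 x) = φ x :=
  apply_antipode_eq (antipode_antipode hh hcoc) (haar_isInvariant hh hcoc hφ)
    (haar_isInvariant hh hcoc hφ) (evalRight_comul_one hφ.left_normalized)
    (evalRight_comul_one hφ.left_normalized) x

theorem haar_star (x : W) : φ (star x) = star (φ x) := by
  have e := apply_antipode_eq (antipode_antipode hh hcoc) (haar_isInvariant hh hcoc hφ)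
    (isInvariant_starFunctional (antipode_antipode hh hcoc) (haar_isInvariant hh hcoc hφ)
      (haar_mul_comm hh hcoc hφ))
    (evalRight_comul_one hφ.left_normalized)
    (evalRight_starFunctional (evalRight_comul_one hφ.left_normalized)) x
  rw [haar_antipode hh hcoc hφ] at e
  rw [e]
  simp [starFunctional]

/-- `∑ φ(x⁽¹⁾y) x⁽²⁾ = ∑ φ(xy⁽¹⁾) S(y⁽²⁾)`. -/
theorem haar_invariant_left {ι κ : Type*} {x y : W} (r : Repr ℂ x ι) (q : Repr ℂ y κ) :
    ∑ i ∈ r.index, φ (r.left i * y) • r.right i =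
      ∑ k ∈ q.index, φ (x * q.left k) • 𝒮 (q.right k) := by
  have := haar_isInvariant hh hcoc hφ x y
  rw [← r.eq, ← q.eq] at this
  simpa [Finset.sum_mul, Finset.mul_sum] using this

/-- `∑ φ(x⁽²⁾y) x⁽¹⁾ = ∑ φ(xy⁽²⁾) S(y⁽¹⁾)`. -/
theorem haar_invariant_right {ι κ : Type*} {x y : W} (r : Repr ℂ x ι) (q : Repr ℂ y κ) :
    ∑ i ∈ r.index, φ (r.right i * y) • r.left i =
      ∑ k ∈ q.index, φ (x * q.right k) • 𝒮 (q.left k) := by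
  have hS := antipode_antipode hh hcoc
  -- The mirror identity is the first one for `S(y)` and `S(x)`, as `φ ∘ S = φ`.
  have e := haar_invariant_left hh hcoc hφ (antipodeRepr q) (antipodeRepr r)
  simp only [antipodeRepr, ← antipode_mul, haar_antipode hh hcoc hφ, hS] at e
  exact e.symm

end HaarInvariance

/-! ### Convolution products along lists -/

section ConvList
variable {A B ι : Type*} [AddCommGroup A] [Module ℂ A] [Coalgebra ℂ A] [Ring B] [Algebra ℂ B]

/-- The convolution product of a list of linear maps. -/
def convList (F : ι → A →ₗ[ℂ] B) (l : List ι) : WithConv (A →ₗ[ℂ] B) :=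
  (l.map fun d => toConv (F d)).prod

@[simp] theorem convList_nil (F : ι → A →ₗ[ℂ] B) : convList F [] = 1 := rfl

@[simp] theorem convList_cons (F : ι → A →ₗ[ℂ] B) (d : ι) (l : List ι) :
    convList F (d :: l) = toConv (F d) * convList F l := by simp [convList]

theorem convList_append (F : ι → A →ₗ[ℂ] B) (l l' : List ι) :
    convList F (l ++ l') = convList F l * convList F l' := by simp [convList]

theorem convMul_commute {f g : WithConv (A →ₗ[ℂ] B)} {b : B} (hf : ∀ a, Commute b (f a))
    (hg : ∀ a, Commute b (g a)) (a : A) : Commute b ((f * g) a) := by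
  rw [(ℛ ℂ a).convMul_apply]
  exact Commute.sum_right _ _ _ fun i _ => (hf _).mul_right (hg _)

theorem commute_convList {F : ι → A →ₗ[ℂ] B} {b : B} {l : List ι}
    (h : ∀ d ∈ l, ∀ a, Commute b (F d a)) (a : A) : Commute b (convList F l a) := by
  induction l generalizing a with
  | nil => exact (Algebra.commutes _ _).symm
  | cons d l ih =>
    rw [convList_cons]
    exact convMul_commute (h d (by simp)) (ih fun d hd => h d (by simp [hd])) a

theorem convList_commute_convList {C : Type*} [AddCommGroup C] [Module ℂ C] [Coalgebra ℂ C]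
    {F : ι → A →ₗ[ℂ] B} {G : ι → C →ₗ[ℂ] B} {l l' : List ι}
    (h : ∀ d ∈ l, ∀ d' ∈ l', ∀ a b, Commute (F d a) (G d' b)) (a : A) (b : C) :
    Commute (convList F l a) (convList G l' b) :=
  commute_convList (fun d' hd' b => (commute_convList
    (fun d hd a => (h d hd d' hd' a b).symm) a).symm) b

theorem convMul_comm_of_cocomm {f g : WithConv (A →ₗ[ℂ] B)}
    (h : ∀ a b, Commute (f a) (g b)) {c : A}
    (hc : TensorProduct.comm ℂ A A (comul c) = comul (R := ℂ) c) : (f * g) c = (g * f) c := by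
  rw [(ℛ ℂ c).convMul_apply]
  rw [convMul_apply, ← hc, ← (ℛ ℂ c).eq]
  simp only [map_sum, TensorProduct.comm_tmul, TensorProduct.map_tmul, mul'_apply]
  exact Finset.sum_congr rfl fun i _ => h _ _

theorem convList_rotate {F : ι → A →ₗ[ℂ] B} (hF : ∀ d d', d ≠ d' → ∀ a b, Commute (F d a) (F d' b))
    {d : ι} {l : List ι} (hd : d ∉ l) {c : A}
    (hc : TensorProduct.comm ℂ A A (comul c) = comul (R := ℂ) c) :
    convList F (d :: l) c = convList F (l ++ [d]) c := by
  rw [convList_cons, convList_append, convList_cons, convList_nil, mul_one]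
  refine convMul_comm_of_cocomm (fun a b => ?_) hc
  refine commute_convList (fun d' hd' b => hF d d' ?_ a b) b
  rintro rfl
  exact hd hd'

/-- Adjoint pairs of linear maps multiply to adjoint pairs under convolution. -/
theorem convList_adjoint {F : ι → A →ₗ[ℂ] B}
    (hF : ∀ d d', d ≠ d' → ∀ a b, Commute (F d a) (F d' b)) {R : B → B → Prop}
    (hR0 : R 0 0) (hRadd : ∀ a a' b b', R a a' → R b b' → R (a + b) (a' + b'))
    (hRmul : ∀ a a' b b', R a a' → R b b' → R (a * b) (b' * a')) {σ : A → A}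
    (hσ : ∀ c : A, ∃ (s : Finset (A × A)) (a b : A × A → A), ∑ i ∈ s, a i ⊗ₜ[ℂ] b i = comul c ∧
      ∑ i ∈ s, σ (a i) ⊗ₜ[ℂ] σ (b i) = comul (σ c))
    (hFσ : ∀ d c, R (F d c) (F d (σ c))) {l : List ι} (hl : l ≠ []) (hn : l.Nodup) (c : A) :
    R (convList F l c) (convList F l (σ c)) := by
  induction l generalizing c with
  | nil => exact absurd rfl hl
  | cons d l ih =>
    by_cases hl' : l = []
    · subst hl'
      simpa using hFσ d c
    obtain ⟨s, a, b, h1, h2⟩ := hσ c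
    have e1 := ({index := s, left := a, right := b, eq := h1} : Coalgebra.Repr ℂ c (A × A)).convMul_apply (toConv (F d)) (convList F l)
    have e2 := ({index := s, left := fun i => σ (a i), right := fun i => σ (b i), eq := h2} :
      Coalgebra.Repr ℂ (σ c) (A × A)).convMul_apply (toConv (F d)) (convList F l)
    rw [convList_cons, e1, e2]
    have hsum : ∀ (t : Finset (A × A)) (f g : A × A → B), (∀ i, R (f i) (g i)) →
        R (∑ i ∈ t, f i) (∑ i ∈ t, g i) := by
      intro t f g hfg
      classical
      induction t using Finset.induction_on with
      | empty => simpa using hR0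
      | insert i t hi iht => rw [Finset.sum_insert hi, Finset.sum_insert hi]; exact hRadd _ _ _ _ (hfg i) iht
    refine hsum _ _ _ fun i => ?_
    -- Passing to adjoints reverses the two factors; commuting them restores the order of the list.
    have hcomm : Commute (F d (σ (a i))) (convList F l (σ (b i))) := by
      refine commute_convList (fun d' hd' b => hF d d' ?_ _ b) _
      rintro rfl
      exact (List.nodup_cons.1 hn).1 hd'
    change R _ (F d (σ (a i)) * convList F l (σ (b i)))
    rw [hcomm.eq]
    exact hRmul _ _ _ _ (hFσ d (a i)) (ih hl' (List.nodup_cons.1 hn).2 (b i))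

end ConvList

section ConvListMul
variable {A B ι : Type*} [Ring A] [Algebra ℂ A] [Coalgebra ℂ A] [Ring B] [Algebra ℂ B]

theorem convMul_map_mul (hA : ∀ x y : A, comul (R := ℂ) (x * y) = comul x * comul y)
    {f g : WithConv (A →ₗ[ℂ] B)} (hf : ∀ x y, f (x * y) = f x * f y)
    (hg : ∀ x y, g (x * y) = g x * g y) (hfg : ∀ x y, Commute (f x) (g y)) (x y : A) :
    (f * g) (x * y) = (f * g) x * (f * g) y := by
  rw [(ℛ ℂ x).convMul_apply, (ℛ ℂ y).convMul_apply, convMul_apply, hA, Finset.sum_mul_sum]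
  conv_lhs => rw [← (ℛ ℂ x).eq, ← (ℛ ℂ y).eq]
  simp only [Finset.sum_mul_sum, map_sum, Algebra.TensorProduct.tmul_mul_tmul,
    TensorProduct.map_tmul, mul'_apply, hf, hg]
  refine Finset.sum_congr rfl fun i _ => Finset.sum_congr rfl fun j _ => ?_
  rw [mul_assoc, mul_assoc, ← mul_assoc (f ((ℛ ℂ y).left j)), (hfg _ _).eq, mul_assoc]

/-- The induction starts from a single factor: the empty product is the counit, which need not be
multiplicative in a weak bialgebra. -/
theorem convList_map_mul (hA : ∀ x y : A, comul (R := ℂ) (x * y) = comul x * comul y)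
    {F : ι → A →ₗ[ℂ] B} (hF : ∀ d d', d ≠ d' → ∀ a b, Commute (F d a) (F d' b))
    (hm : ∀ d x y, F d (x * y) = F d x * F d y) {l : List ι} (hl : l ≠ []) (hn : l.Nodup) (x y : A) :
    convList F l (x * y) = convList F l x * convList F l y := by
  induction l generalizing x y with
  | nil => exact absurd rfl hl
  | cons d l ih =>
    by_cases hl' : l = []
    · subst hl'
      simpa using hm d x y
    rw [convList_cons]
    refine convMul_map_mul hA (hm d) (ih hl' (List.nodup_cons.1 hn).2) (fun x y => ?_) x y
    refine commute_convList (fun d' hd' b => hF d d' ?_ _ b) _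
    rintro rfl
    exact (List.nodup_cons.1 hn).1 hd'

end ConvListMul

/-! ### Cycles of the rotation system as lists -/

namespace DirectedLattice
variable {E : Type v} [Fintype E] (p : Equiv.Perm (E × Bool)) (x : E × Bool)

theorem mem_periodicPts : x ∈ Function.periodicPts p := by
  refine ⟨orderOf p, orderOf_pos p, ?_⟩
  rw [Function.IsPeriodicPt, Function.IsFixedPt, Equiv.Perm.iterate_eq_pow, pow_orderOf_eq_one]
  rfl

theorem minimalPeriod_pos : 0 < Function.minimalPeriod p x :=
  Function.minimalPeriod_pos_of_mem_periodicPts (mem_periodicPts p x)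

omit [Fintype E] in
theorem pow_minimalPeriod : (p ^ Function.minimalPeriod p x) x = x := by
  rw [← Equiv.Perm.iterate_eq_pow]
  exact Function.iterate_minimalPeriod

theorem cycleList_ne_nil : cycleList p x ≠ [] := by
  have := minimalPeriod_pos p x
  simp [cycleList]
  omega

omit [Fintype E] in
theorem cycleList_nodup : (cycleList p x).Nodup := by
  rw [cycleList]
  refine List.Nodup.map_on (fun i hi j hj h => ?_) List.nodup_range
  rw [← Equiv.Perm.iterate_eq_pow, ← Equiv.Perm.iterate_eq_pow] at h
  exact Function.iterate_injOn_Iio_minimalPeriod (by simpa using hi) (by simpa using hj) h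

/-- Listing a cycle from the next element rotates the list. -/
theorem cycleList_rotate : ∃ l, cycleList p x = x :: l ∧ cycleList p (p x) = l ++ [x] := by
  obtain ⟨n, hn⟩ := Nat.exists_eq_succ_of_ne_zero (minimalPeriod_pos p x).ne'
  refine ⟨(List.range n).map fun k => (p ^ (k + 1)) x, ?_, ?_⟩
  · rw [cycleList, hn, List.range_succ_eq_map]
    simp [Function.comp_def]
  · have h := pow_minimalPeriod p x
    rw [cycleList, Function.minimalPeriod_apply (mem_periodicPts p x), hn, List.range_succ]
    rw [hn] at h
    simp only [List.map_append, List.map_cons, List.map_nil, ← Equiv.Perm.mul_apply, ← pow_succ]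
    rw [h]

theorem mem_cycleList {x y : E × Bool} : y ∈ cycleList p x ↔ p.SameCycle x y := by
  constructor
  · intro h
    simp only [cycleList, List.mem_map, List.mem_range] at h
    obtain ⟨k, -, rfl⟩ := h
    exact ⟨k, by simp⟩
  · intro h
    classical
    obtain ⟨i, -, rfl⟩ := h.exists_pow_eq'
    simp only [cycleList, List.mem_map, List.mem_range]
    refine ⟨i % Function.minimalPeriod p x, Nat.mod_lt _ (minimalPeriod_pos p x), ?_⟩
    rw [← Equiv.Perm.iterate_eq_pow, ← Equiv.Perm.iterate_eq_pow]
    exact Function.iterate_mod_minimalPeriod_eq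

/-- A function constant along a permutation is constant on its cycles. -/
theorem eq_of_sameCycle {β : Sort*} {f : E × Bool → β} (hf : ∀ x, f (p x) = f x) {x y : E × Bool}
    (h : p.SameCycle x y) : f x = f y := by
  classical
  obtain ⟨i, -, rfl⟩ := h.exists_pow_eq'
  clear h
  induction i with
  | zero => rfl
  | succ i ih => rw [pow_succ', Equiv.Perm.mul_apply, hf, ih]

theorem convList_cycleList {A B : Type*} [AddCommGroup A] [Module ℂ A] [Coalgebra ℂ A] [Ring B]
    [Algebra ℂ B] {F : E × Bool → A →ₗ[ℂ] B}
    (hF : ∀ d d', d ≠ d' → ∀ a b, Commute (F d a) (F d' b)) {c : A}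
    (hc : TensorProduct.comm ℂ A A (comul c) = comul (R := ℂ) c) {x y : E × Bool}
    (h : p.SameCycle x y) : convList F (cycleList p x) c = convList F (cycleList p y) c := by
  refine eq_of_sameCycle p (f := fun x => convList F (cycleList p x) c) (fun x => ?_) h
  obtain ⟨l, h1, h2⟩ := cycleList_rotate p x
  have hn := cycleList_nodup p x
  rw [h1] at hn
  rw [h1, h2, convList_rotate hF (List.nodup_cons.1 hn).1 hc]

end DirectedLattice

/-! ### Operators on one edge and their exchange relations -/

section LocalOperators
variable {W : Type u} [Ring W] [Algebra ℂ W]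

/-- The functional `ψ(w·)`. -/
def dualMulLeft (w : W) (ψ : DualAlg W) : DualAlg W := toConv (ψ.ofConv ∘ₗ mulLeft ℂ w)

/-- The functional `ψ(·w)`. -/
def dualMulRight (w : W) (ψ : DualAlg W) : DualAlg W := toConv (ψ.ofConv ∘ₗ mulRight ℂ w)

@[simp] theorem dualMulLeft_apply (w : W) (ψ : DualAlg W) (x : W) :
    dualMulLeft w ψ x = ψ (w * x) := rfl

@[simp] theorem dualMulRight_apply (w : W) (ψ : DualAlg W) (x : W) :
    dualMulRight w ψ x = ψ (x * w) := rfl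

variable [WeakHopfAlgebra W]
local notation "𝒮" => WeakHopfAlgebra.antipode

theorem antipodeInv_eq (hS : ∀ x : W, (𝒮 (𝒮 x) : W) = x) :
    antipodeInv W = (𝒮 : Module.End ℂ W) := by
  have h : (𝒮 : Module.End ℂ W) * 𝒮 = 1 := LinearMap.ext hS
  exact Ring.inverse_unit ⟨𝒮, 𝒮, h, h⟩

omit [WeakHopfAlgebra W] in
theorem Lplus_apply (g x : W) : Lplus g x = g * x := rfl

theorem Lminus_apply (hS : ∀ x : W, (𝒮 (𝒮 x) : W) = x) (g x : W) : Lminus g x = x * 𝒮 g := by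
  simp [Lminus, antipodeInv_eq hS]

theorem Tplus_eq (ψ : DualAlg W) (x : W) : Tplus ψ x = evalRight ψ.ofConv (comul x) := rfl

theorem Tminus_eq (ψ : DualAlg W) (x : W) :
    Tminus ψ x = evalLeft (ψ.ofConv ∘ₗ 𝒮) (comul x) := rfl

theorem Tplus_apply {ι : Type*} {x : W} (r : Repr ℂ x ι) (ψ : DualAlg W) :
    Tplus ψ x = ∑ i ∈ r.index, ψ (r.right i) • r.left i := by
  simp [Tplus_eq, ← r.eq]

theorem Tminus_apply {ι : Type*} {x : W} (r : Repr ℂ x ι) (ψ : DualAlg W) :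
    Tminus ψ x = ∑ i ∈ r.index, ψ (𝒮 (r.left i)) • r.right i := by
  simp [Tminus_eq, ← r.eq]

omit [WeakHopfAlgebra W] in
theorem Lplus_mul (x y : W) : Lplus (x * y) = Lplus x * Lplus y := by
  ext z; simp [Lplus_apply, mul_assoc]

theorem Lminus_mul (hS : ∀ x : W, (𝒮 (𝒮 x) : W) = x) (x y : W) :
    Lminus (x * y) = Lminus x * Lminus y := by
  ext z; simp [Lminus_apply hS, antipode_mul, mul_assoc]

theorem Lplus_commute_Lminus (hS : ∀ x : W, (𝒮 (𝒮 x) : W) = x) (x y : W) :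
    Commute (Lplus x) (Lminus y) := by
  ext z; simp [Lplus_apply, Lminus_apply hS, mul_assoc]

theorem comul_Tplus (ψ : DualAlg W) (x : W) :
    comul (R := ℂ) (Tplus ψ x) = lTensor W (Tplus ψ) (comul x) := by
  have h : ∀ t : W ⊗[ℂ] W, lTensor W (evalRight ψ.ofConv)
      (TensorProduct.assoc ℂ W W W (rTensor W comul t)) = comul (R := ℂ) (evalRight ψ.ofConv t) := by
    intro t
    induction t with
    | zero => simp
    | add a b ha hb => simp only [map_add, ha, hb]
    | tmul a b =>
      rw [rTensor_tmul, ← (ℛ ℂ a).eq]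
      simp [TensorProduct.sum_tmul, ← (ℛ ℂ a).eq, Finset.smul_sum]
  rw [Tplus_eq, ← h, coassoc_apply, ← (ℛ ℂ x).eq]
  simp [Tplus_eq]

theorem comul_Tminus (ψ : DualAlg W) (x : W) :
    comul (R := ℂ) (Tminus ψ x) = rTensor W (Tminus ψ) (comul x) := by
  have h : ∀ t : W ⊗[ℂ] W, rTensor W (evalLeft (ψ.ofConv ∘ₗ 𝒮))
      ((TensorProduct.assoc ℂ W W W).symm (lTensor W comul t)) =
        comul (R := ℂ) (evalLeft (ψ.ofConv ∘ₗ 𝒮) t) := by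
    intro t
    induction t with
    | zero => simp
    | add a b ha hb => simp only [map_add, ha, hb]
    | tmul a b =>
      rw [lTensor_tmul, ← (ℛ ℂ b).eq]
      simp [TensorProduct.tmul_sum, ← (ℛ ℂ b).eq, Finset.smul_sum, TensorProduct.smul_tmul']
  rw [Tminus_eq, ← h, coassoc_symm_apply, ← (ℛ ℂ x).eq]
  simp [Tminus_eq]

omit [WeakHopfAlgebra W] in
theorem evalRight_lTensor (ψ : W →ₗ[ℂ] ℂ) (f : W →ₗ[ℂ] W) (t : W ⊗[ℂ] W) :
    evalRight ψ (lTensor W f t) = evalRight (ψ ∘ₗ f) t := by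
  induction t with
  | zero => simp
  | add a b ha hb => simp only [map_add, ha, hb]
  | tmul a b => simp

omit [WeakHopfAlgebra W] in
theorem evalLeft_lTensor (ψ : W →ₗ[ℂ] ℂ) (f : W →ₗ[ℂ] W) (t : W ⊗[ℂ] W) :
    evalLeft ψ (lTensor W f t) = f (evalLeft ψ t) := by
  induction t with
  | zero => simp
  | add a b ha hb => simp only [map_add, ha, hb]
  | tmul a b => simp

omit [WeakHopfAlgebra W] in
theorem evalLeft_rTensor (ψ : W →ₗ[ℂ] ℂ) (f : W →ₗ[ℂ] W) (t : W ⊗[ℂ] W) :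
    evalLeft ψ (rTensor W f t) = evalLeft (ψ ∘ₗ f) t := by
  induction t with
  | zero => simp
  | add a b ha hb => simp only [map_add, ha, hb]
  | tmul a b => simp

theorem Tplus_mul (ψ χ : DualAlg W) : Tplus (ψ * χ) = Tplus ψ * Tplus χ := by
  ext x
  rw [Module.End.mul_apply, Tplus_eq ψ, comul_Tplus, evalRight_lTensor, Tplus_eq]
  congr 2
  ext y
  change (ψ * χ) y = ψ (Tplus χ y)
  simp [Tplus_apply (ℛ ℂ y), dual_mul_apply (ℛ ℂ y), mul_comm]

theorem Tminus_mul (ψ χ : DualAlg W) : Tminus (ψ * χ) = Tminus ψ * Tminus χ := by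
  ext x
  rw [Module.End.mul_apply, Tminus_eq ψ, comul_Tminus, evalLeft_rTensor, Tminus_eq]
  congr 2
  ext y
  change (ψ * χ) (𝒮 y) = ψ (𝒮 (Tminus χ y))
  simp [Tminus_apply (ℛ ℂ y), dual_mul_apply (antipodeRepr (ℛ ℂ y)), antipodeRepr, mul_comm]

/-- The two operators pair opposite legs of the coproduct, so this is coassociativity. -/
theorem Tplus_commute_Tminus (ψ χ : DualAlg W) : Commute (Tplus ψ) (Tminus χ) := by
  ext x
  rw [Module.End.mul_apply, Module.End.mul_apply, Tminus_eq, Tminus_eq, comul_Tplus,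
    evalLeft_lTensor]

/-- By multiplicativity of `Δ`, moving `L₊` to the left of `T₊` leaves the second leg of `g` inside
`ψ`. -/
theorem Tplus_Lplus {ι : Type*} {g : W} (r : Repr ℂ g ι) (ψ : DualAlg W) :
    Tplus ψ * Lplus g = ∑ i ∈ r.index, Lplus (r.left i) * Tplus (dualMulLeft (r.right i) ψ) := by
  ext x
  rw [Module.End.mul_apply, Lplus_apply, Tplus_eq, WeakBialgebra.comul_mul, ← r.eq, ← (ℛ ℂ x).eq]
  rw [Finset.sum_mul_sum]
  simp [Lplus_apply, Tplus_apply (ℛ ℂ x)]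

theorem Tminus_Lminus (hS : ∀ x : W, (𝒮 (𝒮 x) : W) = x) {ι : Type*} {g : W} (r : Repr ℂ g ι)
    (ψ : DualAlg W) :
    Tminus ψ * Lminus g = ∑ i ∈ r.index, Lminus (r.left i) * Tminus (dualMulLeft (r.right i) ψ) := by
  ext x
  rw [Module.End.mul_apply, Lminus_apply hS, Tminus_eq, WeakBialgebra.comul_mul,
    ← (antipodeRepr r).eq, ← (ℛ ℂ x).eq, Finset.sum_mul_sum, Finset.sum_comm]
  simp [Lminus_apply hS, Tminus_apply (ℛ ℂ x), Finset.sum_mul, antipodeRepr, antipode_mul, hS]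

omit [WeakHopfAlgebra W] in
theorem evalLeft_one_tmul_mul (φ : W →ₗ[ℂ] ℂ) (t : W ⊗[ℂ] W) (w : W) :
    evalLeft φ ((1 ⊗ₜ w) * t) = w * evalLeft φ t := by
  induction t with
  | zero => simp
  | add a b ha hb => simp only [map_add, ha, hb, mul_add]
  | tmul a b => simp

theorem Tminus_dualMulRight (hS : ∀ x : W, (𝒮 (𝒮 x) : W) = x) (w : W) (ψ : DualAlg W) (x : W) :
    Tminus (dualMulRight w ψ) x = evalLeft (ψ.ofConv ∘ₗ 𝒮) (((𝒮 w : W) ⊗ₜ[ℂ] 1) * comul x) := by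
  rw [Tminus_eq, ← (ℛ ℂ x).eq]
  simp [Finset.mul_sum, antipode_mul, hS]

theorem Tplus_dualMulRight (w : W) (ψ : DualAlg W) (x : W) :
    Tplus (dualMulRight w ψ) x = evalRight ψ.ofConv (comul x * (1 ⊗ₜ[ℂ] w)) := by
  rw [Tplus_eq, ← (ℛ ℂ x).eq]
  simp [Finset.sum_mul]

/-- For the face on the other side of the edge, an inserted first leg of `g` is cancelled as `L₊`
moves past: `∑ (S(g⁽¹⁾) ⊗ 1)Δ(g⁽²⁾) = (1 ⊗ g)Δ(1)`. -/
theorem Tminus_Lplus (hS : ∀ x : W, (𝒮 (𝒮 x) : W) = x) {ι : Type*} {g : W} (r : Repr ℂ g ι)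
    (ψ : DualAlg W) :
    ∑ i ∈ r.index, Tminus (dualMulRight (r.left i) ψ) * Lplus (r.right i) =
      Lplus g * Tminus ψ := by
  ext x
  have h := congrArg (fun f : WithConv (W →ₗ[ℂ] W ⊗[ℂ] W) => f g)
    (antipode_tmul_conv_comul (W := W))
  beta_reduce at h
  rw [r.convMul_apply] at h
  change ∑ i ∈ r.index, ((𝒮 (r.left i) : W) ⊗ₜ[ℂ] (1 : W)) * comul (r.right i) =
    (1 ⊗ₜ[ℂ] g) * comul 1 at h
  simp only [LinearMap.sum_apply, Module.End.mul_apply, Lplus_apply, Tminus_dualMulRight hS,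
    WeakBialgebra.comul_mul]
  rw [← map_sum]
  simp only [← mul_assoc]
  rw [← Finset.sum_mul, h, mul_assoc, comul_one_mul, evalLeft_one_tmul_mul, Tminus_eq]

theorem Tplus_Lminus (hS : ∀ x : W, (𝒮 (𝒮 x) : W) = x) {ι : Type*} {g : W} (r : Repr ℂ g ι)
    (ψ : DualAlg W) :
    ∑ i ∈ r.index, Tplus (dualMulRight (r.left i) ψ) * Lminus (r.right i) =
      Lminus g * Tplus ψ := by
  ext x
  have h := congrArg (fun f : WithConv (W →ₗ[ℂ] W ⊗[ℂ] W) => f (𝒮 g))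
    (comul_conv_tmul_antipode (W := W))
  beta_reduce at h
  rw [(antipodeRepr r).convMul_apply] at h
  change ∑ i ∈ r.index, comul (𝒮 (r.right i)) * ((1 : W) ⊗ₜ[ℂ] (𝒮 (𝒮 (r.left i)) : W)) =
    comul 1 * ((𝒮 g : W) ⊗ₜ[ℂ] (1 : W)) at h
  simp only [LinearMap.sum_apply, Module.End.mul_apply, Lminus_apply hS, Tplus_dualMulRight,
    WeakBialgebra.comul_mul]
  rw [← map_sum]
  simp only [mul_assoc, hS] at h ⊢
  rw [← Finset.mul_sum, h, ← mul_assoc, comul_mul_one, evalRight_mul_tmul, Tplus_eq]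

end LocalOperators

/-! ### Operators at darts on the total space -/

section OnEdge
variable {W : Type u} [Ring W] [Algebra ℂ W] {E : Type v} [DecidableEq E]

theorem onEdge_mul (e : E) (T T' : Module.End ℂ W) :
    onEdge e (T * T') = onEdge e T * onEdge e T' := by
  refine PiTensorProduct.ext (MultilinearMap.ext fun x => ?_)
  simp [onEdge_tprod]

theorem onEdge_commute_of_ne {e e' : E} (h : e ≠ e') (T T' : Module.End ℂ W) :
    Commute (onEdge e T) (onEdge e' T') := by
  refine PiTensorProduct.ext (MultilinearMap.ext fun x => ?_)
  simp [onEdge_tprod, h, h.symm, Function.update_comm h]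

theorem onEdge_commute (e : E) {T T' : Module.End ℂ W} (h : Commute T T') :
    Commute (onEdge e T) (onEdge e T') := by
  rw [Commute, SemiconjBy, ← onEdge_mul, ← onEdge_mul, h.eq]

end OnEdge

section Darts
variable {W : Type u} [Ring W] [Algebra ℂ W] [WeakHopfAlgebra W] {E : Type v} [DecidableEq E]
local notation "𝒮" => WeakHopfAlgebra.antipode

/-- The two ends of one edge act by left and by right multiplication, so loops cause no trouble. -/
theorem dartL_commute (hS : ∀ x : W, (𝒮 (𝒮 x) : W) = x) {d d' : E × Bool} (hd : d ≠ d')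
    (g g' : W) : Commute (dartL d g) (dartL d' g') := by
  obtain ⟨e, b⟩ := d
  obtain ⟨e', b'⟩ := d'
  by_cases he : e = e'
  · subst he
    refine onEdge_commute e ?_
    cases b <;> cases b' <;> simp at hd ⊢
    · exact Lplus_commute_Lminus hS g g'
    · exact (Lplus_commute_Lminus hS g' g).symm
  · exact onEdge_commute_of_ne he _ _

theorem dartT_commute {d d' : E × Bool} (hd : d ≠ d') (ψ χ : DualAlg W) :
    Commute (dartT d ψ) (dartT d' χ) := by
  obtain ⟨e, b⟩ := d
  obtain ⟨e', b'⟩ := d'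
  by_cases he : e = e'
  · subst he
    refine onEdge_commute e ?_
    cases b <;> cases b' <;> simp at hd ⊢
    · exact Tplus_commute_Tminus ψ χ
    · exact (Tplus_commute_Tminus χ ψ).symm
  · exact onEdge_commute_of_ne he _ _

theorem dartT_commute_dartL {d d' : E × Bool} (hd : d ≠ d') (hd' : d ≠ DirectedLattice.flip d')
    (ψ : DualAlg W) (g : W) : Commute (dartT d ψ) (dartL d' g) := by
  obtain ⟨e, b⟩ := d
  obtain ⟨e', b'⟩ := d'
  refine onEdge_commute_of_ne ?_ _ _
  rintro rfl
  cases b <;> cases b' <;> simp_all [DirectedLattice.flip]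

theorem dartL_mul (hS : ∀ x : W, (𝒮 (𝒮 x) : W) = x) (d : E × Bool) (g g' : W) :
    dartL d (g * g') = dartL d g * dartL d g' := by
  obtain ⟨e, b⟩ := d
  cases b
  · simp [dartL, Lplus_mul, onEdge_mul]
  · simp [dartL, Lminus_mul hS, onEdge_mul]

theorem dartT_mul (d : E × Bool) (ψ χ : DualAlg W) :
    dartT d (ψ * χ) = dartT d ψ * dartT d χ := by
  obtain ⟨e, b⟩ := d
  cases b
  · simp [dartT, Tplus_mul, onEdge_mul]
  · simp [dartT, Tminus_mul, onEdge_mul]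

/-- A walk along the left-hand face leaves the vertex through `d`; the second leg of `g` appears
just before the letter `d`. -/
theorem dartT_mul_dartL (hS : ∀ x : W, (𝒮 (𝒮 x) : W) = x) (d : E × Bool) {ι : Type*} {g : W}
    (r : Repr ℂ g ι) (ψ : DualAlg W) :
    dartT d ψ * dartL d g =
      ∑ i ∈ r.index, dartL d (r.left i) * dartT d (dualMulLeft (r.right i) ψ) := by
  obtain ⟨e, b⟩ := d
  cases b
  · simp [dartT, dartL, ← onEdge_mul, Tplus_Lplus r]
  · simp [dartT, dartL, ← onEdge_mul, Tminus_Lminus hS r]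

/-- A walk along the other face arrives at the vertex through the reverse of `d`; an insertion just
after that letter is absorbed by the action. -/
theorem sum_dartT_flip_mul_dartL (hS : ∀ x : W, (𝒮 (𝒮 x) : W) = x) (d : E × Bool) {ι : Type*}
    {g : W} (r : Repr ℂ g ι) (ψ : DualAlg W) :
    ∑ i ∈ r.index, dartT (DirectedLattice.flip d) (dualMulRight (r.left i) ψ) *
      dartL d (r.right i) = dartL d g * dartT (DirectedLattice.flip d) ψ := by
  obtain ⟨e, b⟩ := d
  cases b
  · simp [dartT, dartL, ← onEdge_mul, ← Tminus_Lplus hS r, DirectedLattice.flip]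
  · simp [dartT, dartL, ← onEdge_mul, ← Tplus_Lminus hS r, DirectedLattice.flip]

end Darts

/-! ### Adjoints for the Haar inner product -/

section Adjoint
variable {W : Type u} [Ring W] [Algebra ℂ W] [StarRing W] [StarModule ℂ W] {E : Type v} [Fintype E]

/-- `T'` is the adjoint of `T` for the Haar inner product. -/
def IsAdjoint (φ : DualAlg W) (T T' : Module.End ℂ (TotalSpace W E)) : Prop :=
  ∀ x y, haarInner φ (T x) y = haarInner φ x (T' y)

theorem haarInner_add_left (φ : DualAlg W) (x x' y : TotalSpace W E) :
    haarInner φ (x + x') y = haarInner φ x y + haarInner φ x' y := by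
  simp [haarInner, add_mul]

theorem haarInner_add_right (φ : DualAlg W) (x y y' : TotalSpace W E) :
    haarInner φ x (y + y') = haarInner φ x y + haarInner φ x y' := by
  simp [haarInner, mul_add]

theorem haarInner_smul_left (φ : DualAlg W) (c : ℂ) (x y : TotalSpace W E) :
    haarInner φ (c • x) y = conj c * haarInner φ x y := by
  simp [haarInner]

theorem haarInner_smul_right (φ : DualAlg W) (c : ℂ) (x y : TotalSpace W E) :
    haarInner φ x (c • y) = c * haarInner φ x y := by
  simp [haarInner]

theorem IsAdjoint.zero (φ : DualAlg W) : IsAdjoint φ (0 : Module.End ℂ (TotalSpace W E)) 0 := by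
  intro x y
  simp [haarInner]

theorem IsAdjoint.add {φ : DualAlg W} {T T' R R' : Module.End ℂ (TotalSpace W E)}
    (hT : IsAdjoint φ T T') (hR : IsAdjoint φ R R') : IsAdjoint φ (T + R) (T' + R') := by
  intro x y
  simp [haarInner_add_left, haarInner_add_right, hT x y, hR x y]

theorem IsAdjoint.mul {φ : DualAlg W} {T T' R R' : Module.End ℂ (TotalSpace W E)}
    (hT : IsAdjoint φ T T') (hR : IsAdjoint φ R R') : IsAdjoint φ (T * R) (R' * T') := by
  intro x y
  simp [hT _ y, hR x _]

theorem isAdjoint_onEdge [DecidableEq E] {φ : DualAlg W} {T T' : Module.End ℂ W}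
    (h : ∀ a b : W, φ (star (T a) * b) = φ (star a * T' b)) (e : E) :
    IsAdjoint φ (onEdge e T) (onEdge e T') := by
  intro x y
  induction x using PiTensorProduct.induction_on with
  | add a b ha hb => rw [map_add, haarInner_add_left, haarInner_add_left, ha, hb]
  | smul_tprod r x =>
    rw [map_smul, haarInner_smul_left, haarInner_smul_left]
    congr 1
    induction y using PiTensorProduct.induction_on with
    | add a b ha hb => rw [map_add, haarInner_add_right, haarInner_add_right, ha, hb]
    | smul_tprod r y =>
      rw [map_smul, haarInner_smul_right, haarInner_smul_right, onEdge_tprod, onEdge_tprod,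
        haarInner_tprod, haarInner_tprod]
      congr 1
      refine Finset.prod_congr rfl fun i _ => ?_
      by_cases hi : i = e
      · subst hi
        simpa using h _ _
      · simp [hi]

end Adjoint

section DualStar
variable {W : Type u} [Ring W] [Algebra ℂ W] [StarRing W] [StarModule ℂ W] [CStarWeakHopfAlgebra W]
local notation "𝒮" => WeakHopfAlgebra.antipode

/-- The involution `ψ⋆(x) = conj ψ(S(x)⋆)` of the dual. -/
def dualStar (ψ : DualAlg W) : DualAlg W := toConv (starFunctional ψ.ofConv ∘ₗ 𝒮)

theorem dualStar_apply (ψ : DualAlg W) (x : W) : dualStar ψ x = star (ψ (star (𝒮 x))) := rfl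

omit [StarRing W] [StarModule ℂ W] [CStarWeakHopfAlgebra W] in
theorem dualTensorEquiv_comm [Module.Finite ℂ W] (t : DualAlg W ⊗[ℂ] DualAlg W) (x y : W) :
    dualTensorEquiv W (TensorProduct.comm ℂ _ _ t) (x ⊗ₜ y) = dualTensorEquiv W t (y ⊗ₜ x) := by
  induction t with
  | zero => simp
  | add a b ha hb => simp only [map_add, LinearMap.add_apply, ha, hb]
  | tmul a b => rw [TensorProduct.comm_tmul, dualTensorEquiv_tmul, dualTensorEquiv_tmul, mul_comm]

/-- The compatibility with the coproduct is phrased by sums because the involution is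
conjugate-linear and has no linear tensor square. -/
theorem dual_comul_dualStar [Module.Finite ℂ W] {ι : Type*} {ψ : DualAlg W} (r : Repr ℂ ψ ι) :
    ∑ i ∈ r.index, dualStar (r.left i) ⊗ₜ[ℂ] dualStar (r.right i) = comul (R := ℂ) (dualStar ψ) := by
  apply dual_ext
  intro x y
  have h := pair_comul ψ (star (𝒮 x)) (star (𝒮 y))
  rw [← r.eq] at h
  rw [pair_comul, dualStar_apply, antipode_mul, star_mul, ← h]
  simp [dualStar_apply]

variable {h : W} {φ : DualAlg W} [Module.Finite ℂ W]

omit [Module.Finite ℂ W] in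
theorem IsHaarIntegral.mul_self (hh : IsHaarIntegral h) : h * h = h := by
  rw [hh.left_integral, hh.left_normalized, one_mul]

theorem IsHaarIntegral.dual_mul_self (hφ : IsHaarIntegral φ) : φ * φ = φ := by
  rw [hφ.left_integral, hφ.left_normalized, one_mul]

-- Since `ε_L(h⋆) = 1`, the integral property gives `h = h⋆h`, which is self-adjoint.
omit [Module.Finite ℂ W] in
theorem IsHaarIntegral.star_eq (hh : IsHaarIntegral h) (hcoc : IsCocommutative h) :
    star h = h := by
  have hS := antipode_antipode hh hcoc
  have e : epsL (star h) = 1 := by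
    rw [← star_star (epsL (star h)), star_epsL_star, ← antipode_epsR hS, hh.right_normalized,
      antipode_one, star_one]
  have e1 : star h * h = h := by rw [hh.left_integral, e, one_mul]
  rw [← e1, star_mul, star_star]

theorem IsHaarIntegral.dual_isCocommutative (hh : IsHaarIntegral h) (hcoc : IsCocommutative h)
    (hφ : IsHaarIntegral φ) : IsCocommutative φ := by
  apply dual_ext
  intro x y
  rw [dualTensorEquiv_comm, pair_comul, pair_comul, haar_mul_comm hh hcoc hφ]

theorem IsHaarIntegral.dualStar_eq (hh : IsHaarIntegral h) (hcoc : IsCocommutative h)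
    (hφ : IsHaarIntegral φ) : dualStar φ = φ := by
  ext x
  change dualStar φ x = φ x
  rw [dualStar_apply, haar_star hh hcoc hφ, star_star, haar_antipode hh hcoc hφ]

variable {E : Type v} [Fintype E] [DecidableEq E]

/-- For `L₊` this is associativity. For `L₋`, a right multiplication, the trace property of `φ` is
needed. -/
theorem isAdjoint_dartL (hh : IsHaarIntegral h) (hcoc : IsCocommutative h)
    (hφ : IsHaarIntegral φ) (d : E × Bool) (g : W) :
    IsAdjoint φ (dartL d g) (dartL d (star g)) := by
  have hS := antipode_antipode hh hcoc
  obtain ⟨e, b⟩ := d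
  refine isAdjoint_onEdge (fun x y => ?_) e
  cases b
  · simp [Lplus_apply, mul_assoc]
  · simp only [if_true, Lminus_apply hS, star_mul, antipode_star hS]
    rw [mul_assoc, haar_mul_comm hh hcoc hφ, mul_assoc]

/-- Invariance of `φ` moves the coproduct from `x⋆` to `y` at the cost of an antipode, which is the
one in the involution of the dual. -/
theorem isAdjoint_dartT (hh : IsHaarIntegral h) (hcoc : IsCocommutative h)
    (hφ : IsHaarIntegral φ) (d : E × Bool) (ψ : DualAlg W) :
    IsAdjoint φ (dartT d ψ) (dartT d (dualStar ψ)) := by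
  have hS := antipode_antipode hh hcoc
  obtain ⟨e, b⟩ := d
  refine isAdjoint_onEdge (fun x y => ?_) e
  cases b
  · have e1 := congrArg (starFunctional ψ.ofConv)
      (haar_invariant_left hh hcoc hφ (starRepr (ℛ ℂ x)) (ℛ ℂ y))
    have e2 : ∀ w : W, starFunctional ψ.ofConv (star w) = star (ψ w) := fun w => by
      change star (ψ (star (star w))) = _
      rw [star_star]
    have e3 : ∀ w : W, starFunctional ψ.ofConv (𝒮 w) = dualStar ψ w := fun w => rfl
    simp only [map_sum, map_smul, starRepr, e2, e3, smul_eq_mul] at e1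
    simp only [Bool.false_eq_true, if_false, Tplus_apply (ℛ ℂ x), Tplus_apply (ℛ ℂ y), star_sum,
      star_smul, Finset.sum_mul, Finset.mul_sum, smul_mul_assoc, mul_smul_comm, map_sum, map_smul,
      smul_eq_mul]
    simpa only [mul_comm] using e1
  · have e1 := congrArg (dualStar ψ).ofConv
      (haar_invariant_right hh hcoc hφ (starRepr (ℛ ℂ x)) (ℛ ℂ y))
    have e2 : ∀ w : W, (dualStar ψ).ofConv (star w) = star (ψ (𝒮 w)) := fun w => by
      change star (ψ (star (𝒮 (star w)))) = _
      rw [antipode_star hS, star_star]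
    simp only [map_sum, map_smul, starRepr, e2, smul_eq_mul] at e1
    simp only [if_true, Tminus_apply (ℛ ℂ x), Tminus_apply (ℛ ℂ y), star_sum,
      star_smul, Finset.sum_mul, Finset.mul_sum, smul_mul_assoc, mul_smul_comm, map_sum, map_smul,
      smul_eq_mul]
    simpa only [mul_comm] using e1

end DualStar

/-! ### Vertex and face operators: products, sites, commutation within each kind -/

section SiteOperators
variable {W : Type u} [Ring W] [Algebra ℂ W] [WeakHopfAlgebra W] {E : Type v} [DecidableEq E]
  (C : DirectedLattice E)
local notation "𝒮" => WeakHopfAlgebra.antipode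

variable [Module.Finite ℂ W]

theorem siteB_eq (s : C.Site) (ψ : DualAlg W) :
    siteB C s ψ = convList dartT (DirectedLattice.cycleList C.faceRot (C.rot.symm s)) ψ := rfl

theorem faceOp_eq (f : C.Face) (ψ : DualAlg W) :
    faceOp C ψ f = convList dartT (DirectedLattice.cycleList C.faceRot f.out) ψ := by
  rw [faceOp, siteB_eq, Equiv.symm_apply_apply]

variable [Fintype E]

omit [Module.Finite ℂ W] in
theorem siteA_mul (hS : ∀ x : W, (𝒮 (𝒮 x) : W) = x) (s : C.Site) (x y : W) :
    siteA C s (x * y) = siteA C s x * siteA C s y :=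
  convList_map_mul WeakBialgebra.comul_mul (fun _ _ hd => dartL_commute hS hd) (dartL_mul hS)
    (DirectedLattice.cycleList_ne_nil _ _) (DirectedLattice.cycleList_nodup _ _) x y

theorem siteB_mul (s : C.Site) (ψ χ : DualAlg W) :
    siteB C s (ψ * χ) = siteB C s ψ * siteB C s χ :=
  convList_map_mul dual_comul_mul (fun _ _ hd => dartT_commute hd) dartT_mul
    (DirectedLattice.cycleList_ne_nil _ _) (DirectedLattice.cycleList_nodup _ _) ψ χ

omit [Module.Finite ℂ W] in
theorem siteA_eq_vertexOp (hS : ∀ x : W, (𝒮 (𝒮 x) : W) = x) {h : W} (hcoc : IsCocommutative h)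
    (s : C.Site) : siteA C s h = vertexOp C h (C.siteVertex s) :=
  DirectedLattice.convList_cycleList C.rot (fun _ _ hd => dartL_commute hS hd) hcoc
    ((Equiv.Perm.SameCycle.setoid C.rot).symm' (Quotient.mk_out (s := Equiv.Perm.SameCycle.setoid C.rot) s))

theorem siteB_eq_faceOp {φ : DualAlg W} (hcoc : IsCocommutative φ)
    (s : C.Site) : siteB C s φ = faceOp C φ (C.siteFace s) := by
  rw [faceOp_eq]
  exact DirectedLattice.convList_cycleList C.faceRot (fun _ _ hd => dartT_commute hd) hcoc
    ((Equiv.Perm.SameCycle.setoid C.faceRot).symm'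
      (Quotient.mk_out (s := Equiv.Perm.SameCycle.setoid C.faceRot) (C.rot.symm s)))

omit [Module.Finite ℂ W] in
theorem vertexOp_commute (hS : ∀ x : W, (𝒮 (𝒮 x) : W) = x) (g : W) (v v' : C.Vertex) :
    Commute (vertexOp C g v) (vertexOp C g v') := by
  by_cases hv : v = v'
  · rw [hv]
  refine convList_commute_convList (fun d hd d' hd' => dartL_commute hS ?_) g g
  rintro rfl
  refine hv (Quotient.out_equiv_out.1 ?_)
  exact ((DirectedLattice.mem_cycleList _).1 hd).trans ((DirectedLattice.mem_cycleList _).1 hd').symm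

theorem faceOp_commute (ψ : DualAlg W) (f f' : C.Face) :
    Commute (faceOp C ψ f) (faceOp C ψ f') := by
  by_cases hf : f = f'
  · rw [hf]
  rw [faceOp_eq, faceOp_eq]
  refine convList_commute_convList (fun d hd d' hd' => dartT_commute ?_) ψ ψ
  rintro rfl
  refine hf (Quotient.out_equiv_out.1 ?_)
  exact ((DirectedLattice.mem_cycleList _).1 hd).trans ((DirectedLattice.mem_cycleList _).1 hd').symm

end SiteOperators

/-! ### Hermiticity of the site operators -/

section Hermitian
variable {W : Type u} [Ring W] [Algebra ℂ W] [StarRing W] [StarModule ℂ W] [CStarWeakHopfAlgebra W]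
  [Module.Finite ℂ W] {E : Type v} [Fintype E] [DecidableEq E] (C : DirectedLattice E)
  {h : W} {φ : DualAlg W}

theorem isHermitian_siteA (hh : IsHaarIntegral h) (hcoc : IsCocommutative h)
    (hφ : IsHaarIntegral φ) (s : C.Site) : IsHermitian φ (siteA C s h) := by
  have hS := antipode_antipode hh hcoc
  have hcop : ∀ c : W, ∃ (s : Finset (W × W)) (a b : W × W → W),
      ∑ i ∈ s, a i ⊗ₜ[ℂ] b i = comul c ∧
        ∑ i ∈ s, star (a i) ⊗ₜ[ℂ] star (b i) = comul (R := ℂ) (star c) := fun c =>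
    ⟨(ℛ ℂ c).index, (ℛ ℂ c).left, (ℛ ℂ c).right, (ℛ ℂ c).eq, by
      rw [← (starRepr (ℛ ℂ c)).eq]; rfl⟩
  have hA : ∀ (d : E × Bool) (c : W), IsAdjoint φ (dartL d c) (dartL d (star c)) :=
    isAdjoint_dartL hh hcoc hφ
  have key : IsAdjoint φ (convList dartL (DirectedLattice.cycleList C.rot s) h)
      (convList dartL (DirectedLattice.cycleList C.rot s) (star h)) :=
    convList_adjoint (fun _ _ hd => dartL_commute hS hd) (IsAdjoint.zero φ)
      (fun _ _ _ _ h1 h2 => h1.add h2) (fun _ _ _ _ h1 h2 => h1.mul h2) hcop hA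
      (DirectedLattice.cycleList_ne_nil C.rot s) (DirectedLattice.cycleList_nodup C.rot s) h
  rwa [hh.star_eq hcoc] at key

theorem isHermitian_siteB (hh : IsHaarIntegral h) (hcoc : IsCocommutative h)
    (hφ : IsHaarIntegral φ) (s : C.Site) : IsHermitian φ (siteB C s φ) := by
  have hcop : ∀ c : DualAlg W, ∃ (s : Finset (DualAlg W × DualAlg W))
      (a b : DualAlg W × DualAlg W → DualAlg W),
      ∑ i ∈ s, a i ⊗ₜ[ℂ] b i = comul c ∧
        ∑ i ∈ s, dualStar (a i) ⊗ₜ[ℂ] dualStar (b i) = comul (R := ℂ) (dualStar c) := fun c =>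
    ⟨(ℛ ℂ c).index, (ℛ ℂ c).left, (ℛ ℂ c).right, (ℛ ℂ c).eq, dual_comul_dualStar (ℛ ℂ c)⟩
  have hB : ∀ (d : E × Bool) (c : DualAlg W), IsAdjoint φ (dartT d c) (dartT d (dualStar c)) :=
    isAdjoint_dartT hh hcoc hφ
  have key : IsAdjoint φ
      (convList dartT (DirectedLattice.cycleList C.faceRot (C.rot.symm s)) φ)
      (convList dartT (DirectedLattice.cycleList C.faceRot (C.rot.symm s)) (dualStar φ)) :=
    convList_adjoint (fun _ _ hd => dartT_commute hd) (IsAdjoint.zero φ)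
      (fun _ _ _ _ h1 h2 => h1.add h2) (fun _ _ _ _ h1 h2 => h1.mul h2) hcop hB
      (DirectedLattice.cycleList_ne_nil C.faceRot (C.rot.symm s))
      (DirectedLattice.cycleList_nodup C.faceRot (C.rot.symm s)) φ
  rwa [hh.dualStar_eq hcoc hφ] at key

end Hermitian

/-! ### Constants in convolution algebras and cyclic products -/

section ConstConv
variable {W B ι : Type*} [AddCommGroup W] [Module ℂ W] [Coalgebra ℂ W] [Ring B] [Algebra ℂ B]

/-- The element `g ↦ ε(g)a` of the convolution algebra. -/
def constConv (W : Type*) {B : Type*} [AddCommGroup W] [Module ℂ W] [Coalgebra ℂ W] [Ring B]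
    [Algebra ℂ B] (a : B) : WithConv (W →ₗ[ℂ] B) :=
  toConv ((counit (R := ℂ) (A := W)).smulRight a)

theorem constConv_apply (a : B) (g : W) : constConv W a g = counit (R := ℂ) g • a := rfl

theorem constConv_mul_apply (a : B) (f : WithConv (W →ₗ[ℂ] B)) (g : W) :
    (constConv W a * f) g = a * f g := by
  rw [(ℛ ℂ g).convMul_apply]
  conv_rhs => rw [← sum_counit_smul (ℛ ℂ g)]
  simp [constConv_apply, Finset.mul_sum]

theorem mul_constConv_apply (f : WithConv (W →ₗ[ℂ] B)) (a : B) (g : W) :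
    (f * constConv W a) g = f g * a := by
  conv_rhs => rw [← mul_one f]
  rw [(ℛ ℂ g).convMul_apply, (ℛ ℂ g).convMul_apply]
  simp [constConv_apply, Finset.sum_mul, Algebra.algebraMap_eq_smul_one]

theorem constConv_one : constConv W (1 : B) = 1 := by
  ext g
  simp [constConv, Algebra.algebraMap_eq_smul_one]

theorem constConv_mul (a b : B) : constConv W (a * b) = constConv W a * constConv W b := by
  ext g
  change constConv W (a * b) g = (constConv W a * constConv W b) g
  rw [constConv_mul_apply, constConv_apply, constConv_apply, mul_smul_comm]

theorem constConv_commute {a : B} {f : WithConv (W →ₗ[ℂ] B)} (h : ∀ g, Commute a (f g)) :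
    Commute (constConv W a) f := by
  ext g
  change (constConv W a * f) g = (f * constConv W a) g
  rw [constConv_mul_apply, mul_constConv_apply, (h g).eq]

theorem list_prod_constConv (l : List ι) (a : ι → B) :
    (l.map fun c => constConv W (a c)).prod = constConv W (l.map a).prod := by
  induction l with
  | nil => simp [constConv_one]
  | cons c l ih => simp [ih, constConv_mul]

/-- A product of constants with one non-constant factor. -/
theorem list_prod_constConv_ite_apply [DecidableEq ι] {l : List ι} (hl : l.Nodup) {q : ι}
    (hq : q ∈ l) (a : ι → B) (f : WithConv (W →ₗ[ℂ] B)) (g : W) :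
    (l.map fun c => if c = q then f else constConv W (a c)).prod g =
      (l.map fun c => if c = q then f g else a c).prod := by
  induction l with
  | nil => simp at hq
  | cons c l ih =>
    rw [List.nodup_cons] at hl
    rw [List.map_cons, List.prod_cons, List.map_cons, List.prod_cons]
    by_cases hc : c = q
    · subst hc
      have e1 : (l.map fun c' => if c' = c then f else constConv W (a c')) =
          l.map fun c' => constConv W (a c') :=
        List.map_congr_left fun c' hc' => if_neg (by rintro rfl; exact hl.1 hc')
      have e2 : (l.map fun c' => if c' = c then f g else a c') = l.map a :=
        List.map_congr_left fun c' hc' => if_neg (by rintro rfl; exact hl.1 hc')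
      rw [e1, e2, list_prod_constConv, if_pos rfl, if_pos rfl, mul_constConv_apply]
    · rw [if_neg hc, if_neg hc, constConv_mul_apply,
        ih hl.2 ((List.mem_cons.1 hq).resolve_left fun h => hc h.symm)]

end ConstConv

section ListProd
variable {ι R : Type*} [Monoid R]

theorem list_prod_mul_of_semiconj {u v : ι → R} {z : R} {l : List ι}
    (h : ∀ c ∈ l, u c * z = z * v c) : (l.map u).prod * z = z * (l.map v).prod := by
  induction l with
  | nil => simp
  | cons c l ih =>
    simp only [List.map_cons, List.prod_cons]
    rw [mul_assoc, ih fun c hc => h c (by simp [hc]), ← mul_assoc, h c (by simp), mul_assoc]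

theorem list_prod_mul_eq_of_forall_eq_one {y w : ι → R} {c : ι} {l : List ι}
    (h : ∀ d ∈ l, w d = 1) : ((c :: l).map fun d => w d * y d).prod =
      w c * ((c :: l).map y).prod := by
  have e : (l.map fun d => w d * y d) = l.map y := List.map_congr_left fun d hd => by simp [h d hd]
  rw [List.map_cons, List.prod_cons, e, List.map_cons, List.prod_cons, mul_assoc]

theorem list_prod_mul_eq_of_forall_eq_one' {y w : ι → R} {c : ι} {l : List ι}
    (h : ∀ d ∈ l, w d = 1) : ((l ++ [c]).map fun d => y d * w d).prod =
      ((l ++ [c]).map y).prod * w c := by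
  have e : (l.map fun d => y d * w d) = l.map y := List.map_congr_left fun d hd => by simp [h d hd]
  simp [e, mul_assoc]

end ListProd

namespace DirectedLattice
variable {E : Type v} {R : Type*} [Monoid R] (p : Equiv.Perm (E × Bool)) (x : E × Bool)

/-- Moving the factors `w` between consecutive letters of a cyclic word. -/
theorem mul_cycleList_prod (y w : E × Bool → R) :
    w x * ((cycleList p x).map fun c => y c * w (p c)).prod =
      ((cycleList p x).map fun c => w c * y c).prod * w x := by
  have h : ∀ n : ℕ, w x * (((List.range n).map fun k => (p ^ k) x).map fun c => y c * w (p c)).prod =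
      (((List.range n).map fun k => (p ^ k) x).map fun c => w c * y c).prod * w ((p ^ n) x) := by
    intro n
    induction n with
    | zero => simp
    | succ n ih =>
      simp only [List.range_succ, List.map_append, List.prod_append, List.map_cons, List.map_nil,
        List.prod_singleton]
      rw [← mul_assoc, ih, pow_succ', Equiv.Perm.mul_apply]
      simp only [mul_assoc]
  have := h (Function.minimalPeriod p x)
  rwa [pow_minimalPeriod] at this

end DirectedLattice

/-! ### Convolutions evaluated at counital elements -/

section ConvCounital
variable {W : Type u} [Ring W] [Algebra ℂ W] [WeakBialgebra W] {B : Type*} [Ring B] [Algebra ℂ B]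

theorem convMul_apply_epsR {f g : WithConv (W →ₗ[ℂ] B)} (hg : ∀ x y, g (x * y) = g x * g y)
    (a : W) : (f * g) (epsR a) = (f * g) 1 * g (epsR a) := by
  rw [(ℛ ℂ (1 : W)).convMul_apply, convMul_apply, comul_epsR', ← (ℛ ℂ (1 : W)).eq]
  simp [Finset.sum_mul, hg, mul_assoc]

theorem convMul_apply_epsL {f g : WithConv (W →ₗ[ℂ] B)} (hf : ∀ x y, f (x * y) = f x * f y)
    (a : W) : (f * g) (epsL a) = f (epsL a) * (f * g) 1 := by
  rw [(ℛ ℂ (1 : W)).convMul_apply, convMul_apply, comul_epsL, ← (ℛ ℂ (1 : W)).eq]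
  simp [Finset.mul_sum, hf, mul_assoc]

/-- `Δ(1)` lies in `ε_R(W) ⊗ W`. -/
theorem convMul_one_eq_epsR (f g : WithConv (W →ₗ[ℂ] B)) :
    (f * g) 1 = ∑ i ∈ (ℛ ℂ (1 : W)).index, f (epsR ((ℛ ℂ (1 : W)).left i)) *
      g ((ℛ ℂ (1 : W)).right i) := by
  have h := map_epsR_id_comul (1 : W)
  rw [← Algebra.TensorProduct.one_def, one_mul] at h
  rw [convMul_apply, ← h, ← (ℛ ℂ (1 : W)).eq]
  simp [epsRMap_apply]

/-- `Δ(1)` lies in `W ⊗ ε_L(W)`. -/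
theorem convMul_one_eq_epsL (f g : WithConv (W →ₗ[ℂ] B)) :
    (f * g) 1 = ∑ i ∈ (ℛ ℂ (1 : W)).index, f ((ℛ ℂ (1 : W)).left i) *
      g (epsL ((ℛ ℂ (1 : W)).right i)) := by
  have h := map_id_epsL_comul (1 : W)
  rw [← Algebra.TensorProduct.one_def, mul_one] at h
  rw [convMul_apply, ← h, ← (ℛ ℂ (1 : W)).eq]
  simp [epsLMap_apply]

/-- The first leg of `Δ(1)` lies in `ε_R(W)`, and on `ε_R(a)` the product of `f` and `g` is its
value at `1` times `g(ε_R(a))`. -/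
theorem convMul_convMul_one {f g k : WithConv (W →ₗ[ℂ] B)} {b : B}
    (hg : ∀ x y, g (x * y) = g x * g y) (hb : (f * g) 1 = b) :
    (f * g * k) 1 = b * (g * k) 1 := by
  rw [convMul_one_eq_epsR, convMul_one_eq_epsR, Finset.mul_sum]
  exact Finset.sum_congr rfl fun i _ => by rw [convMul_apply_epsR hg, hb, mul_assoc]

theorem convMul_convMul_one' {f g k : WithConv (W →ₗ[ℂ] B)} {b : B}
    (hg : ∀ x y, g (x * y) = g x * g y) (hb : (g * k) 1 = b) :
    (f * (g * k)) 1 = (f * g) 1 * b := by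
  rw [convMul_one_eq_epsL, convMul_one_eq_epsL, Finset.sum_mul]
  exact Finset.sum_congr rfl fun i _ => by rw [convMul_apply_epsL hg, hb, mul_assoc]

end ConvCounital

/-! ### Calculus of face words with insertions -/

/-- Words of face letters with insertions of `W`, together with an action of `W` at the darts.
The letters are the factors of a face operator, `mark` inserts an element of `W` between two
letters, and `eval` is a trace-like evaluation of words. -/
structure FaceCalculus (W : Type u) (M B : Type*) (E : Type v) [Ring W] [Algebra ℂ W]
    [WeakBialgebra W] [Ring M] [Algebra ℂ M] [Ring B] [Algebra ℂ B] where
  /-- The factor of the face operator at a dart. -/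
  letter : E × Bool → B
  /-- The insertion of an element of `W`. -/
  mark : W →ₗ[ℂ] B
  /-- Operators as words. -/
  emb : M →ₐ[ℂ] B
  /-- The operator of a word. -/
  eval : B →ₗ[ℂ] M
  /-- The action of `W` at a dart. -/
  act : E × Bool → W →ₗ[ℂ] M
  act_mul : ∀ d x y, act d (x * y) = act d x * act d y
  act_one : ∀ d, act d 1 = 1
  mark_mul : ∀ x y, mark (x * y) = mark x * mark y
  commute_mark_emb : ∀ w m, Commute (mark w) (emb m)
  eval_emb_mul : ∀ m a, eval (emb m * a) = m * eval a
  eval_mul_emb : ∀ a m, eval (a * emb m) = eval a * m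
  eval_mark_mul : ∀ w a, eval (mark w * a) = eval (a * mark w)
  letter_mul_act : ∀ d, constConv W (letter d) * toConv (emb.toLinearMap ∘ₗ act d) =
    toConv (emb.toLinearMap ∘ₗ act d) * (toConv mark * constConv W (letter d))
  letter_flip_mul_act : ∀ d, constConv W (letter (DirectedLattice.flip d)) *
      (toConv mark * toConv (emb.toLinearMap ∘ₗ act d)) =
    toConv (emb.toLinearMap ∘ₗ act d) * constConv W (letter (DirectedLattice.flip d))
  letter_commute : ∀ c d, c ≠ d → c ≠ DirectedLattice.flip d →
    ∀ g, Commute (letter c) (emb (act d g))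

namespace DirectedLattice
variable {E : Type v}

theorem flip_ne (d : E × Bool) : flip d ≠ d := by
  obtain ⟨e, b⟩ := d
  cases b <;> simp [flip]

theorem flip_flip (d : E × Bool) : flip (flip d) = d := by
  obtain ⟨e, b⟩ := d
  cases b <;> simp [flip]

end DirectedLattice

namespace FaceCalculus
variable {W : Type u} {M B : Type*} {E : Type v} [Ring W] [Algebra ℂ W]
    [WeakBialgebra W] [Ring M] [Algebra ℂ M] [Ring B] [Algebra ℂ B] (F : FaceCalculus W M B E)

/-- The action at a dart, in the convolution algebra of words. -/
def actConv (d : E × Bool) : WithConv (W →ₗ[ℂ] B) := toConv (F.emb.toLinearMap ∘ₗ F.act d)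

/-- The insertion, in the convolution algebra of words. -/
def markConv : WithConv (W →ₗ[ℂ] B) := toConv F.mark

/-- Evaluation of words depending on an element of `W`. -/
def evalConv (f : WithConv (W →ₗ[ℂ] B)) : WithConv (W →ₗ[ℂ] M) := toConv (F.eval ∘ₗ f.ofConv)

theorem actConv_apply (d : E × Bool) (g : W) : F.actConv d g = F.emb (F.act d g) := rfl

theorem markConv_apply (g : W) : F.markConv g = F.mark g := rfl

theorem evalConv_apply (f : WithConv (W →ₗ[ℂ] B)) (g : W) : F.evalConv f g = F.eval (f g) := rfl

theorem evalConv_mul_actConv (f : WithConv (W →ₗ[ℂ] B)) (d : E × Bool) :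
    F.evalConv (f * F.actConv d) = F.evalConv f * toConv (F.act d) := by
  ext g
  change F.evalConv (f * F.actConv d) g = (F.evalConv f * toConv (F.act d)) g
  rw [evalConv_apply, (ℛ ℂ g).convMul_apply, (ℛ ℂ g).convMul_apply]
  simp [actConv_apply, evalConv_apply, F.eval_mul_emb]

theorem evalConv_actConv_mul (f : WithConv (W →ₗ[ℂ] B)) (d : E × Bool) :
    F.evalConv (F.actConv d * f) = toConv (F.act d) * F.evalConv f := by
  ext g
  change F.evalConv (F.actConv d * f) g = (toConv (F.act d) * F.evalConv f) g
  rw [evalConv_apply, (ℛ ℂ g).convMul_apply, (ℛ ℂ g).convMul_apply]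
  simp [actConv_apply, evalConv_apply, F.eval_emb_mul]

theorem evalConv_markConv_mul (a : B) :
    F.evalConv (F.markConv * constConv W a) = F.evalConv (constConv W a * F.markConv) := by
  ext g
  change F.evalConv _ g = F.evalConv _ g
  rw [evalConv_apply, evalConv_apply, constConv_mul_apply, mul_constConv_apply, markConv_apply,
    F.eval_mark_mul]

theorem constConv_commute_actConv {b : B} (hb : ∀ m, Commute b (F.emb m)) (d : E × Bool) :
    Commute (constConv W b) (F.actConv d) :=
  constConv_commute fun g => by rw [actConv_apply]; exact hb _

variable [DecidableEq E]

/-- The word around a face, decorated by `b`, with an insertion to the left of the letter `q`. -/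
def wordL (l : List (E × Bool)) (q : E × Bool) (b : E × Bool → B) : WithConv (W →ₗ[ℂ] M) :=
  F.evalConv (l.map fun c =>
    (if c = q then F.markConv else 1) * constConv W (b c * F.letter c)).prod

/-- The word around a face, decorated by `b`, with an insertion between the decoration at `d` and
the letter `d`. -/
def wordR (l : List (E × Bool)) (d : E × Bool) (b : E × Bool → B) : WithConv (W →ₗ[ℂ] M) :=
  F.evalConv (l.map fun c =>
    constConv W (b c) * ((if c = d then F.markConv else 1) * constConv W (F.letter c))).prod

theorem wordL_eq_wordR (l : List (E × Bool)) {d : E × Bool} {b : E × Bool → B} (hb : b d = 1) :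
    F.wordL l d b = F.wordR l d b := by
  rw [wordL, wordR]
  congr 3
  funext c
  by_cases hc : c = d
  · subst hc
    simp [hb, constConv_one]
  · simp [hc, constConv_mul]

variable [Fintype E] (p : Equiv.Perm (E × Bool)) (x : E × Bool)

/-- An insertion before `q` is one after the preceding letter. If `q` heads the list, that letter is
the last one, and the trace property of the evaluation closes the word. -/
theorem evalConv_shift (q : E × Bool) (a : E × Bool → B) :
    F.evalConv ((DirectedLattice.cycleList p x).map fun c =>
      constConv W (a c) * (if p c = q then F.markConv else 1)).prod =
    F.evalConv ((DirectedLattice.cycleList p x).map fun c =>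
      (if c = q then F.markConv else 1) * constConv W (a c)).prod := by
  by_cases hx : x = q
  · subst hx
    obtain ⟨l, h1, -⟩ := DirectedLattice.cycleList_rotate p x
    obtain ⟨l', h2, h3⟩ := DirectedLattice.cycleList_rotate p (p.symm x)
    rw [Equiv.apply_symm_apply] at h3
    have n1 := DirectedLattice.cycleList_nodup p x
    have n2 := DirectedLattice.cycleList_nodup p (p.symm x)
    rw [h1, List.nodup_cons] at n1
    rw [h2, List.nodup_cons] at n2
    have e1 : ((DirectedLattice.cycleList p x).map fun c =>
        (if c = x then F.markConv else 1) * constConv W (a c)).prod =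
        F.markConv * constConv W ((DirectedLattice.cycleList p x).map a).prod := by
      rw [h1, list_prod_mul_eq_of_forall_eq_one, if_pos rfl, list_prod_constConv]
      intro d hd
      exact if_neg (by rintro rfl; exact n1.1 hd)
    have e2 : ((DirectedLattice.cycleList p x).map fun c =>
        constConv W (a c) * (if p c = x then F.markConv else 1)).prod =
        constConv W ((DirectedLattice.cycleList p x).map a).prod * F.markConv := by
      rw [h3, list_prod_mul_eq_of_forall_eq_one' (w := fun c => if p c = x then F.markConv else 1),
        if_pos (Equiv.apply_symm_apply p x), list_prod_constConv]
      intro d hd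
      exact if_neg (by rintro rfl; exact n2.1 (by simpa using hd))
    rw [e1, e2, evalConv_markConv_mul]
  · have h := DirectedLattice.mul_cycleList_prod p x (fun c => constConv W (a c))
      (fun c => if c = q then F.markConv else 1)
    rw [if_neg hx, one_mul, mul_one] at h
    rw [h]

/-- Moving the action at a dart through a word around a face. -/
theorem wordL_mul_act {d q : E × Bool} (hd : p (DirectedLattice.flip d) = q) {b : E × Bool → B}
    (hb : ∀ c m, Commute (b c) (F.emb m)) :
    F.wordL (DirectedLattice.cycleList p x) q b * toConv (F.act d) =
      toConv (F.act d) * F.wordR (DirectedLattice.cycleList p x) d b := by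
  rw [wordL, ← evalConv_shift, ← evalConv_mul_actConv, wordR, ← evalConv_actConv_mul]
  congr 1
  refine list_prod_mul_of_semiconj fun c _ => ?_
  have hbc := (F.constConv_commute_actConv (hb c) d).eq
  have hpc : p c = q ↔ c = DirectedLattice.flip d := by
    rw [← hd]
    exact p.injective.eq_iff
  rw [constConv_mul]
  -- The reverse of `d` absorbs the insertion that follows it, the letter `d` creates a new one
  -- before itself, and every other letter commutes with the action.
  by_cases h1 : c = DirectedLattice.flip d
  · rw [if_pos (hpc.2 h1), if_neg (h1 ▸ DirectedLattice.flip_ne d), one_mul, mul_assoc, mul_assoc]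
    subst h1
    have := F.letter_flip_mul_act d
    change constConv W (F.letter (DirectedLattice.flip d)) * (F.markConv * F.actConv d) =
      F.actConv d * _ at this
    rw [this, ← mul_assoc, hbc, mul_assoc]
  · rw [if_neg (mt hpc.1 h1), mul_one]
    by_cases h2 : c = d
    · subst h2
      have := F.letter_mul_act c
      change constConv W (F.letter c) * F.actConv c = F.actConv c * (F.markConv * _) at this
      rw [if_pos rfl, mul_assoc, this, ← mul_assoc, hbc, mul_assoc]
    · have := (constConv_commute (W := W) (f := F.actConv d) fun g => F.letter_commute c d h2 h1 g).eq
      rw [if_neg h2, one_mul, mul_assoc, this, ← mul_assoc, hbc, mul_assoc]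

end FaceCalculus

namespace FaceCalculus
variable {W : Type u} {M B : Type*} {E : Type v} [Ring W] [Algebra ℂ W]
    [WeakBialgebra W] [Ring M] [Algebra ℂ M] [Ring B] [Algebra ℂ B] (F : FaceCalculus W M B E)
    [DecidableEq E]

theorem wordL_of_notMem {l : List (E × Bool)} {q : E × Bool} (hq : q ∉ l) :
    F.wordL l q 1 = constConv W (F.eval (l.map F.letter).prod) := by
  have e : (l.map fun c => (if c = q then F.markConv else 1) *
      constConv W ((1 : E × Bool → B) c * F.letter c)) = l.map fun c => constConv W (F.letter c) :=
    List.map_congr_left fun c hc => by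
      rw [if_neg (by rintro rfl; exact hq hc), one_mul, Pi.one_apply, one_mul]
  ext g
  change F.wordL l q 1 g = _
  rw [wordL, evalConv_apply, e, list_prod_constConv, constConv_apply, map_smul]
  rfl

/-- Decoration by an element of `W` at one letter. -/
def mark1 (q : E × Bool) (w : W) : E × Bool → B := fun c => if c = q then F.mark w else 1

theorem commute_mark1_emb (q : E × Bool) (w : W) (c : E × Bool) (m : M) :
    Commute (F.mark1 q w c) (F.emb m) := by
  rw [mark1]
  split_ifs
  · exact F.commute_mark_emb w m
  · exact Commute.one_left _

theorem wordL_one_apply {l : List (E × Bool)} (hl : l.Nodup) {q : E × Bool} (hq : q ∈ l) (g : W) :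
    F.wordL l q 1 g = F.eval (l.map fun c =>
      if c = q then F.mark g * F.letter q else F.letter c).prod := by
  have e : (l.map fun c => (if c = q then F.markConv else 1) *
      constConv W ((1 : E × Bool → B) c * F.letter c)) =
      l.map fun c => if c = q then F.markConv * constConv W (F.letter q)
        else constConv W (F.letter c) := by
    refine List.map_congr_left fun c _ => ?_
    split_ifs with h
    · rw [Pi.one_apply, one_mul, h]
    · rw [Pi.one_apply, one_mul, one_mul]
  rw [wordL, evalConv_apply, e, list_prod_constConv_ite_apply hl hq, mul_constConv_apply,
    markConv_apply]

theorem wordL_mark1_apply {l : List (E × Bool)} (hl : l.Nodup) {q : E × Bool} (hq : q ∈ l)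
    (w g : W) : F.wordL l q (F.mark1 q w) g = F.wordL l q 1 (g * w) := by
  have e : (l.map fun c => (if c = q then F.markConv else 1) *
      constConv W (F.mark1 q w c * F.letter c)) =
      l.map fun c => if c = q then F.markConv * constConv W (F.mark w * F.letter q)
        else constConv W (F.letter c) := by
    refine List.map_congr_left fun c _ => ?_
    rw [mark1]
    split_ifs with h
    · rw [h]
    · rw [one_mul, one_mul]
  rw [wordL_one_apply F hl hq, wordL, evalConv_apply, e, list_prod_constConv_ite_apply hl hq,
    mul_constConv_apply, markConv_apply, F.mark_mul, mul_assoc]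

theorem wordR_mark1_apply {l : List (E × Bool)} (hl : l.Nodup) {q : E × Bool} (hq : q ∈ l)
    (w g : W) : F.wordR l q (F.mark1 q w) g = F.wordL l q 1 (w * g) := by
  have e : (l.map fun c => constConv W (F.mark1 q w c) *
      ((if c = q then F.markConv else 1) * constConv W (F.letter c))) =
      l.map fun c => if c = q then constConv W (F.mark w) * (F.markConv * constConv W (F.letter q))
        else constConv W (F.letter c) := by
    refine List.map_congr_left fun c _ => ?_
    rw [mark1]
    split_ifs with h
    · rw [h]
    · rw [one_mul, constConv_one, one_mul]
  rw [wordL_one_apply F hl hq, wordR, evalConv_apply, e, list_prod_constConv_ite_apply hl hq,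
    constConv_mul_apply, mul_constConv_apply, markConv_apply, F.mark_mul, mul_assoc]

omit [DecidableEq E] in
theorem actConv_mul (d : E × Bool) (x y : W) :
    F.actConv d (x * y) = F.actConv d x * F.actConv d y := by
  simp [actConv_apply, F.act_mul]

/-- Only the reverse of `d` is in question. On `ε_R(a)` the insertion convolved with the action is
its value at `1` times the action of `ε_R(a)`, and the letter absorbs that value. -/
theorem letter_commute_epsR {c d : E × Bool} (hcd : c ≠ d) (a : W) :
    Commute (F.letter c) (F.emb (F.act d (epsR a))) := by
  by_cases h : c = DirectedLattice.flip d
  · subst h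
    have key : ∀ y, F.letter (DirectedLattice.flip d) * (F.markConv * F.actConv d) y =
        F.emb (F.act d y) * F.letter (DirectedLattice.flip d) := by
      intro y
      have := congrArg (fun f : WithConv (W →ₗ[ℂ] B) => f y) (F.letter_flip_mul_act d)
      beta_reduce at this
      rw [constConv_mul_apply, mul_constConv_apply] at this
      exact this
    have h1 := key (epsR a)
    have h2 := key 1
    rw [F.act_one, map_one F.emb, one_mul] at h2
    rw [convMul_apply_epsR (F.actConv_mul d), ← mul_assoc, h2] at h1
    exact h1
  · exact F.letter_commute c d hcd h _

/-- The unit component of an action followed by a word with an insertion at the same dart. -/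
theorem act_mul_wordR_one {l : List (E × Bool)} (hl : l.Nodup) (d : E × Bool) :
    (toConv (F.act d) * F.wordR l d 1) 1 = F.eval (l.map F.letter).prod := by
  rw [wordR, ← evalConv_actConv_mul, evalConv_apply]
  congr 1
  simp only [Pi.one_apply, constConv_one, one_mul]
  induction l with
  | nil => simp [actConv_apply, F.act_one]
  | cons c l ih =>
    rw [List.nodup_cons] at hl
    rw [List.map_cons, List.prod_cons, List.map_cons, List.prod_cons]
    by_cases hc : c = d
    · subst hc
      have e : (l.map fun c' => (if c' = c then F.markConv else 1) * constConv W (F.letter c')) =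
          l.map fun c' => constConv W (F.letter c') :=
        List.map_congr_left fun c' hc' => by
          rw [if_neg (by rintro rfl; exact hl.1 hc'), one_mul]
      have := F.letter_mul_act c
      change constConv W (F.letter c) * F.actConv c = F.actConv c * (F.markConv * _) at this
      rw [e, list_prod_constConv, if_pos rfl, ← mul_assoc, ← this, mul_assoc, constConv_mul_apply,
        mul_constConv_apply, actConv_apply, F.act_one, map_one, one_mul]
    -- The action carries the first leg of `Δ(1)`, which lies in `ε_R(W)`, so it passes the letters
    -- that precede `d`.
    · rw [if_neg hc, one_mul, ← ih hl.2, convMul_one_eq_epsR, convMul_one_eq_epsR, Finset.mul_sum]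
      refine Finset.sum_congr rfl fun i _ => ?_
      rw [constConv_mul_apply, ← mul_assoc, ← mul_assoc, actConv_apply,
        (F.letter_commute_epsR hc _).eq]

variable [Fintype E] (p r : Equiv.Perm (E × Bool)) (x s : E × Bool)

/-- Moving all actions around a vertex through a word around a face. -/
theorem wordL_mul_convList (hpr : ∀ d, p (DirectedLattice.flip d) = r.symm d) {b : E × Bool → B}
    (hb : ∀ c m, Commute (b c) (F.emb m)) (hb1 : ∀ c, c ≠ r.symm s → b c = 1) :
    F.wordL (DirectedLattice.cycleList p x) (r.symm s) b *
        convList F.act (DirectedLattice.cycleList r s) =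
      convList F.act (DirectedLattice.cycleList r s) *
        F.wordR (DirectedLattice.cycleList p x) (r.symm s) b := by
  set l := DirectedLattice.cycleList p x
  have step : ∀ n : ℕ, F.wordL l (r.symm ((r ^ n) s)) b * toConv (F.act ((r ^ n) s)) =
      toConv (F.act ((r ^ n) s)) * F.wordR l ((r ^ n) s) b := fun n =>
    F.wordL_mul_act p x (hpr _) hb
  have hsucc : ∀ n : ℕ, r.symm ((r ^ (n + 1)) s) = (r ^ n) s := fun n => by
    rw [pow_succ', Equiv.Perm.mul_apply, Equiv.symm_apply_apply]
  -- After `n` darts the travelling insertion has advanced by `n` corners. The last dart is kept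
  -- apart: there the insertion returns to the corner carrying the decoration and ends on its other
  -- side.
  have key : ∀ n : ℕ, n < Function.minimalPeriod r s →
      F.wordL l (r.symm s) b * convList F.act ((List.range n).map fun k => (r ^ k) s) =
        convList F.act ((List.range n).map fun k => (r ^ k) s) *
          F.wordL l (r.symm ((r ^ n) s)) b := by
    intro n
    induction n with
    | zero => intro _; simp
    | succ n ih =>
      intro hn
      -- Equality would close the cycle too early. Hence the decoration at this dart is trivial, and
      -- it does not matter on which side of it the insertion sits.
      have hne : (r ^ n) s ≠ r.symm s := by
        intro h
        have h' : (r ^ (n + 1)) s = s := by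
          rw [pow_succ', Equiv.Perm.mul_apply, h, Equiv.apply_symm_apply]
        have : Function.IsPeriodicPt r (n + 1) s := by
          rw [Function.IsPeriodicPt, Function.IsFixedPt, Equiv.Perm.iterate_eq_pow, h']
        exact absurd (this.minimalPeriod_le n.succ_pos) (by omega)
      rw [List.range_succ, List.map_append, convList_append, ← mul_assoc, ih (by omega),
        List.map_singleton, convList_cons, convList_nil, mul_one, mul_assoc, step, hsucc,
        F.wordL_eq_wordR l (hb1 _ hne), mul_assoc]
  obtain ⟨m, hm⟩ := Nat.exists_eq_succ_of_ne_zero (DirectedLattice.minimalPeriod_pos r s).ne'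
  have hlast : (r ^ m) s = r.symm s := by
    have := DirectedLattice.pow_minimalPeriod r s
    rw [hm, Nat.succ_eq_add_one] at this
    rw [← hsucc, this]
  rw [DirectedLattice.cycleList, hm, Nat.succ_eq_add_one, List.range_succ, List.map_append,
    convList_append, ← mul_assoc, key m (by omega), List.map_singleton, convList_cons,
    convList_nil, mul_one, mul_assoc, step, mul_assoc, hlast]

end FaceCalculus

/-! ### From an exchange relation to commutation with `A(h)` -/

section Exchange
variable {W : Type u} {M : Type*} [Ring W] [Algebra ℂ W] [WeakHopfAlgebra W] [Ring M] [Algebra ℂ M]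
local notation "𝒮" => WeakHopfAlgebra.antipode

theorem mul_comm_rTensor_antipode (hS : ∀ x : W, (𝒮 (𝒮 x) : W) = x) (x : W) :
    mul' ℂ W (TensorProduct.comm ℂ W W (rTensor W 𝒮 (comul x))) = epsROp W x := by
  rw [← antipode_epsL hS, ← WeakHopfAlgebra.mul_lTensor_antipode, ← (ℛ ℂ x).eq]
  simp [antipode_mul, hS]

theorem mul_comm_lTensor_antipode (hS : ∀ x : W, (𝒮 (𝒮 x) : W) = x) (x : W) :
    mul' ℂ W (TensorProduct.comm ℂ W W (lTensor W 𝒮 (comul x))) = epsLOp W x := by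
  rw [← antipode_epsR hS, ← WeakHopfAlgebra.mul_rTensor_antipode, ← (ℛ ℂ x).eq]
  simp [antipode_mul, hS]

theorem convMul_one_mul_apply {A γ : WithConv (W →ₗ[ℂ] M)}
    (hA : ∀ x y, A (x * y) = A x * A y) (h : W) :
    (toConv (γ.ofConv ∘ₗ epsROp W) * A) h = (γ * A) 1 * A h := by
  have e : (toConv (γ.ofConv ∘ₗ epsROp W) * A) h =
      mul' ℂ M (TensorProduct.map γ.ofConv A.ofConv
        (TensorProduct.map (epsROp W) LinearMap.id (comul h))) := by
    rw [convMul_apply, ← (ℛ ℂ h).eq]; simp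
  rw [e, map_epsROp_id_comul, (ℛ ℂ (1 : W)).convMul_apply, ← (ℛ ℂ (1 : W)).eq]
  simp [Finset.sum_mul, hA, mul_assoc]

theorem apply_mul_convMul_one {A γ : WithConv (W →ₗ[ℂ] M)}
    (hA : ∀ x y, A (x * y) = A x * A y) (h : W) :
    (A * toConv (γ.ofConv ∘ₗ epsLOp W)) h = A h * (A * γ) 1 := by
  have e : (A * toConv (γ.ofConv ∘ₗ epsLOp W)) h =
      mul' ℂ M (TensorProduct.map A.ofConv γ.ofConv
        (TensorProduct.map LinearMap.id (epsLOp W) (comul h))) := by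
    rw [convMul_apply, ← (ℛ ℂ h).eq]; simp
  rw [e, map_id_epsLOp_comul, (ℛ ℂ (1 : W)).convMul_apply, ← (ℛ ℂ (1 : W)).eq]
  simp [Finset.mul_sum, hA, mul_assoc]

/-- An exchange relation between `A` and `γ` makes `A(h)` commute with the unit components. -/
theorem unit_mul_apply_of_exchange (hS : ∀ x : W, (𝒮 (𝒮 x) : W) = x) {h : W}
    (hcoc : IsCocommutative h) {A γ : WithConv (W →ₗ[ℂ] M)} (hA : ∀ x y, A (x * y) = A x * A y)
    (hex : ∀ w, toConv (γ.ofConv ∘ₗ mulRight ℂ w) * A = A * toConv (γ.ofConv ∘ₗ mulLeft ℂ w)) :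
    (γ * A) 1 * A h = A h * (A * γ) 1 := by
  rw [← convMul_one_mul_apply hA, ← apply_mul_convMul_one hA]
  -- `G(a ⊗ b ⊗ c) = γ(bS(a))A(c)` and `G'(a ⊗ b ⊗ c) = A(a)γ(S(c)b)`; the products inside `γ`
  -- collapse to `ε'_R` and `ε'_L` on the threefold coproduct of `h`.
  let G : W ⊗[ℂ] (W ⊗[ℂ] W) →ₗ[ℂ] M := mul' ℂ M ∘ₗ
    TensorProduct.map (γ.ofConv ∘ₗ mul' ℂ W ∘ₗ (TensorProduct.comm ℂ W W).toLinearMap ∘ₗ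
      rTensor W 𝒮) A.ofConv ∘ₗ (TensorProduct.assoc ℂ W W W).symm.toLinearMap
  let G' : W ⊗[ℂ] (W ⊗[ℂ] W) →ₗ[ℂ] M := mul' ℂ M ∘ₗ
    TensorProduct.map A.ofConv (γ.ofConv ∘ₗ mul' ℂ W ∘ₗ (TensorProduct.comm ℂ W W).toLinearMap ∘ₗ
      lTensor W 𝒮)
  have h1 : G (lTensor W comul (comul h)) = (toConv (γ.ofConv ∘ₗ epsROp W) * A) h := by
    rw [← coassoc_apply, convMul_apply, ← (ℛ ℂ h).eq]
    simp [G, mul_comm_rTensor_antipode hS]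
  have h2 : G' (TensorProduct.assoc ℂ W W W (rTensor W comul (comul h))) =
      (A * toConv (γ.ofConv ∘ₗ epsLOp W)) h := by
    rw [coassoc_apply, convMul_apply, ← (ℛ ℂ h).eq]
    simp [G', mul_comm_lTensor_antipode hS]
  have h3 : ∀ a b : W, G (a ⊗ₜ comul b) = (toConv (γ.ofConv ∘ₗ mulRight ℂ (𝒮 a)) * A) b := by
    intro a b
    rw [convMul_apply, ← (ℛ ℂ b).eq]
    simp [G, TensorProduct.tmul_sum]
  have h4 : ∀ a b : W, G' (TensorProduct.assoc ℂ W W W (comul b ⊗ₜ a)) =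
      (A * toConv (γ.ofConv ∘ₗ mulLeft ℂ (𝒮 a))) b := by
    intro a b
    rw [convMul_apply, ← (ℛ ℂ b).eq]
    simp [G', TensorProduct.sum_tmul]
  -- Cocommutativity lets the isolated leg of `h` stand last instead of first. The two sums then
  -- agree term by term by the exchange relation with `w` the antipode of that leg.
  rw [← h1, ← h2]
  conv_rhs => rw [← hcoc]
  rw [← (ℛ ℂ h).eq]
  simp only [map_sum, lTensor_tmul, TensorProduct.comm_tmul, rTensor_tmul, h3, h4, hex]

end Exchange

/-! ### Face words as maps from the dual to operators -/

section DualWords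
variable {W : Type u} [Ring W] [Algebra ℂ W] [Module.Finite ℂ W] {M : Type*} [Ring M] [Algebra ℂ M]

/-- The functional `ψ ↦ ψ(w)` as an element of the convolution algebra. -/
def dualMark (W : Type u) [Ring W] [Algebra ℂ W] [Module.Finite ℂ W] (M : Type*) [Ring M]
    [Algebra ℂ M] : W →ₗ[ℂ] WithConv (DualAlg W →ₗ[ℂ] M) where
  toFun w := toConv ((Module.Dual.eval ℂ W w ∘ₗ
    (WithConv.linearEquiv ℂ (W →ₗ[ℂ] ℂ)).toLinearMap).smulRight 1)
  map_add' x y := by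
    ext ψ
    simp [add_smul]
  map_smul' c x := by
    ext ψ
    simp [mul_smul]

theorem dualMark_apply (w : W) (ψ : DualAlg W) : dualMark W M w ψ = ψ w • (1 : M) := rfl

theorem dualMulLeft_eq_sum {ι : Type*} {ψ : DualAlg W} (r : Coalgebra.Repr ℂ ψ ι) (w : W) :
    dualMulLeft w ψ = ∑ i ∈ r.index, r.left i w • r.right i := by
  ext y
  have h := pair_comul ψ w y
  rw [← r.eq] at h
  change ψ (w * y) = _
  rw [← h]
  simp

theorem dualMulRight_eq_sum {ι : Type*} {ψ : DualAlg W} (r : Coalgebra.Repr ℂ ψ ι) (w : W) :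
    dualMulRight w ψ = ∑ i ∈ r.index, r.right i w • r.left i := by
  ext y
  have h := pair_comul ψ y w
  rw [← r.eq] at h
  change ψ (y * w) = _
  rw [← h]
  simp [mul_comm]

theorem dualMark_mul_apply (w : W) (f : WithConv (DualAlg W →ₗ[ℂ] M)) (ψ : DualAlg W) :
    (dualMark W M w * f) ψ = f (dualMulLeft w ψ) := by
  rw [(ℛ ℂ ψ).convMul_apply, dualMulLeft_eq_sum (ℛ ℂ ψ)]
  simp [dualMark_apply]

theorem mul_dualMark_apply (w : W) (f : WithConv (DualAlg W →ₗ[ℂ] M)) (ψ : DualAlg W) :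
    (f * dualMark W M w) ψ = f (dualMulRight w ψ) := by
  rw [(ℛ ℂ ψ).convMul_apply, dualMulRight_eq_sum (ℛ ℂ ψ)]
  simp [dualMark_apply]

/-- Operators as constant elements of the convolution algebra. -/
def dualEmb (W : Type u) [Ring W] [Algebra ℂ W] [Module.Finite ℂ W] (M : Type*) [Ring M]
    [Algebra ℂ M] : M →ₐ[ℂ] WithConv (DualAlg W →ₗ[ℂ] M) :=
  AlgHom.ofLinearMap
    { toFun := constConv (DualAlg W)
      map_add' := fun a b => by ext ψ; simp [constConv]
      map_smul' := fun c a => by ext ψ; simp [constConv, smul_comm c] }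
    constConv_one constConv_mul

theorem dualEmb_mul_apply (m : M) (f : WithConv (DualAlg W →ₗ[ℂ] M)) (ψ : DualAlg W) :
    (dualEmb W M m * f) ψ = m * f ψ := constConv_mul_apply m f ψ

theorem mul_dualEmb_apply (m : M) (f : WithConv (DualAlg W →ₗ[ℂ] M)) (ψ : DualAlg W) :
    (f * dualEmb W M m) ψ = f ψ * m := mul_constConv_apply f m ψ

theorem dualMark_mul (x y : W) :
    dualMark W M (x * y) = dualMark W M x * dualMark W M y := by
  ext ψ
  change dualMark W M (x * y) ψ = (dualMark W M x * dualMark W M y) ψ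
  rw [dualMark_mul_apply, dualMark_apply, dualMark_apply, dualMulLeft_apply]

theorem dualMark_commute_dualEmb (w : W) (m : M) : Commute (dualMark W M w) (dualEmb W M m) := by
  ext ψ
  change (dualMark W M w * dualEmb W M m) ψ = (dualEmb W M m * dualMark W M w) ψ
  rw [mul_dualEmb_apply, dualEmb_mul_apply, dualMark_apply, smul_mul_assoc, one_mul,
    mul_smul_comm, mul_one]

theorem commute_dualEmb {f : WithConv (DualAlg W →ₗ[ℂ] M)} {m : M} (h : ∀ ψ, Commute (f ψ) m) :
    Commute f (dualEmb W M m) := by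
  ext ψ
  change (f * dualEmb W M m) ψ = (dualEmb W M m * f) ψ
  rw [mul_dualEmb_apply, dualEmb_mul_apply, (h ψ).eq]

section
variable [Coalgebra ℂ W] {t : DualAlg W →ₗ[ℂ] M} {a : W →ₗ[ℂ] M}

/-- Carries the local relation, stated for each `g` and `ψ`, to the convolution algebra over `W` of
words; the next lemma does so for the relation that absorbs an insertion. -/
theorem constConv_mul_dualEmb (h : ∀ g ψ, t ψ * a g = ∑ i ∈ (ℛ ℂ g).index,
      a ((ℛ ℂ g).left i) * t (dualMulLeft ((ℛ ℂ g).right i) ψ)) :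
    constConv W (toConv t) * toConv ((dualEmb W M).toLinearMap ∘ₗ a) =
      toConv ((dualEmb W M).toLinearMap ∘ₗ a) *
        (toConv (dualMark W M) * constConv W (toConv t)) := by
  ext1
  refine LinearMap.ext fun g => ?_
  change (constConv W (toConv t) * toConv ((dualEmb W M).toLinearMap ∘ₗ a)) g =
    (toConv ((dualEmb W M).toLinearMap ∘ₗ a) *
        (toConv (dualMark W M) * constConv W (toConv t))) g
  rw [constConv_mul_apply, (ℛ ℂ g).convMul_apply]
  ext ψ
  simp only [mul_constConv_apply]
  change (toConv t * dualEmb W M (a g)) ψ = (∑ i ∈ (ℛ ℂ g).index,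
    dualEmb W M (a ((ℛ ℂ g).left i)) * (dualMark W M ((ℛ ℂ g).right i) * toConv t)).ofConv ψ
  rw [mul_dualEmb_apply, WithConv.ofConv_sum, LinearMap.sum_apply]
  simp only [dualEmb_mul_apply, dualMark_mul_apply]
  exact h g ψ

theorem constConv_mul_dualMark_mul_dualEmb (h : ∀ g ψ, ∑ i ∈ (ℛ ℂ g).index,
      t (dualMulRight ((ℛ ℂ g).left i) ψ) * a ((ℛ ℂ g).right i) = a g * t ψ) :
    constConv W (toConv t) * (toConv (dualMark W M) * toConv ((dualEmb W M).toLinearMap ∘ₗ a)) =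
      toConv ((dualEmb W M).toLinearMap ∘ₗ a) * constConv W (toConv t) := by
  ext1
  refine LinearMap.ext fun g => ?_
  change (constConv W (toConv t) * (toConv (dualMark W M) *
    toConv ((dualEmb W M).toLinearMap ∘ₗ a))) g =
      (toConv ((dualEmb W M).toLinearMap ∘ₗ a) * constConv W (toConv t)) g
  rw [constConv_mul_apply, mul_constConv_apply, (ℛ ℂ g).convMul_apply, Finset.mul_sum]
  ext ψ
  change (∑ i ∈ (ℛ ℂ g).index, toConv t * (dualMark W M ((ℛ ℂ g).left i) *
    dualEmb W M (a ((ℛ ℂ g).right i)))).ofConv ψ = (dualEmb W M (a g) * toConv t) ψ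
  rw [dualEmb_mul_apply, WithConv.ofConv_sum, LinearMap.sum_apply]
  simp only [← mul_assoc, mul_dualEmb_apply, mul_dualMark_apply]
  exact h g ψ

end

end DualWords

/-! ### The face calculus of the lattice model -/

section Lattice
variable {W : Type u} [Ring W] [Algebra ℂ W] [WeakHopfAlgebra W] [Module.Finite ℂ W]
  {E : Type v} [DecidableEq E]
local notation "𝒮" => WeakHopfAlgebra.antipode

omit [Module.Finite ℂ W] in
theorem dartL_one (hS : ∀ x : W, (𝒮 (𝒮 x) : W) = x) (d : E × Bool) :
    dartL d (1 : W) = (1 : Module.End ℂ (TotalSpace W E)) := by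
  have h : (if d.2 then (Lminus : W →ₗ[ℂ] Module.End ℂ W) else Lplus) 1 = 1 := by
    split_ifs
    · ext x; simp [Lminus_apply hS, antipode_one]
    · ext x; simp [Lplus_apply]
  refine PiTensorProduct.ext (MultilinearMap.ext fun x => ?_)
  simp [dartL, h, onEdge_tprod]

/-- The words of the lattice model, evaluated at a tracial functional. -/
def latticeCalculus (hS : ∀ x : W, (𝒮 (𝒮 x) : W) = x) {φ : DualAlg W}
    (hφ : ∀ x y : W, φ (x * y) = φ (y * x)) :
    FaceCalculus W (Module.End ℂ (TotalSpace W E))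
      (WithConv (DualAlg W →ₗ[ℂ] Module.End ℂ (TotalSpace W E))) E where
  letter c := toConv (dartT c)
  mark := dualMark W _
  emb := dualEmb W _
  eval :=
    { toFun := fun f => f φ
      map_add' := fun f g => rfl
      map_smul' := fun c f => rfl }
  act := dartL
  act_mul := dartL_mul hS
  act_one := dartL_one hS
  mark_mul := dualMark_mul
  commute_mark_emb := dualMark_commute_dualEmb
  eval_emb_mul m a := dualEmb_mul_apply m a φ
  eval_mul_emb a m := mul_dualEmb_apply m a φ
  -- An insertion before the word replaces `φ` by `φ(w ·)`, one after it by `φ(· w)`; these agree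
  -- for a trace.
  eval_mark_mul w a := by
    refine (dualMark_mul_apply w a φ).trans (Eq.trans ?_ (mul_dualMark_apply w a φ).symm)
    congr 1
    ext x
    exact hφ w x
  letter_mul_act d := constConv_mul_dualEmb fun g ψ => dartT_mul_dartL hS d (ℛ ℂ g) ψ
  letter_flip_mul_act d :=
    constConv_mul_dualMark_mul_dualEmb fun g ψ => sum_dartT_flip_mul_dartL hS d (ℛ ℂ g) ψ
  letter_commute c d hcd hcd' g := commute_dualEmb fun ψ => dartT_commute_dartL hcd hcd' ψ g

end Lattice

/-! ### Commutation of vertex and face operators -/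

namespace FaceCalculus
variable {W : Type u} {M B : Type*} {E : Type v} [Ring W] [Algebra ℂ W]
    [WeakHopfAlgebra W] [Ring M] [Algebra ℂ M] [Ring B] [Algebra ℂ B] (F : FaceCalculus W M B E)
    [DecidableEq E] [Fintype E] (p r : Equiv.Perm (E × Bool)) (x s : E × Bool)
local notation "𝒮" => WeakHopfAlgebra.antipode

/-- Crossing the first dart moves the insertion to that dart, where the legs of `Δ(1)` recombine and
vanish; the remaining darts only see `1`. -/
theorem wordL_mul_convList_one (hpr : ∀ d, p (DirectedLattice.flip d) = r.symm d) :
    (F.wordL (DirectedLattice.cycleList p x) (r.symm s) 1 *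
      convList F.act (DirectedLattice.cycleList r s)) 1 =
    F.eval ((DirectedLattice.cycleList p x).map F.letter).prod *
      convList F.act (DirectedLattice.cycleList r s) 1 := by
  obtain ⟨l', h, -⟩ := DirectedLattice.cycleList_rotate r s
  rw [h, convList_cons, ← mul_assoc]
  refine convMul_convMul_one (F.act_mul s) ?_
  rw [F.wordL_mul_act p x (hpr s) (b := 1) fun _ _ => Commute.one_left _]
  exact F.act_mul_wordR_one (DirectedLattice.cycleList_nodup p x) s

theorem convList_mul_wordL_one :
    (convList F.act (DirectedLattice.cycleList r s) *
      F.wordL (DirectedLattice.cycleList p x) (r.symm s) 1) 1 =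
    convList F.act (DirectedLattice.cycleList r s) 1 *
      F.eval ((DirectedLattice.cycleList p x).map F.letter).prod := by
  obtain ⟨l', -, h⟩ := DirectedLattice.cycleList_rotate r (r.symm s)
  rw [Equiv.apply_symm_apply] at h
  rw [h, convList_append, convList_cons, convList_nil, mul_one, mul_assoc]
  refine convMul_convMul_one' (F.act_mul _) ?_
  rw [F.wordL_eq_wordR _ (b := 1) rfl]
  exact F.act_mul_wordR_one (DirectedLattice.cycleList_nodup p x) _

/-- Let `B` be the evaluated word and `γ` the word with an insertion at the corner of `s`. Moving
the actions around the vertex gives the exchange relation, hence `B A(1)A(h) = A(h)A(1)B`, and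
`A(1)` is absorbed by multiplicativity. -/
theorem convList_commute_eval (hS : ∀ x : W, (𝒮 (𝒮 x) : W) = x) {h : W}
    (hcoc : IsCocommutative h) (hpr : ∀ d, p (DirectedLattice.flip d) = r.symm d)
    (hA : ∀ y z, convList F.act (DirectedLattice.cycleList r s) (y * z) =
      convList F.act (DirectedLattice.cycleList r s) y *
        convList F.act (DirectedLattice.cycleList r s) z) :
    Commute (convList F.act (DirectedLattice.cycleList r s) h)
      (F.eval ((DirectedLattice.cycleList p x).map F.letter).prod) := by
  set A := convList F.act (DirectedLattice.cycleList r s) with hAdef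
  set l := DirectedLattice.cycleList p x with hl
  have hn : l.Nodup := DirectedLattice.cycleList_nodup p x
  by_cases hq : r.symm s ∈ l
  · have hex : ∀ w, toConv ((F.wordL l (r.symm s) 1).ofConv ∘ₗ mulRight ℂ w) * A =
        A * toConv ((F.wordL l (r.symm s) 1).ofConv ∘ₗ mulLeft ℂ w) := by
      intro w
      have e1 : toConv ((F.wordL l (r.symm s) 1).ofConv ∘ₗ mulRight ℂ w) =
          F.wordL l (r.symm s) (F.mark1 (r.symm s) w) := by
        ext g
        exact (F.wordL_mark1_apply hn hq w g).symm
      have e2 : toConv ((F.wordL l (r.symm s) 1).ofConv ∘ₗ mulLeft ℂ w) =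
          F.wordR l (r.symm s) (F.mark1 (r.symm s) w) := by
        ext g
        exact (F.wordR_mark1_apply hn hq w g).symm
      rw [e1, e2]
      exact F.wordL_mul_convList p r x s hpr (F.commute_mark1_emb _ w) fun c hc => if_neg hc
    have key := unit_mul_apply_of_exchange hS hcoc hA hex
    rw [F.wordL_mul_convList_one p r x s hpr, F.convList_mul_wordL_one p r x s, mul_assoc,
      ← mul_assoc (A h), ← hA, ← hA, one_mul, mul_one] at key
    exact key.symm
  -- If the corner of `s` is not on the face, nothing is inserted at the start or at the end of the
  -- turn, and the transport identity is already the commutation.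
  · have key := congrArg (fun f : WithConv (W →ₗ[ℂ] M) => f h)
      (F.wordL_mul_convList p r x s hpr (b := 1) (fun _ _ => Commute.one_left _) fun _ _ => rfl)
    beta_reduce at key
    rw [← F.wordL_eq_wordR _ (b := 1) rfl, F.wordL_of_notMem hq, constConv_mul_apply,
      mul_constConv_apply] at key
    exact key.symm

end FaceCalculus

section SiteCommute
variable {W : Type u} [Ring W] [Algebra ℂ W] [WeakHopfAlgebra W] [Module.Finite ℂ W]
  {E : Type v} [DecidableEq E] [Fintype E] (C : DirectedLattice E)
local notation "𝒮" => WeakHopfAlgebra.antipode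

theorem siteA_commute_siteB (hS : ∀ x : W, (𝒮 (𝒮 x) : W) = x) {h : W} (hcoc : IsCocommutative h)
    {φ : DualAlg W} (hφ : ∀ x y : W, φ (x * y) = φ (y * x)) (s s' : C.Site) :
    Commute (siteA C s h) (siteB C s' φ) :=
  (latticeCalculus (E := E) hS hφ).convList_commute_eval C.faceRot C.rot (C.rot.symm s') s hS hcoc
    (fun d => by
      rw [DirectedLattice.faceRot, Equiv.trans_apply, DirectedLattice.flip_flip])
    (siteA_mul C hS s)

end SiteCommute

end

end WeakHopf

/-! ### The main theorem -/

theorem mainTheorem5 {W : Type u} [Ring W] [Algebra ℂ W] [StarRing W] [StarModule ℂ W]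
    [WeakHopf.CStarWeakHopfAlgebra W] [Module.Finite ℂ W]
    {E : Type v} [Fintype E] [DecidableEq E] (C : WeakHopf.DirectedLattice E)
    (h : W) (φ : WeakHopf.DualAlg W)
    (hh : WeakHopf.IsHaarIntegral h) (hφ : WeakHopf.IsHaarIntegral φ)
    (hcoc : WeakHopf.IsCocommutative h) :
    (∀ s : C.Site, WeakHopf.siteA C s h = WeakHopf.vertexOp C h (C.siteVertex s)) ∧
    (∀ s : C.Site, WeakHopf.siteB C s φ = WeakHopf.faceOp C φ (C.siteFace s)) ∧
    (∀ v : C.Vertex, WeakHopf.IsHermitian φ (WeakHopf.vertexOp C h v) ∧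
      IsIdempotentElem (WeakHopf.vertexOp C h v)) ∧
    (∀ f : C.Face, WeakHopf.IsHermitian φ (WeakHopf.faceOp C φ f) ∧
      IsIdempotentElem (WeakHopf.faceOp C φ f)) ∧
    (∀ (v : C.Vertex) (f : C.Face),
      Commute (WeakHopf.vertexOp C h v) (WeakHopf.faceOp C φ f)) ∧
    (∀ v v' : C.Vertex, Commute (WeakHopf.vertexOp C h v) (WeakHopf.vertexOp C h v')) ∧
    (∀ f f' : C.Face, Commute (WeakHopf.faceOp C φ f) (WeakHopf.faceOp C φ f')) := by
  have hS := WeakHopf.antipode_antipode hh hcoc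
  have hφc := hh.dual_isCocommutative hcoc hφ
  refine ⟨WeakHopf.siteA_eq_vertexOp C hS hcoc, WeakHopf.siteB_eq_faceOp C hφc,
    fun v => ⟨WeakHopf.isHermitian_siteA C hh hcoc hφ _, ?_⟩,
    fun f => ⟨WeakHopf.isHermitian_siteB C hh hcoc hφ _, ?_⟩,
    fun v f => ?_, WeakHopf.vertexOp_commute C hS h, WeakHopf.faceOp_commute C φ⟩
  · change WeakHopf.siteA C _ h * WeakHopf.siteA C _ h = WeakHopf.siteA C _ h
    rw [← WeakHopf.siteA_mul C hS, hh.mul_self]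
  · change WeakHopf.siteB C _ φ * WeakHopf.siteB C _ φ = WeakHopf.siteB C _ φ
    rw [← WeakHopf.siteB_mul, hφ.dual_mul_self]
  · exact WeakHopf.siteA_commute_siteB C hS hcoc (WeakHopf.haar_mul_comm hh hcoc hφ) _ _
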